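/- **Setting.** Let $\lambda$ be the security parameter. Let $F_\lambda:\{0,1\}^{\lambda}\times\{0,1\}^{u(\lambda)}\to\{0,1\}^{v(\lambda)}$ be a polynomial-time computable family of functions, with $u,v$ computable in polynomial time in unary. An OPRF protocol for $F$ is a polynomial-time two-party protocol between a client with input $x\in\{0,1\}^{u(\lambda)}$ and a server with key $k\in\{0,1\}^{\lambda}$, in which the client outputs a string of $v(\lambda)$ bits. The view of a party consists of its input, its random coins and the messages it receives. Computational indistinguishability is with respect to non-uniform polynomial-time distinguishers, with an advantage bounded by a negligible function of $\lambda$ uniformly over the inputs (of polynomial size); simulators are uniform probabilistic polynomial-time (PPT) algorithms. The OPRF is *secure* (against semi-honest parties) if 1. $F$ is a pseudorandom function; 2. for all $k,x$ the client outputs $F_\lambda(k,x)$, except with probability negligible in $\lambda$; 3. some PPT simulator, given $(1^\lambda,x,F_\lambda(k,x))$, produces output indistinguishable from the client's view, and some PPT simulator, given $(1^\lambda,k)$, produces output indistinguishable from the server's view. **Group PSI.** There are two groups of $m$ clients $\mathcal C_{j,1},\dots,\mathcal C_{j,m}$, $j\in\{0,1\}$. Client $\mathcal C_{j,i}$ holds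 a finite set $S_{j,i}\subseteq\{0,1\}^{u(\lambda)}$, and the sets of different clients of the same group are disjoint. The Group PSI functionality gives to $\mathcal C_{j,i}$ the vector $\vec v_{j,i}=[S_{j,i}\cap S_{1-j,1},\dots,S_{j,i}\cap S_{1-j,m}]$, and nothing to the third party, which has no input. The number $m$ and the cardinalities $|S_{j,i}|$ are public and bounded by an arbitrary polynomial in $\lambda$. **Protocol** $\text{EG-PSI}^{(\mathrm{II})}$. The third party, a trusted execution environment (TEE), draws a uniform key $k\in\{0,1\}^\lambda$. Each client $\mathcal C_{j,i}$ runs the OPRF protocol with the TEE (server, key $k$) once for each $x\in S_{j,i}$, with fresh coins; the set of the values obtained is its encrypted set. It sends its encrypted set, as an unordered set, to every client of the other group. It outputs, for each $t$, the set of those $x\in S_{j,i}$ whose encryption belongs to the encrypted set received from $\mathcal C_{1-j,t}$. **Theorem 2.** Assume that the OPRF is secure. Then $\text{EG-PSI}^{(\mathrm{II})}$ securely realizes the Group PSI functionality in the presence of a static semi-honest adversary that corrupts one party, with empty leakage to the TEE. That is, there are PPT simulators $\mathsf{Sim}_{\mathcal C}$ and $\mathsf{Sim}_{\mathrm{TEE}}$,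 both given the public data ($1^\lambda$, $m$ and all cardinalities $|S_{j,i}|$), such that * for every client $\mathcal C_{j,i}$, the output of $\mathsf{Sim}_{\mathcal C}$ on $(j,i,S_{j,i},\vec v_{j,i})$ is computationally indistinguishable from the view of $\mathcal C_{j,i}$ in the protocol; * the output of $\mathsf{Sim}_{\mathrm{TEE}}$ on the empty input, empty output and empty leakage is computationally indistinguishable from the view of the TEE in the protocol. Moreover, if $2^{-v(\lambda)}$ is negligible in $\lambda$, then, except with negligible probability, every client $\mathcal C_{j,i}$ outputs $\vec v_{j,i}$. -/

import Mathlib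

open Filter Topology

noncomputable section

namespace EGPSI

/-! ## Machine model: programs over binary trees, with a running time -/

/-- The data handled by programs: binary trees (S-expressions) whose leaves carry one bit. -/
inductive Data : Type
  | atom (b : Bool) : Data
  | cons (x y : Data) : Data

namespace Data

/-- Length of a datum: its number of nodes. -/
def size : Data → ℕ
  | atom _ => 1
  | cons x y => x.size + y.size + 1

/-- Left component (the atom `0` if there is none). -/
def fst : Data → Data
  | atom _ => atom false
  | cons x _ => x

/-- Right component (the atom `0` if there is none). -/
def snd : Data → Data
  | atom _ => atom false
  | cons _ y => y

/-- The atom `1` if the datum is a pair, the atom `0` if not. -/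
def isCons : Data → Data
  | atom _ => atom false
  | cons _ _ => atom true

/-- A list of data, coded by nested pairs with terminator `0`. Also used for tuples. -/
def list : List Data → Data
  | [] => atom false
  | x :: l => cons x (list l)

/-- A natural number in unary, i.e. `1ⁿ`. -/
def unary (n : ℕ) : Data := list (List.replicate n (atom true))

end Data

/-- Programs of a small deterministic while-language. A program transforms one datum into
another; its meaning and its running time are given by `Runs`. -/
inductive Prog : Type
  | const (b : Bool) : Prog
  | id : Prog
  | fst : Prog
  | snd : Prog
  | isCons : Prog
  | pair (p q : Prog) : Prog
  | comp (p q : Prog) : Prog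
  | ite (c p q : Prog) : Prog
  | loop (c p : Prog) : Prog

/-- `Runs p x y t`: on input `x` the program `p` halts with output `y` after time `t`.
Each construct is charged the length of the datum it is applied to, besides the time of its
parts; a test succeeds if its value is not the atom `0`. `comp p q` is `p` followed by `q`, and
`loop c p` is `while c do p`. -/
inductive Runs : Prog → Data → Data → ℕ → Prop
  | const (b : Bool) (x : Data) : Runs (.const b) x (.atom b) x.size
  | id (x : Data) : Runs .id x x x.size
  | fst (x : Data) : Runs .fst x x.fst x.size
  | snd (x : Data) : Runs .snd x x.snd x.size
  | isCons (x : Data) : Runs .isCons x x.isCons x.size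
  | pair {p q : Prog} {x y z : Data} {s t : ℕ} :
      Runs p x y s → Runs q x z t → Runs (.pair p q) x (.cons y z) (x.size + s + t)
  | comp {p q : Prog} {x y z : Data} {s t : ℕ} :
      Runs p x y s → Runs q y z t → Runs (.comp p q) x z (x.size + s + t)
  | ite_true {c p q : Prog} {x b y : Data} {s t : ℕ} :
      Runs c x b s → b ≠ .atom false → Runs p x y t → Runs (.ite c p q) x y (x.size + s + t)
  | ite_false {c p q : Prog} {x y : Data} {s t : ℕ} :
      Runs c x (.atom false) s → Runs q x y t → Runs (.ite c p q) x y (x.size + s + t)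
  | loop_stop {c p : Prog} {x : Data} {s : ℕ} :
      Runs c x (.atom false) s → Runs (.loop c p) x x (x.size + s)
  | loop_step {c p : Prog} {x b y z : Data} {s t r : ℕ} :
      Runs c x b s → b ≠ .atom false → Runs p x y t → Runs (.loop c p) y z r →
      Runs (.loop c p) x z (x.size + s + t + r)

/-- One program computes `out i` from `enc i`, for all `i`, in time polynomial in the length of
`enc i`. -/
def PolyTime {ι : Type} (enc out : ι → Data) : Prop :=
  ∃ (p : Prog) (q : Polynomial ℕ), ∀ i, ∃ t, t ≤ q.eval (enc i).size ∧ Runs p (enc i) (out i) t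

/-- A length function that is computable in polynomial time, `1ⁿ ↦ 1^(ℓ n)`. -/
def PolyLength (ℓ : ℕ → ℕ) : Prop :=
  PolyTime (fun n : ℕ => Data.unary n) (fun n => Data.unary (ℓ n))

/-! ## Bit strings and sets of bit strings -/

/-- Bit strings of length `n`. -/
abbrev Bits (n : ℕ) : Type := Fin n → Bool

/-- A bit string as a datum. -/
def bits {n : ℕ} (b : Bits n) : Data := Data.list (List.ofFn fun i => Data.atom (b i))

/-- The elements of a set of bit strings, listed in lexicographic order. -/
def sorted {n : ℕ} (s : Finset (Bits n)) : List (Bits n) :=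
  ((s.map (toLex : Bits n ≃ Lex (Bits n)).toEmbedding).sort (fun a b => a ≤ b)).map ofLex

/-- A set of bit strings as a datum. Elements come in lexicographic order, so that the datum
depends on the set only. -/
def bitsSet {n : ℕ} (s : Finset (Bits n)) : Data := Data.list ((sorted s).map bits)

/-! ## Probability, negligible functions, probabilistic polynomial time -/

/-- The law of `X ω` for uniformly distributed `ω`. -/
def law {Ω α : Type} [Fintype Ω] [Nonempty Ω] (X : Ω → α) : PMF α :=
  (PMF.uniformOfFintype Ω).map X

/-- The probability of the event `E` for uniformly distributed `ω`. -/
def prob {Ω : Type} [Fintype Ω] [Nonempty Ω] (E : Ω → Prop) : ℝ :=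
  ((PMF.uniformOfFintype Ω).toOuterMeasure {ω | E ω}).toReal

/-- Negligible functions: `nᶜ · ε n → 0` for every `c`. -/
def Negligible (ε : ℕ → ℝ) : Prop :=
  Asymptotics.SuperpolynomialDecay atTop (fun n : ℕ => (n : ℝ)) ε

/-- A (strict, uniform) probabilistic polynomial-time algorithm: a polynomial-time function of the
input and of a string of uniform coins of polynomial length. -/
structure PPT where
  /-- the number of coins, as a function of the length of the input -/
  coins : Polynomial ℕ
  /-- the output on an input paired with coins -/
  run : Data → Data
  polyTime : PolyTime (fun x : Data => x) run

/-- The distribution of the output of a PPT algorithm. -/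
def PPT.dist (A : PPT) (x : Data) : PMF Data :=
  law (fun r : Bits (A.coins.eval x.size) => A.run (.cons x (bits r)))

/-- A non-uniform polynomial-time distinguisher: a polynomial-time test that is given, besides the
sample, an advice of polynomial length that depends on the security parameter only. -/
structure Distinguisher where
  advice : ℕ → Data
  advice_bound : ∃ q : Polynomial ℕ, ∀ n, (advice n).size ≤ q.eval n
  test : ℕ → Data → Bool
  polyTime : PolyTime (fun p : ℕ × Data => .cons (advice p.1) p.2)
    (fun p => .atom (test p.1 p.2))

/-- The probability that the distinguisher answers `1` on a sample from `X`. -/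
def Distinguisher.accept (D : Distinguisher) (n : ℕ) (X : PMF Data) : ℝ :=
  (X.toOuterMeasure {z | D.test n z = true}).toReal

/-- Computational indistinguishability of two ensembles indexed by the security parameter `n` and
by an input `i : I n`: the advantage of every distinguisher is at most a negligible function
of `n`, uniformly in the input. -/
def CompIndist {I : ℕ → Type} (X Y : ∀ n, I n → PMF Data) : Prop :=
  ∀ D : Distinguisher, ∃ ε : ℕ → ℝ, Negligible ε ∧
    ∀ n (i : I n), |D.accept n (X n i) - D.accept n (Y n i)| ≤ ε n

/-! ## Pseudorandom functions -/

/-- A family of efficiently computable functions `{0,1}ⁿ × {0,1}^(u n) → {0,1}^(v n)`; the first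
argument is the key and `n` the security parameter. -/
structure FunFamily where
  u : ℕ → ℕ
  v : ℕ → ℕ
  u_poly : PolyLength u
  v_poly : PolyLength v
  eval : ∀ n, Bits n → Bits (u n) → Bits (v n)
  polyTime : PolyTime
    (fun a : Σ n, Bits n × Bits (u n) => Data.list [.unary a.1, bits a.2.1, bits a.2.2])
    (fun a => bits (eval a.1 a.2.1 a.2.2))

/-- A non-uniform polynomial-time oracle algorithm attacking a function family. It makes
polynomially many queries, each of them, and finally its answer, computed in polynomial time
from the advice and the oracle's answers so far. -/
structure OracleAdversary (u v : ℕ → ℕ) where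
  advice : ℕ → Data
  advice_bound : ∃ q : Polynomial ℕ, ∀ n, (advice n).size ≤ q.eval n
  queries : ℕ → ℕ
  queries_bound : ∃ q : Polynomial ℕ, ∀ n, queries n ≤ q.eval n
  query : ∀ n, List (Bits (v n)) → Bits (u n)
  query_polyTime : PolyTime
    (fun a : Σ n, List (Bits (v n)) => .cons (advice a.1) (Data.list (a.2.map bits)))
    (fun a => bits (query a.1 a.2))
  guess : ∀ n, List (Bits (v n)) → Bool
  guess_polyTime : PolyTime
    (fun a : Σ n, List (Bits (v n)) => .cons (advice a.1) (Data.list (a.2.map bits)))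
    (fun a => .atom (guess a.1 a.2))

/-- The first `t` answers that the adversary receives from the oracle `g`. -/
def OracleAdversary.answers {u v : ℕ → ℕ} (A : OracleAdversary u v) (n : ℕ)
    (g : Bits (u n) → Bits (v n)) : ℕ → List (Bits (v n))
  | 0 => []
  | t + 1 => A.answers n g t ++ [g (A.query n (A.answers n g t))]

/-- The adversary's final answer when its oracle is `g`. -/
def OracleAdversary.result {u v : ℕ → ℕ} (A : OracleAdversary u v) (n : ℕ)
    (g : Bits (u n) → Bits (v n)) : Bool :=
  A.guess n (A.answers n g (A.queries n))

/-- Pseudorandomness: under a uniform key the function cannot be told from a uniformly random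
function by oracle queries. -/
def FunFamily.IsPRF (F : FunFamily) : Prop :=
  ∀ A : OracleAdversary F.u F.v, Negligible fun n =>
    |prob (fun k : Bits n => A.result n (F.eval n k) = true)
      - prob (fun g : Bits (F.u n) → Bits (F.v n) => A.result n g = true)|

/-! ## Oblivious pseudorandom functions -/

/-- The messages sent by the client and by the server in the first `t` rounds. In each
round the client sends a message and the server replies; `cm`, `sm` are their next-message
functions, applied to the messages received so far. -/
def transcript (cm sm : List Data → Data) : ℕ → List Data × List Data
  | 0 => ([], [])
  | t + 1 =>
    let T := transcript cm sm t
    let a := cm T.2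
    (T.1 ++ [a], T.2 ++ [sm (T.1 ++ [a])])

/-- A polynomial-time two-party protocol between a client, holding `x ∈ {0,1}^(u n)`, and a server,
holding a key `k ∈ {0,1}ⁿ`, in which the client outputs an element of `{0,1}^(v n)`. -/
structure OPRFProtocol (F : FunFamily) where
  clientCoins : ℕ → ℕ
  serverCoins : ℕ → ℕ
  rounds : ℕ → ℕ
  clientCoins_poly : PolyLength clientCoins
  serverCoins_poly : PolyLength serverCoins
  rounds_poly : PolyLength rounds
  /-- the client's next message, from input, coins and received messages -/
  clientMsg : ∀ n, Bits (F.u n) → Bits (clientCoins n) → List Data → Data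
  /-- the server's next message, from key, coins and received messages -/
  serverMsg : ∀ n, Bits n → Bits (serverCoins n) → List Data → Data
  /-- the client's output, from input, coins and received messages -/
  clientOut : ∀ n, Bits (F.u n) → Bits (clientCoins n) → List Data → Bits (F.v n)
  clientMsg_polyTime : PolyTime
    (fun a : Σ n, Bits (F.u n) × Bits (clientCoins n) × List Data =>
      Data.list [.unary a.1, bits a.2.1, bits a.2.2.1, .list a.2.2.2])
    (fun a => clientMsg a.1 a.2.1 a.2.2.1 a.2.2.2)
  serverMsg_polyTime : PolyTime
    (fun a : Σ n, Bits n × Bits (serverCoins n) × List Data =>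
      Data.list [.unary a.1, bits a.2.1, bits a.2.2.1, .list a.2.2.2])
    (fun a => serverMsg a.1 a.2.1 a.2.2.1 a.2.2.2)
  clientOut_polyTime : PolyTime
    (fun a : Σ n, Bits (F.u n) × Bits (clientCoins n) × List Data =>
      Data.list [.unary a.1, bits a.2.1, bits a.2.2.1, .list a.2.2.2])
    (fun a => bits (clientOut a.1 a.2.1 a.2.2.1 a.2.2.2))
  /-- messages have polynomial length -/
  msg_bound : ∃ q : Polynomial ℕ, ∀ n (k : Bits n) (x : Bits (F.u n)) (rc : Bits (clientCoins n))
    (rs : Bits (serverCoins n)),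
    (∀ a ∈ (transcript (clientMsg n x rc) (serverMsg n k rs) (rounds n)).1, a.size ≤ q.eval n) ∧
    (∀ b ∈ (transcript (clientMsg n x rc) (serverMsg n k rs) (rounds n)).2, b.size ≤ q.eval n)

namespace OPRFProtocol

variable {F : FunFamily}

/-- The messages (of the client, of the server) in a full execution. -/
def exec (P : OPRFProtocol F) (n : ℕ) (k : Bits n) (x : Bits (F.u n))
    (rc : Bits (P.clientCoins n)) (rs : Bits (P.serverCoins n)) : List Data × List Data :=
  transcript (P.clientMsg n x rc) (P.serverMsg n k rs) (P.rounds n)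

/-- The client's view: input, coins, received messages. -/
def clientView (P : OPRFProtocol F) (n : ℕ) (k : Bits n) (x : Bits (F.u n))
    (rc : Bits (P.clientCoins n)) (rs : Bits (P.serverCoins n)) : Data :=
  Data.list [bits x, bits rc, .list (P.exec n k x rc rs).2]

/-- The server's view: key, coins, received messages. -/
def serverView (P : OPRFProtocol F) (n : ℕ) (k : Bits n) (x : Bits (F.u n))
    (rc : Bits (P.clientCoins n)) (rs : Bits (P.serverCoins n)) : Data :=
  Data.list [bits k, bits rs, .list (P.exec n k x rc rs).1]

/-- The client's output. -/
def output (P : OPRFProtocol F) (n : ℕ) (k : Bits n) (x : Bits (F.u n))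
    (rc : Bits (P.clientCoins n)) (rs : Bits (P.serverCoins n)) : Bits (F.v n) :=
  P.clientOut n x rc (P.exec n k x rc rs).2

/-- A secure OPRF (semi-honest model). The function is pseudorandom; up to a negligible error the
client obtains `F k x`; the client's view is simulatable from `x` and `F k x`; the server's
view is simulatable from `k`. -/
structure Secure (P : OPRFProtocol F) : Prop where
  prf : F.IsPRF
  correct : ∃ ε : ℕ → ℝ, Negligible ε ∧ ∀ n (k : Bits n) (x : Bits (F.u n)),
    prob (fun r : Bits (P.clientCoins n) × Bits (P.serverCoins n) =>
      P.output n k x r.1 r.2 ≠ F.eval n k x) ≤ ε n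
  client : ∃ Sim : PPT, CompIndist (I := fun n => Bits n × Bits (F.u n))
    (fun n i => Sim.dist (Data.list [.unary n, bits i.2, bits (F.eval n i.1 i.2)]))
    (fun n i => law fun r : Bits (P.clientCoins n) × Bits (P.serverCoins n) =>
      P.clientView n i.1 i.2 r.1 r.2)
  server : ∃ Sim : PPT, CompIndist (I := fun n => Bits n × Bits (F.u n))
    (fun n i => Sim.dist (Data.list [.unary n, bits i.1]))
    (fun n i => law fun r : Bits (P.clientCoins n) × Bits (P.serverCoins n) =>
      P.serverView n i.1 i.2 r.1 r.2)

end OPRFProtocol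

/-! ## Group PSI -/

/-- The clients' inputs: two groups of `m` clients each; client `i` of group `j` holds the set
`S j i` of `u`-bit strings, and sets of clients in the same group are disjoint. -/
structure Inputs (u : ℕ) where
  m : ℕ
  S : Fin 2 → Fin m → Finset (Bits u)
  disjoint : ∀ j i i', i ≠ i' → Disjoint (S j i) (S j i')

namespace Inputs

variable {u : ℕ}

/-- The functionality: client `i` of group `j` obtains the vector of the intersections of its set
with the sets of the clients `t` of the other group. The third party obtains nothing. -/
def fGPSI (I : Inputs u) (j : Fin 2) (i : Fin I.m) : Fin I.m → Finset (Bits u) :=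
  fun t => I.S j i ∩ I.S (1 - j) t

/-- What is public: the security parameter and the cardinalities of the clients' sets (hence also
the number of clients), in unary. -/
def pub (n : ℕ) (I : Inputs u) : Data :=
  Data.list [.unary n, .list (List.ofFn fun i => .unary (I.S 0 i).card),
    .list (List.ofFn fun i => .unary (I.S 1 i).card)]

/-- At most `b` clients per group, holding at most `b` elements each. -/
def Bounded (b : ℕ) (I : Inputs u) : Prop := I.m ≤ b ∧ ∀ j i, (I.S j i).card ≤ b

end Inputs

/-- The executions of a Group PSI protocol with a third party, the parties following the
protocol: uniform random choices of all the parties, and the resulting views and outputs. -/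
structure GPSIProtocol (u : ℕ → ℕ) where
  Coins : ∀ n, Inputs (u n) → Type
  [fintype : ∀ n I, Fintype (Coins n I)]
  [nonempty : ∀ n I, Nonempty (Coins n I)]
  clientView : ∀ n (I : Inputs (u n)), Coins n I → Fin 2 → Fin I.m → Data
  tpView : ∀ n (I : Inputs (u n)), Coins n I → Data
  clientOut : ∀ n (I : Inputs (u n)), Coins n I →
    ∀ (_j : Fin 2) (_i : Fin I.m), Fin I.m → Finset (Bits (u n))

attribute [instance] GPSIProtocol.fintype GPSIProtocol.nonempty

namespace GPSIProtocol

variable {u : ℕ → ℕ}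

/-- Simulation-based security against semi-honest adversaries, with leakage `L` to the third party:
there are PPT simulators such that each client's view is simulated from its input and output,
and the third party's view from its (empty) input and output and the leakage. The simulators know
the public data and, for a client, which client it is. Inputs are of polynomial size. -/
def SecurelyRealizes (G : GPSIProtocol u) (L : ∀ n, Inputs (u n) → Data) : Prop :=
  ∃ SimC SimT : PPT, ∀ B : Polynomial ℕ,
    CompIndist
      (I := fun n => Σ I : {I : Inputs (u n) // I.Bounded (B.eval n)}, Fin 2 × Fin I.1.m)
      (fun n a => SimC.dist (Data.list [a.1.1.pub n, .unary a.2.1, .unary a.2.2,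
        bitsSet (a.1.1.S a.2.1 a.2.2),
        .list (List.ofFn fun t => bitsSet (a.1.1.fGPSI a.2.1 a.2.2 t))]))
      (fun n a => law fun ω => G.clientView n a.1.1 ω a.2.1 a.2.2) ∧
    CompIndist (I := fun n => {I : Inputs (u n) // I.Bounded (B.eval n)})
      (fun n I => SimT.dist (Data.list [I.1.pub n, bitsSet (∅ : Finset (Bits (u n))),
        bitsSet (∅ : Finset (Bits (u n))), L n I.1]))
      (fun n I => law fun ω => G.tpView n I.1 ω)

/-- On inputs of polynomial size, except with negligible probability all clients output
what the functionality prescribes. -/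
def Correct (G : GPSIProtocol u) : Prop :=
  ∀ B : Polynomial ℕ, ∃ ε : ℕ → ℝ, Negligible ε ∧
    ∀ n (I : Inputs (u n)), I.Bounded (B.eval n) →
      prob (fun ω => ∃ j i, G.clientOut n I ω j i ≠ I.fGPSI j i) ≤ ε n

end GPSIProtocol

/-- The leakage function with empty output. -/
def emptyLeakage {u : ℕ → ℕ} : ∀ n, Inputs (u n) → Data := fun _ _ => Data.list []

/-! ## The protocol EG-PSI^(II) -/

section Protocol

variable {F : FunFamily} (P : OPRFProtocol F)

/-- Random choices: the TEE's key `k`, and for each client `(j, i)` and element `x` the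
coins of client and TEE in the OPRF run on `x` (only those with `x ∈ S j i` are used). -/
abbrev Coins2 (n : ℕ) (I : Inputs (F.u n)) : Type :=
  Bits n × (Fin 2 → Fin I.m → Bits (F.u n) → Bits (P.clientCoins n) × Bits (P.serverCoins n))

variable (n : ℕ) (I : Inputs (F.u n)) (ω : Coins2 P n I) (j : Fin 2) (i : Fin I.m)

/-- The value that client `(j, i)` obtains for `x` from its OPRF run with the TEE. -/
def encElem (x : Bits (F.u n)) : Bits (F.v n) :=
  P.output n ω.1 x (ω.2 j i x).1 (ω.2 j i x).2

/-- The encrypted set of client `(j, i)`, which it sends to all clients of the other group. -/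
def encSet : Finset (Bits (F.v n)) := (I.S j i).image (encElem P n I ω j i)

/-- The view of client `(j, i)`: its input, its views (input, coins, messages) in its OPRF runs, one
for each element of its set, and the encrypted sets received from the other group. -/
def clientView2 : Data :=
  Data.list [bitsSet (I.S j i),
    .list ((sorted (I.S j i)).map fun x => P.clientView n ω.1 x (ω.2 j i x).1 (ω.2 j i x).2),
    .list (List.ofFn fun t => bitsSet (encSet P n I ω (1 - j) t))]

/-- The view of the TEE: its key and its views (key, coins, messages) in all the OPRF runs, grouped
by client. It has no input and receives nothing else. -/
def teeView2 : Data :=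
  Data.list [bits ω.1,
    .list (List.ofFn fun j : Fin 2 => .list (List.ofFn fun i : Fin I.m =>
      .list ((sorted (I.S j i)).map fun x =>
        P.serverView n ω.1 x (ω.2 j i x).1 (ω.2 j i x).2)))]

/-- The output of client `(j, i)`: for each `t`, those of its elements whose encryption is in the
encrypted set received from client `t` of the other group. -/
def clientOut2 : Fin I.m → Finset (Bits (F.u n)) :=
  fun t => (I.S j i).filter fun x => encElem P n I ω j i x ∈ encSet P n I ω (1 - j) t

/-- EG-PSI^(II) based on the OPRF protocol `P`. -/
def egpsi2 : GPSIProtocol F.u where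
  Coins := Coins2 P
  fintype := fun _ _ => inferInstance
  nonempty := fun _ _ => inferInstance
  clientView := clientView2 P
  tpView := teeView2 P
  clientOut := clientOut2 P

end Protocol

end EGPSI

end

open Filter Topology
open scoped BigOperators

namespace EGPSI

/-! ## Polynomial bounds -/

/-! For the TEE, fix the key `k`. Its view is then a fixed frame, shaped by the public cardinalities
alone, filled with independent OPRF server views. Each of them is indistinguishable from a
simulation that sees only `k`, uniformly in `k` and in the element. A hybrid argument over the at
most `2 * b * b` elements replaces them all, and averaging over `k` gives the simulator, which draws
`k` itself (`tee_compIndist`).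

For a client there are three replacements (`client_compIndist`). The encrypted sets received become
the images under `F k`, at the cost of the OPRF's error probability. The client's OPRF views are
then simulated from `x` and `F k x`, by a hybrid argument for fixed `k`. Now the view depends on `k`
only through values of `F k` at polynomially many points, so `F k` can be replaced by a random
function `g`. The last world can be sampled exactly from the client's input and output. Values of
`g` on its own set are drawn together with the simulated runs and reused on the intersections. Every
other element of the other group gets a fresh value, and only the number of such elements is needed.
Disjointness within the group makes these values independent between clients, and the canonical
order of encoded sets hides which value belongs to which element.

Outputs are correct unless an OPRF run errs or two different elements collide under `F k`. Two
oracle queries detect a collision, so its probability is at most that for a random function, `2 ^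
(-v)`, plus a negligible term (`exists_collision_bound`). Union bounds finish the argument.

Two technical matters account for most of the length. Reductions and simulators must be programs of
the while-language: `FP` collects closure properties, with `FP.foldl` as the one source of loops.
Advantages must be negligible uniformly over inputs and surrounding contexts:
`exists_negligible_of_forall_selection` picks a nearly worst instance for each security parameter,
and this instance is hard-wired as advice. Finally, `expect_block` shows that blocks cut from the
simulator's coins are independent and uniform. -/

theorem polynomial_eval_mono (q : Polynomial ℕ) : Monotone fun n : ℕ => q.eval n := by
  intro a b h
  simp only [Polynomial.eval_eq_sum_range]
  gcongr

/-- `f` is bounded by a polynomial in `sz`. -/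
def PolyBdd {ι : Type} (sz f : ι → ℕ) : Prop := ∃ q : Polynomial ℕ, ∀ i, f i ≤ q.eval (sz i)

namespace PolyBdd

variable {ι : Type} {sz f g : ι → ℕ}

theorem self (sz : ι → ℕ) : PolyBdd sz sz := ⟨Polynomial.X, fun i => by simp⟩

theorem const (sz : ι → ℕ) (c : ℕ) : PolyBdd sz fun _ => c := ⟨Polynomial.C c, fun i => by simp⟩

theorem add (hf : PolyBdd sz f) (hg : PolyBdd sz g) : PolyBdd sz fun i => f i + g i := by
  obtain ⟨p, hp⟩ := hf
  obtain ⟨q, hq⟩ := hg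
  exact ⟨p + q, fun i => by simpa using add_le_add (hp i) (hq i)⟩

theorem mul (hf : PolyBdd sz f) (hg : PolyBdd sz g) : PolyBdd sz fun i => f i * g i := by
  obtain ⟨p, hp⟩ := hf
  obtain ⟨q, hq⟩ := hg
  exact ⟨p * q, fun i => by simpa using Nat.mul_le_mul (hp i) (hq i)⟩

theorem mono (hg : PolyBdd sz g) (h : ∀ i, f i ≤ g i) : PolyBdd sz f := by
  obtain ⟨q, hq⟩ := hg
  exact ⟨q, fun i => (h i).trans (hq i)⟩

theorem eval (hf : PolyBdd sz f) (p : Polynomial ℕ) : PolyBdd sz fun i => p.eval (f i) := by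
  obtain ⟨q, hq⟩ := hf
  refine ⟨p.comp q, fun i => ?_⟩
  simpa [Polynomial.eval_comp] using polynomial_eval_mono p (hq i)

theorem trans (hf : PolyBdd sz f) (hg : PolyBdd f g) : PolyBdd sz g := by
  obtain ⟨q, hq⟩ := hg
  exact (hf.eval q).mono hq

end PolyBdd

/-! ## Data -/

namespace Data

theorem one_le_size (x : Data) : 1 ≤ x.size := by cases x <;> simp [size]

/-- The list coded by a datum; inverse to `Data.list`. -/
def toList : Data → List Data
  | atom _ => []
  | cons x y => x :: y.toList

@[simp] theorem toList_list (l : List Data) : (list l).toList = l := by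
  induction l with
  | nil => rfl
  | cons a l ih => simp [list, toList, ih]

@[simp] theorem toList_atom (b : Bool) : (atom b).toList = [] := rfl

@[simp] theorem toList_cons (x y : Data) : (cons x y).toList = x :: y.toList := rfl

@[simp] theorem fst_cons (x y : Data) : (cons x y).fst = x := rfl

@[simp] theorem snd_cons (x y : Data) : (cons x y).snd = y := rfl

@[simp] theorem list_nil : list [] = atom false := rfl

@[simp] theorem list_cons (x : Data) (l : List Data) : list (x :: l) = cons x (list l) := rfl

@[simp] theorem toList_snd (x : Data) : x.snd.toList = x.toList.tail := by cases x <;> rfl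

@[simp] theorem size_atom (b : Bool) : (atom b).size = 1 := rfl

@[simp] theorem size_cons (x y : Data) : (cons x y).size = x.size + y.size + 1 := rfl

theorem size_list (l : List Data) : (list l).size = (l.map fun a => a.size + 1).sum + 1 := by
  induction l with
  | nil => rfl
  | cons a l ih => simp only [list, size_cons, ih, List.map_cons, List.sum_cons]; omega

theorem size_list_append (l l' : List Data) :
    (list (l ++ l')).size + 1 = (list l).size + (list l').size := by
  simp only [size_list, List.map_append, List.sum_append]; omega

theorem size_list_reverse (l : List Data) : (list l.reverse).size = (list l).size := by
  simp only [size_list, List.map_reverse, List.sum_reverse]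

/-- The terminator of a coded list may be either atom. Both have size one, so normalising it does
not change the size. -/
theorem size_list_toList (x : Data) : (list x.toList).size = x.size := by
  induction x with
  | atom b => rfl
  | cons x y _ ih => simp [toList, size, ih]

theorem size_list_sublist {l l' : List Data} (h : l.Sublist l') :
    (list l).size ≤ (list l').size := by
  simp only [size_list]
  have := (h.map fun a : Data => a.size + 1).sum_le_sum (by simp)
  omega

theorem length_lt_size_list (l : List Data) : l.length < (list l).size := by
  induction l with
  | nil => simp
  | cons a l ih => simp only [list_cons, size_cons, List.length_cons]; omega

theorem length_toList_le (x : Data) : x.toList.length ≤ x.size := by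
  have := length_lt_size_list x.toList
  rw [size_list_toList] at this
  omega

theorem size_lt_of_mem {a : Data} {l : List Data} (h : a ∈ l) : a.size < (list l).size := by
  induction l with
  | nil => simp at h
  | cons b l ih =>
    simp only [list_cons, size_cons]
    rcases List.mem_cons.1 h with rfl | h
    · omega
    · have := ih h; omega

theorem size_le_of_mem_toList {a x : Data} (h : a ∈ x.toList) : a.size ≤ x.size := by
  have := size_lt_of_mem h
  rw [size_list_toList] at this
  omega

theorem size_list_le {l : List Data} {p q : ℕ} (hl : l.length ≤ p) (h : ∀ a ∈ l, a.size ≤ q) :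
    (list l).size ≤ p * (q + 1) + 1 := by
  rw [size_list]
  have := List.sum_le_card_nsmul (l.map fun a => a.size + 1) (q + 1) (by simpa using h)
  rw [List.length_map, smul_eq_mul] at this
  have := Nat.mul_le_mul_right (q + 1) hl
  omega

theorem size_list_le_of_prefix {l : List Data} {x : Data} (h : l <+: x.toList) :
    (list l).size ≤ x.size := by
  rw [← size_list_toList x]
  exact size_list_sublist h.sublist

theorem size_fst_le (x : Data) : x.fst.size ≤ x.size := by
  cases x <;> simp [fst]; omega

theorem size_snd_le (x : Data) : x.snd.size ≤ x.size := by
  cases x <;> simp [snd]; omega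

/-- The truth value of a datum as a test: everything but the atom `0` counts as true. -/
def truth : Data → Bool
  | atom b => b
  | cons _ _ => true

@[simp] theorem truth_atom (b : Bool) : (atom b).truth = b := rfl

@[simp] theorem truth_cons (x y : Data) : (cons x y).truth = true := rfl

theorem truth_eq_true_iff (x : Data) : x.truth = true ↔ x ≠ atom false := by
  cases x with
  | atom b => cases b <;> simp
  | cons => simp

theorem truth_eq_false_iff (x : Data) : x.truth = false ↔ x = atom false := by
  cases x with
  | atom b => cases b <;> simp
  | cons => simp

@[simp] theorem truth_isCons (x : Data) : x.isCons.truth = !x.toList.isEmpty := by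
  cases x <;> rfl

@[simp] theorem length_toList_unary (n : ℕ) : (unary n).toList.length = n := by simp [unary]

theorem size_unary (n : ℕ) : (unary n).size = 2 * n + 1 := by
  simp [unary, size_list]; omega

theorem unary_length {α : Type} (l : List α) :
    unary l.length = list (l.map fun _ => atom true) := by simp [unary]

end Data

open Data

/-- Every construct is charged for the datum it reads, so building a large output takes at least as
much time. This keeps compositions of polynomial-time programs polynomial. -/
theorem Runs.size_le {p : Prog} {x y : Data} {t : ℕ} (h : Runs p x y t) : y.size ≤ t := by
  induction h with
  | const b x => exact x.one_le_size
  | id x => exact le_rfl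
  | fst x => exact x.size_fst_le
  | snd x => exact x.size_snd_le
  | isCons x => cases x <;> simp [Data.isCons]
  | @pair p q x y z s t _ _ h1 h2 => have := x.one_le_size; simp; omega
  | comp _ _ h1 h2 => omega
  | ite_true => omega
  | ite_false => omega
  | loop_stop => omega
  | loop_step => omega

/-! ## Closure properties of polynomial time -/

/-- Running times can thus be assembled from `PolyBdd` closure properties, without explicit
polynomials. -/
theorem polyTime_iff {ι : Type} {enc out : ι → Data} : PolyTime enc out ↔
    ∃ (p : Prog) (T : ι → ℕ), PolyBdd (fun i => (enc i).size) T ∧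
      ∀ i, ∃ t, t ≤ T i ∧ Runs p (enc i) (out i) t := by
  constructor
  · rintro ⟨p, q, h⟩
    exact ⟨p, fun i => q.eval (enc i).size, ⟨q, fun _ => le_rfl⟩, h⟩
  · rintro ⟨p, T, ⟨q, hq⟩, h⟩
    refine ⟨p, q, fun i => ?_⟩
    obtain ⟨t, ht, hr⟩ := h i
    exact ⟨t, ht.trans (hq i), hr⟩

namespace PolyTime

variable {ι κ : Type} {enc mid out : ι → Data}

theorem polyBdd (h : PolyTime enc out) : PolyBdd (fun i => (enc i).size) fun i => (out i).size := by
  obtain ⟨p, q, h⟩ := h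
  refine ⟨q, fun i => ?_⟩
  obtain ⟨t, ht, hr⟩ := h i
  exact hr.size_le.trans ht

theorem comp (h1 : PolyTime enc mid) (h2 : PolyTime mid out) : PolyTime enc out := by
  -- The time of the second program is polynomial in the size of the intermediate datum, which is
  -- itself polynomial in the size of the input.
  have hb := h1.polyBdd
  rw [polyTime_iff] at *
  obtain ⟨p1, T1, hT1, h1⟩ := h1
  obtain ⟨p2, T2, hT2, h2⟩ := h2
  refine ⟨.comp p1 p2, fun i => (enc i).size + T1 i + T2 i,
    ((PolyBdd.self _).add hT1).add (hb.trans hT2), fun i => ?_⟩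
  obtain ⟨t1, ht1, hr1⟩ := h1 i
  obtain ⟨t2, ht2, hr2⟩ := h2 i
  exact ⟨_, by dsimp only; omega, .comp hr1 hr2⟩

theorem reindex (h : PolyTime enc out) (e : κ → ι) :
    PolyTime (fun i => enc (e i)) fun i => out (e i) := by
  obtain ⟨p, q, h⟩ := h
  exact ⟨p, q, fun i => h _⟩

theorem pair {a b : ι → Data} (h1 : PolyTime enc a) (h2 : PolyTime enc b) :
    PolyTime enc fun i => .cons (a i) (b i) := by
  rw [polyTime_iff] at *
  obtain ⟨p1, T1, hT1, h1⟩ := h1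
  obtain ⟨p2, T2, hT2, h2⟩ := h2
  refine ⟨.pair p1 p2, fun i => (enc i).size + T1 i + T2 i,
    ((PolyBdd.self _).add hT1).add hT2, fun i => ?_⟩
  obtain ⟨t1, ht1, hr1⟩ := h1 i
  obtain ⟨t2, ht2, hr2⟩ := h2 i
  exact ⟨_, by dsimp only; omega, .pair hr1 hr2⟩

end PolyTime

/-- Total functions computable in polynomial time. -/
abbrev FP (f : Data → Data) : Prop := PolyTime (fun x : Data => x) f

namespace FP

variable {f g h : Data → Data}

theorem size_bdd (hf : FP f) : PolyBdd size fun x => (f x).size := hf.polyBdd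

theorem of_prog (p : Prog) (hp : ∀ x, Runs p x (f x) x.size) : FP f :=
  ⟨p, Polynomial.X, fun x => ⟨x.size, by simp, hp x⟩⟩

theorem id : FP fun x => x := of_prog .id Runs.id

theorem atom (b : Bool) : FP fun _ => .atom b := of_prog (.const b) (Runs.const b)

theorem comp (hg : FP g) (hf : FP f) : FP fun x => g (f x) :=
  PolyTime.comp hf (hg.reindex f)

theorem fst (hf : FP f) : FP fun x => (f x).fst := comp (of_prog .fst Runs.fst) hf

theorem snd (hf : FP f) : FP fun x => (f x).snd := comp (of_prog .snd Runs.snd) hf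

theorem isCons (hf : FP f) : FP fun x => (f x).isCons := comp (of_prog .isCons Runs.isCons) hf

theorem cons (hf : FP f) (hg : FP g) : FP fun x => .cons (f x) (g x) := PolyTime.pair hf hg

theorem const (d : Data) : FP fun _ => d := by
  induction d with
  | atom b => exact atom b
  | cons x y hx hy => exact cons hx hy

theorem ite (hf : FP f) (hg : FP g) (hh : FP h) :
    FP fun x => if (f x).truth = true then g x else h x := by
  obtain ⟨p1, q1, h1⟩ := hf
  obtain ⟨p2, q2, h2⟩ := hg
  obtain ⟨p3, q3, h3⟩ := hh
  refine ⟨.ite p1 p2 p3, .X + q1 + q2 + q3, fun x => ?_⟩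
  obtain ⟨t1, ht1, hr1⟩ := h1 x
  obtain ⟨t2, ht2, hr2⟩ := h2 x
  obtain ⟨t3, ht3, hr3⟩ := h3 x
  simp only [Polynomial.eval_add, Polynomial.eval_X]
  dsimp only at ht1 ht2 ht3
  split_ifs with hc
  · exact ⟨_, by omega, .ite_true hr1 ((truth_eq_true_iff _).1 hc) hr2⟩
  · have hc := (truth_eq_false_iff _).1 (by simpa using hc)
    rw [hc] at hr1
    exact ⟨_, by omega, .ite_false hr1 hr3⟩

end FP

/-! ### Loops over lists -/

/-- The state of a loop over a list: unchanged context, remaining list, accumulator. -/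
def foldState (c r a : Data) : Data := .cons c (.cons r a)

/-- Induction on the remaining list. Every accumulator met is a fold over a prefix, so each state
has size at most `M`, each pass costs at most `M + N + N`, and there are at most `r.size` passes and
one final test. The leftover `z` is existential because the terminator of the list may be either
atom. -/
theorem runs_fold_loop {g : Data → Data → Data → Data} {pc pb : Prog} {c r a : Data} {M N : ℕ}
    (hc : ∀ r a, (foldState c r a).size ≤ M → ∃ t, t ≤ N ∧ Runs pc (foldState c r a) r.isCons t)
    (hb : ∀ e r a, (foldState c (.cons e r) a).size ≤ M → ∃ t, t ≤ N ∧
      Runs pb (foldState c (.cons e r) a) (foldState c r (g c e a)) t)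
    (hM : ∀ l, l <+: r.toList →
      (foldState c r (l.foldl (fun a e => g c e a) a)).size ≤ M) :
    ∃ z t, t ≤ (r.size + 1) * (M + N + N) ∧ Runs (.loop pc pb) (foldState c r a)
      (foldState c z (r.toList.foldl (fun a e => g c e a) a)) t := by
  induction r generalizing a with
  | atom b =>
    have h0 := hM [] (by simp)
    obtain ⟨t, ht, hr⟩ := hc (.atom b) a h0
    simp only [List.foldl_nil] at h0
    refine ⟨.atom b, _, ?_, Runs.loop_stop hr⟩
    nlinarith
  | cons e r _ ih =>
    have h0 := hM [] (by simp)
    simp only [List.foldl_nil] at h0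
    obtain ⟨t1, ht1, hr1⟩ := hc (.cons e r) a h0
    obtain ⟨t2, ht2, hr2⟩ := hb e r a h0
    obtain ⟨z, t3, ht3, hr3⟩ := ih (a := g c e a) (fun l hl => by
      -- A prefix of the tail, folded from the updated accumulator, is the prefix with `e` in front
      -- folded from the old one.
      have := hM (e :: l) (by simpa using hl)
      simp only [List.foldl_cons] at this
      refine le_trans ?_ this
      simp only [foldState, size_cons]
      omega)
    refine ⟨z, _, ?_, .loop_step hr1 (by simp [Data.isCons]) hr2 hr3⟩
    simp only [size_cons]
    nlinarith [Nat.zero_le (e.size * (M + N + N))]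

namespace FP

/-- A polynomial-time step alone would not do, since iterating it can make the accumulator grow
exponentially. Hence the bound `h` on the folds over all prefixes. -/
theorem foldl {g : Data → Data → Data → Data} {c l a : Data → Data}
    (hg : FP fun p => g p.fst p.snd.fst p.snd.snd) (hc : FP c) (hl : FP l) (ha : FP a)
    {b : Data → ℕ} (hb : PolyBdd size b)
    (h : ∀ x l', l' <+: (l x).toList → (l'.foldl (fun a e => g (c x) e a) (a x)).size ≤ b x) :
    FP fun x => (l x).toList.foldl (fun a e => g (c x) e a) (a x) := by
  obtain ⟨q, hq⟩ := hb
  replace hq : ∀ x l', l' <+: (l x).toList →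
      (l'.foldl (fun a e => g (c x) e a) (a x)).size ≤ q.eval x.size :=
    fun x l' hl' => (h x l' hl').trans (hq x)
  have hbody : FP fun s => foldState s.fst s.snd.fst.snd (g s.fst s.snd.fst.fst s.snd.snd) := by
    refine cons id.fst (cons id.snd.fst.snd ?_)
    have := hg.comp (cons id.fst (cons id.snd.fst.fst id.snd.snd))
    simpa using this
  obtain ⟨pb, qb, hpb⟩ := hbody
  obtain ⟨pc, qc, hpc⟩ := id.snd.fst.isCons
  have hinit : FP fun x => foldState (c x) (l x) (a x) := cons hc (cons hl ha)
  obtain ⟨p0, T0, hT0, h0⟩ := polyTime_iff.1 hinit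
  -- The `2` accounts for the two pairs that form a loop state.
  let M : Data → ℕ := fun x => (c x).size + (l x).size + q.eval x.size + 2
  have hM : PolyBdd size M :=
    ((hc.size_bdd.add hl.size_bdd).add ⟨q, fun _ => le_rfl⟩).add (.const _ 2)
  let N : Data → ℕ := fun x => qb.eval (M x) + qc.eval (M x)
  have hN : PolyBdd size N := (hM.eval qb).add (hM.eval qc)
  have key : ∀ x, ∃ z t, t ≤ ((l x).size + 1) * (M x + N x + N x) ∧
      Runs (.loop pc pb) (foldState (c x) (l x) (a x))
        (foldState (c x) z ((l x).toList.foldl (fun a e => g (c x) e a) (a x))) t := by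
    intro x
    refine runs_fold_loop (fun r a hs => ?_) (fun e r a hs => ?_) fun l' hl' => ?_
    · obtain ⟨t, ht, hr⟩ := hpc (foldState (c x) r a)
      exact ⟨t, (ht.trans (polynomial_eval_mono qc hs)).trans (Nat.le_add_left _ _), hr⟩
    · obtain ⟨t, ht, hr⟩ := hpb (foldState (c x) (.cons e r) a)
      exact ⟨t, (ht.trans (polynomial_eval_mono qb hs)).trans (Nat.le_add_right _ _), hr⟩
    · have := hq x l' hl'
      simp only [foldState, size_cons, M]
      omega
  choose z t ht hr using key
  have hst : FP fun x =>
      foldState (c x) (z x) ((l x).toList.foldl (fun a e => g (c x) e a) (a x)) := by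
    refine polyTime_iff.2 ⟨.comp p0 (.loop pc pb), fun x => x.size + T0 x +
      ((l x).size + 1) * (M x + N x + N x), ((PolyBdd.self _).add hT0).add
      ((hl.size_bdd.add (.const _ 1)).mul ((hM.add hN).add hN)), fun x => ?_⟩
    obtain ⟨t0, ht0, hr0⟩ := h0 x
    refine ⟨_, ?_, .comp hr0 (hr x)⟩
    have := ht x
    dsimp only
    omega
  exact hst.snd.snd

end FP

end EGPSI

namespace EGPSI
open Data

/-! ### Operations on lists -/

/-- Pushing results onto an accumulator reverses them, so the list operations below end with a
reversal. -/
theorem foldl_cons_map (f : Data → Data) (l a : List Data) :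
    l.foldl (fun a e => Data.cons (f e) a) (list a) = list ((l.map f).reverse ++ a) := by
  induction l generalizing a with
  | nil => rfl
  | cons e l ih => simpa using ih (f e :: a)

theorem foldl_cons_filter (b : Data → Bool) (l a : List Data) :
    l.foldl (fun a e => if b e = true then Data.cons e a else a) (list a) =
      list ((l.filter b).reverse ++ a) := by
  induction l generalizing a with
  | nil => rfl
  | cons e l ih =>
    rw [List.foldl_cons]
    split_ifs with h
    · simpa [h] using ih (e :: a)
    · simpa [h] using ih a

/-- The results of `f` on the elements of a list and on consecutive blocks, of length `B`, of a
second list. -/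
def blockMap {α β γ : Type} (f : α → List β → γ) (B : ℕ) : List α → List β → List γ
  | [], _ => []
  | e :: l, r => f e (r.take B) :: blockMap f B l (r.drop B)

namespace FP

variable {f g c l r a b : Data → Data}

theorem congr (hf : FP f) (h : ∀ x, f x = g x) : FP g := (funext h : f = g) ▸ hf

theorem app2 {F : Data → Data → Data} (hF : FP fun p => F p.fst p.snd) (ha : FP a) (hb : FP b) :
    FP fun x => F (a x) (b x) :=
  hF.comp (cons ha hb)

theorem app3 {F : Data → Data → Data → Data} (hF : FP fun p => F p.fst p.snd.fst p.snd.snd)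
    (ha : FP a) (hb : FP b) (hc : FP c) : FP fun x => F (a x) (b x) (c x) :=
  hF.comp (cons ha (cons hb hc))

theorem truth (hf : FP f) : FP fun x => .atom (f x).truth :=
  (hf.ite (atom true) (atom false)).congr fun x => by cases (f x).truth <;> simp

theorem ite' {t : Data → Bool} (ht : FP fun x => .atom (t x)) (hf : FP f) (hg : FP g) :
    FP fun x => if t x = true then f x else g x :=
  ht.ite hf hg

theorem not {t : Data → Bool} (ht : FP fun x => .atom (t x)) : FP fun x => .atom !(t x) :=
  (ht.ite' (atom false) (atom true)).congr fun x => by cases t x <;> simp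

theorem and {s t : Data → Bool} (hs : FP fun x => .atom (s x)) (ht : FP fun x => .atom (t x)) :
    FP fun x => .atom (s x && t x) :=
  (hs.ite' ht (atom false)).congr fun x => by cases s x <;> simp

theorem reverse (hl : FP l) : FP fun x => list (l x).toList.reverse := by
  have key (l : List Data) : l.foldl (fun a e => Data.cons e a) (list []) = list l.reverse := by
    simpa using foldl_cons_map (fun e => e) l []
  refine (foldl (g := fun _ e a => .cons e a) (cons id.snd.fst id.snd.snd) id hl
    (const (list [])) hl.size_bdd fun x l' hl' => ?_).congr fun x => key _
  rw [key, size_list_reverse]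
  exact size_list_le_of_prefix hl'

theorem map {F : Data → Data → Data} (hF : FP fun p => F p.fst p.snd) (hc : FP c) (hl : FP l) :
    FP fun x => list ((l x).toList.map (F (c x))) := by
  have key (c : Data) (l : List Data) :
      l.foldl (fun a e => Data.cons (F c e) a) (list []) = list (l.map (F c)).reverse := by
    simpa using foldl_cons_map (F c) l []
  obtain ⟨q, hq⟩ := hF.size_bdd
  have := (foldl (g := fun c e a => .cons (F c e) a) (cons (hF.app2 id.fst id.snd.fst) id.snd.snd)
    hc hl (const (list []))
    ((hl.size_bdd.mul ((((hc.size_bdd.add hl.size_bdd).add (.const _ 1)).eval q).add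
      (.const _ 1))).add (.const _ 1))
    fun x l' hl' => ?_).reverse
  · exact this.congr fun x => by rw [key, toList_list, List.reverse_reverse]
  · rw [key]
    refine size_list_le ?_ fun e he => ?_
    · simpa using hl'.length_le.trans (length_toList_le _)
    · simp only [List.mem_reverse, List.mem_map] at he
      obtain ⟨e, he, rfl⟩ := he
      have he := size_le_of_mem_toList (hl'.subset he)
      refine (hq (.cons (c x) e)).trans (polynomial_eval_mono q ?_)
      simp only [size_cons]
      omega

theorem filter {t : Data → Data → Bool} (ht : FP fun p => .atom (t p.fst p.snd)) (hc : FP c)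
    (hl : FP l) : FP fun x => list ((l x).toList.filter (t (c x))) := by
  have key (c : Data) (l : List Data) :
      l.foldl (fun a e => if t c e = true then Data.cons e a else a) (list []) =
        list (l.filter (t c)).reverse := by
    simpa using foldl_cons_filter (t c) l []
  have hg : FP fun p => .atom (t p.fst p.snd.fst) :=
    app2 (F := fun c e => .atom (t c e)) ht id.fst id.snd.fst
  have := (foldl (g := fun c e a => if t c e = true then .cons e a else a)
    (hg.ite' (cons id.snd.fst id.snd.snd) id.snd.snd) hc hl (const (list [])) hl.size_bdd
    fun x l' hl' => ?_).reverse
  · exact this.congr fun x => by rw [key, toList_list, List.reverse_reverse]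
  · rw [key, size_list_reverse]
    exact (size_list_sublist List.filter_sublist).trans (size_list_le_of_prefix hl')

/-- Reversing twice replaces the terminator by the atom `0`. -/
theorem toList (hl : FP l) : FP fun x => list (l x).toList :=
  hl.reverse.reverse.congr fun x => by simp

theorem append (ha : FP a) (hb : FP b) :
    FP fun x => list ((a x).toList ++ (b x).toList) := by
  have key (l a : List Data) :
      l.foldl (fun a e => Data.cons e a) (list a) = list (l.reverse ++ a) := by
    simpa using foldl_cons_map (fun e => e) l a
  refine (foldl (g := fun _ e a => .cons e a) (cons id.snd.fst id.snd.snd) id ha.reverse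
    hb.toList (ha.size_bdd.add hb.size_bdd) fun x l' hl' => ?_).congr fun x => ?_
  · rw [key]
    have h1 := size_list_append l'.reverse (b x).toList
    simp only [size_list_reverse, size_list_toList] at h1
    have h2 := size_list_le_of_prefix (x := list (a x).toList.reverse) (by simpa using hl')
    simp only [size_list_reverse, size_list_toList] at h2
    omega
  · simp [key]

theorem zip (ha : FP a) (hb : FP b) :
    FP fun x => list (List.zipWith Data.cons (a x).toList (b x).toList) := by
  -- The state is the unread part of the second list, paired with the reversed output. Once the
  -- second list is exhausted the state no longer changes, which gives the truncation of
  -- `List.zipWith`.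
  let g : Data → Data → Data := fun e s =>
    if s.fst.isCons.truth = true then .cons s.fst.snd (.cons (.cons e s.fst.fst) s.snd) else s
  have hg : FP fun p => g p.snd.fst p.snd.snd :=
    id.snd.snd.fst.isCons.ite
      (cons id.snd.snd.fst.snd (cons (cons id.snd.fst id.snd.snd.fst.fst) id.snd.snd.snd))
      id.snd.snd
  have key (l : List Data) (r : Data) (s : List Data) : ∃ z,
      l.foldl (fun a e => g e a) (.cons r (list s)) =
        .cons z (list ((List.zipWith Data.cons l r.toList).reverse ++ s)) ∧
      z.size ≤ r.size := by
    induction l generalizing r s with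
    | nil => exact ⟨r, by simp⟩
    | cons e l ih =>
      cases r with
      | atom t =>
        obtain ⟨z, h, hz⟩ := ih (.atom t) s
        exact ⟨z, by simpa [g] using h, hz⟩
      | cons y r =>
        obtain ⟨z, h, hz⟩ := ih r (.cons e y :: s)
        refine ⟨z, by simpa [g] using h, ?_⟩
        simp only [size_cons]
        omega
  have := (foldl (g := fun _ e a => g e a) hg id ha (cons hb (const (list [])))
    ((hb.size_bdd.add ((ha.size_bdd.mul (((ha.size_bdd.add hb.size_bdd).add
      (.const _ 1)).add (.const _ 1))).add (.const _ 1))).add (.const _ 1)) fun x l' hl' => ?_)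
  · refine this.snd.reverse.congr fun x => ?_
    obtain ⟨z, h, -⟩ := key (a x).toList (b x) []
    rw [h]
    simp
  · obtain ⟨z, h, hz⟩ := key l' (b x) []
    rw [h, size_cons]
    refine Nat.succ_le_succ (Nat.add_le_add hz (size_list_le ?_ fun e he => ?_))
    · have := hl'.length_le.trans (length_toList_le _)
      simp
      omega
    · simp only [List.append_nil, List.mem_reverse] at he
      rw [← List.map_uncurry_zip_eq_zipWith] at he
      obtain ⟨⟨u, v⟩, huv, rfl⟩ := List.mem_map.1 he
      obtain ⟨hu, hv⟩ := List.of_mem_zip huv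
      have h1 := size_le_of_mem_toList (hl'.subset hu)
      have h2 := size_le_of_mem_toList hv
      simp only [Function.uncurry_apply_pair, size_cons]
      omega

/-! ### Arithmetic in unary -/

theorem unary_length_toList (hl : FP l) : FP fun x => unary (l x).toList.length :=
  (map (F := fun _ _ => .atom true) (const _) id hl).congr fun x => by
    rw [unary_length]

theorem unary_const (n : ℕ) : FP fun _ => unary n := const _

variable {M N : Data → ℕ}

theorem unary_add (hM : FP fun x => unary (M x)) (hN : FP fun x => unary (N x)) :
    FP fun x => unary (M x + N x) :=
  (hM.append hN).unary_length_toList.congr fun x => by simp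

/-- Repeated addition: `N` is added once for each element of the list coding `M`. -/
theorem unary_mul (hM : FP fun x => unary (M x)) (hN : FP fun x => unary (N x)) :
    FP fun x => unary (M x * N x) := by
  have key (l : List Data) (n k : ℕ) : l.foldl (fun a _ =>
      unary ((unary n).toList.length + a.toList.length)) (unary k) = unary (l.length * n + k) := by
    induction l generalizing k with
    | nil => simp
    | cons e l ih =>
      simp only [length_toList_unary] at ih
      simp only [List.foldl_cons, length_toList_unary, ih, List.length_cons]
      congr 1
      ring
  refine (foldl (g := fun c _ a => unary (c.toList.length + a.toList.length))
    (unary_add id.fst.unary_length_toList id.snd.snd.unary_length_toList) hN hM (unary_const 0)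
    (((PolyBdd.const _ 2).mul (hM.size_bdd.mul hN.size_bdd)).add (.const _ 1))
    fun x l' hl' => ?_).congr fun x => ?_
  swap
  · exact (key _ _ 0).trans (by simp)
  rw [key, size_unary]
  have h1 := hl'.length_le
  rw [length_toList_unary] at h1
  have := Nat.mul_le_mul h1 (le_refl (N x))
  simp only [size_unary]
  nlinarith [Nat.zero_le (M x * N x), Nat.zero_le (M x), Nat.zero_le (N x)]

theorem unary_eval (q : Polynomial ℕ) (hN : FP fun x => unary (N x)) :
    FP fun x => unary (q.eval (N x)) := by
  induction q using Polynomial.induction_on' with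
  | add p q hp hq => simpa using unary_add hp hq
  | monomial k c =>
    simp only [Polynomial.eval_monomial]
    refine unary_mul (unary_const c) ?_
    induction k with
    | zero => simpa using unary_const 1
    | succ k ih => simpa [pow_succ] using unary_mul ih hN

theorem unary_polyLength {ℓ : ℕ → ℕ} (hℓ : PolyLength ℓ) (hN : FP fun x => unary (N x)) :
    FP fun x => unary (ℓ (N x)) :=
  PolyTime.comp hN (hℓ.reindex N)

/-- Zipping with `1ᴺ` truncates the list; projecting to second components recovers its elements. -/
theorem take (hN : FP fun x => unary (N x)) (hl : FP l) :
    FP fun x => list ((l x).toList.take (N x)) :=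
  (map (F := fun _ e => e.snd) id.snd.snd id (hN.zip hl)).congr fun x => by
    have key (n : ℕ) (l : List Data) :
        (list (List.zipWith Data.cons (unary n).toList l)).toList.map Data.snd = l.take n := by
      simp only [unary, toList_list]
      induction l generalizing n with
      | nil => simp
      | cons e l ih => cases n <;> simp [List.replicate_succ, ih]
    rw [key]

theorem drop (hN : FP fun x => unary (N x)) (hl : FP l) :
    FP fun x => list ((l x).toList.drop (N x)) := by
  -- Dropping is iterated `snd`. Overshooting is harmless, since `snd` of an atom is the empty list.
  have key (l : List Data) (a : Data) : (l.foldl (fun a _ => a.snd) a).toList =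
      a.toList.drop l.length ∧ (l.foldl (fun a _ => a.snd) a).size ≤ a.size := by
    induction l generalizing a with
    | nil => simp
    | cons e l ih =>
      have := ih a.snd
      simp only [List.foldl_cons, this.1, List.length_cons, toList_snd, List.drop_tail, true_and]
      exact this.2.trans a.size_snd_le
  refine (foldl (g := fun _ _ a => a.snd) id.snd.snd.snd id hN hl hl.size_bdd
    fun x l' hl' => (key _ _).2).toList.congr fun x => ?_
  simp [(key _ _).1]

theorem blockMap {F : Data → Data → Data → Data} (hF : FP fun p => F p.fst p.snd.fst p.snd.snd)
    (hc : FP c) (hN : FP fun x => unary (N x)) (hl : FP l) (hr : FP r) :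
    FP fun x => list (blockMap (fun e b => F (c x) e (list b)) (N x) (l x).toList (r x).toList) := by
  -- The state is the unread rest of the second list together with the reversed results. The block
  -- length travels in the context, in unary.
  let g : Data → Data → Data → Data := fun c e s =>
    .cons (list (s.fst.toList.drop c.snd.toList.length))
      (.cons (F c.fst e (list (s.fst.toList.take c.snd.toList.length))) s.snd)
  have hg : FP fun p => g p.fst p.snd.fst p.snd.snd :=
    cons (id.fst.snd.unary_length_toList.drop id.snd.snd.fst)
      (cons (hF.app3 id.fst.fst id.snd.fst (id.fst.snd.unary_length_toList.take id.snd.snd.fst))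
        id.snd.snd.snd)
  have key (c : Data) (n : ℕ) (l r s : List Data) : ∃ z,
      l.foldl (fun a e => g (.cons c (unary n)) e a) (.cons (list r) (list s)) =
        .cons z (list ((EGPSI.blockMap (fun e b => F c e (list b)) n l r).reverse ++ s)) ∧
      z.size ≤ (list r).size := by
    induction l generalizing r s with
    | nil => exact ⟨list r, by simp [EGPSI.blockMap]⟩
    | cons e l ih =>
      obtain ⟨z, h, hz⟩ := ih (r.drop n) (F c e (list (r.take n)) :: s)
      refine ⟨z, ?_, hz.trans (size_list_sublist (List.drop_sublist _ _))⟩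
      simpa [g, EGPSI.blockMap] using h
  have hlen (f : Data → List Data → Data) (n : ℕ) (l r : List Data) :
      (EGPSI.blockMap f n l r).length = l.length := by
    induction l generalizing r with
    | nil => rfl
    | cons e l ih => simp [EGPSI.blockMap, ih]
  have hmem (f : Data → List Data → Data) (n : ℕ) (l r : List Data) :
      ∀ z ∈ EGPSI.blockMap f n l r, ∃ e ∈ l, ∃ b, (list b).size ≤ (list r).size ∧ z = f e b := by
    induction l generalizing r with
    | nil => simp [EGPSI.blockMap]
    | cons e l ih =>
      intro z hz
      rcases List.mem_cons.1 hz with rfl | hz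
      · exact ⟨e, by simp, _, size_list_sublist (List.take_sublist _ _), rfl⟩
      · obtain ⟨e', he', b, hb, rfl⟩ := ih _ z hz
        exact ⟨e', by simp [he'], b, hb.trans (size_list_sublist (List.drop_sublist _ _)), rfl⟩
  obtain ⟨q, hq⟩ := hF.size_bdd
  have := (foldl (g := g) hg (cons hc hN) hl (cons hr.toList (const (list [])))
    ((hr.size_bdd.add ((hl.size_bdd.mul (((((hc.size_bdd.add hl.size_bdd).add hr.size_bdd).add
      (.const _ 2)).eval q).add (.const _ 1))).add (.const _ 1))).add (.const _ 1))
      fun x l' hl' => ?_)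
  · refine this.snd.reverse.congr fun x => ?_
    obtain ⟨z, h, -⟩ := key (c x) (N x) (l x).toList (r x).toList []
    rw [h]
    simp
  · obtain ⟨z, h, hz⟩ := key (c x) (N x) l' (r x).toList []
    rw [h, size_cons]
    rw [size_list_toList] at hz
    refine Nat.succ_le_succ (Nat.add_le_add hz (size_list_le ?_ fun e he => ?_))
    · have := hl'.length_le.trans (length_toList_le _)
      simpa [hlen] using this
    · simp only [List.append_nil, List.mem_reverse] at he
      obtain ⟨e, he', b, hb, rfl⟩ := hmem _ _ _ _ _ he
      have he := size_le_of_mem_toList (hl'.subset he')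
      rw [size_list_toList] at hb
      refine (hq (.cons (c x) (.cons e (list b)))).trans (polynomial_eval_mono q ?_)
      simp only [size_cons]
      omega

end FP

end EGPSI

namespace EGPSI
open Data

/-! ### Comparison and sorting of bit strings -/

/-- Lexicographic comparison of lists of bits. -/
def lexLT : List Data → List Data → Bool
  | a :: l, b :: l' => if a.truth = b.truth then lexLT l l' else b.truth
  | _, _ => false

/-- Because of asymmetry, an insertion keeps each old element in at most one of the two filtered
parts. This bounds the accumulators of the sorting loop on arbitrary data, even data that do not
code bit strings. -/
theorem lexLT_asymm (l l' : List Data) (h : lexLT l l' = true) : lexLT l' l = false := by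
  induction l generalizing l' with
  | nil => simp [lexLT] at h
  | cons a l ih =>
    cases l' with
    | nil => rfl
    | cons b l' =>
      simp only [lexLT] at h ⊢
      by_cases hab : a.truth = b.truth
      · simp only [hab, if_true] at h ⊢
        exact ih _ h
      · simp only [hab, Ne.symm hab, if_false] at h ⊢
        cases ha : a.truth <;> simp_all

/-- Equality of lists of bits of the same length. -/
def lexEq (l l' : List Data) : Bool := !lexLT l l' && !lexLT l' l

/-- Insertion of `y` into a list that is strictly sorted with respect to `lt`. -/
def insertLT {α : Type} (lt : α → α → Bool) (l : List α) (y : α) : List α :=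
  l.filter (fun e => lt e y) ++ y :: l.filter (fun e => lt y e)

/-- Insertion sort without repetitions. -/
def sortLT {α : Type} (lt : α → α → Bool) (l : List α) : List α := l.foldl (insertLT lt) []

/-- Sorting is natural in comparison-preserving maps. This carries it from bit strings to their
codes. -/
theorem map_sortLT {α β : Type} (f : α → β) {lt : α → α → Bool} {lt' : β → β → Bool}
    (h : ∀ a b, lt' (f a) (f b) = lt a b) (l : List α) :
    sortLT lt' (l.map f) = (sortLT lt l).map f := by
  have key (a : List α) : (l.map f).foldl (insertLT lt') (a.map f) =
      (l.foldl (insertLT lt) a).map f := by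
    induction l generalizing a with
    | nil => rfl
    | cons y l ih =>
      rw [List.map_cons, List.foldl_cons, List.foldl_cons, ← ih]
      congr 1
      simp only [insertLT, List.map_append, List.map_cons, List.filter_map, Function.comp_def, h]
  exact key []

section LinearOrder

variable {α : Type} [LinearOrder α] {lt : α → α → Bool}

theorem mem_sortLT (hlt : ∀ a b, lt a b = true ↔ a < b) (l : List α) (x : α) : x ∈ sortLT lt l ↔ x ∈ l := by
  have key (a : List α) : x ∈ l.foldl (insertLT lt) a ↔ x ∈ a ∨ x ∈ l := by
    induction l generalizing a with
    | nil => simp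
    | cons y l ih =>
      rw [List.foldl_cons, ih]
      simp only [insertLT, List.mem_append, List.mem_cons, List.mem_filter, hlt]
      rcases lt_trichotomy x y with h | h | h
      · simp [h, h.not_gt, h.ne]
      · simp [h]
      · simp [h, h.not_gt, h.ne']
  exact (key []).trans (by simp)

theorem pairwise_sortLT (hlt : ∀ a b, lt a b = true ↔ a < b) (l : List α) : (sortLT lt l).Pairwise (· < ·) := by
  have key (a : List α) (ha : a.Pairwise (· < ·)) :
      (l.foldl (insertLT lt) a).Pairwise (· < ·) := by
    induction l generalizing a with
    | nil => exact ha
    | cons y l ih =>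
      refine ih _ (List.pairwise_append.2 ⟨ha.filter _, List.pairwise_cons.2 ⟨?_, ha.filter _⟩, ?_⟩)
      · simp [hlt]
      · intro x hx z hz
        simp only [List.mem_filter, hlt, List.mem_cons] at hx hz
        rcases hz with rfl | hz
        · exact hx.2
        · exact hx.2.trans hz.2
  exact key [] (by simp)

/-- A finite set has only one strictly increasing listing. -/
theorem sort_toFinset_eq_sortLT [DecidableEq α] (hlt : ∀ a b, lt a b = true ↔ a < b)
    (l : List α) : l.toFinset.sort (fun a b => a ≤ b) = sortLT lt l := by
  have h := pairwise_sortLT hlt l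
  have hn : (sortLT lt l).Nodup := h.imp ne_of_lt
  rw [← (List.toFinset_sort (· ≤ ·) hn).2 (h.imp le_of_lt)]
  congr 1
  ext x
  simp [mem_sortLT hlt]

end LinearOrder

section Bits

variable {n : ℕ}

theorem size_bits (x : Bits n) : (bits x).size = 2 * n + 1 := by
  simp [bits, size_list, List.map_ofFn, Function.comp_def]
  omega

theorem toList_bits (x : Bits n) : (bits x).toList = List.ofFn fun i => Data.atom (x i) := by
  simp [bits]

@[simp] theorem length_toList_bits (x : Bits n) : (bits x).toList.length = n := by
  simp [toList_bits]

theorem lexLT_bits (x y : Bits n) :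
    lexLT (bits x).toList (bits y).toList = true ↔ toLex x < toLex y := by
  simp only [toList_bits]
  induction n with
  | zero =>
    have : x = y := Subsingleton.elim _ _
    simp only [lexLT, this, List.ofFn_zero, Bool.false_eq_true, false_iff]
    exact lt_irrefl (toLex y : Lex (Bits 0))
  | succ n ih =>
    induction x using Fin.consCases with | _ x₀ x => ?_
    induction y using Fin.consCases with | _ y₀ y => ?_
    have h : toLex (Fin.cons x₀ x : Bits (n + 1)) < toLex (Fin.cons y₀ y : Bits (n + 1)) ↔
        x₀ < y₀ ∨ x₀ = y₀ ∧ toLex x < toLex y :=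
      Fin.pi_lex_lt_cons_cons (α := fun _ => Bool) (s := fun {_} a b => a < b)
    have := ih x y
    simp only [List.ofFn_succ, Fin.cons_zero, Fin.cons_succ, lexLT, truth_atom, h]
    by_cases hxy : x₀ = y₀
    · simp [hxy, this]
    · cases x₀ <;> cases y₀ <;> simp_all

theorem lexEq_bits (x y : Bits n) : lexEq (bits x).toList (bits y).toList = true ↔ x = y := by
  simp only [lexEq, Bool.and_eq_true, Bool.not_eq_true', ← Bool.not_eq_true, lexLT_bits]
  refine ⟨fun h => ?_, fun h => ?_⟩
  swap
  · rw [h, and_self]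
    exact lt_irrefl (toLex y : Lex (Bits n))
  rcases lt_trichotomy (α := Lex (Bits n)) (toLex x) (toLex y) with h' | h' | h'
  · exact absurd h' h.1
  · exact toLex.injective h'
  · exact absurd h' h.2

@[simp] theorem mem_sorted {s : Finset (Bits n)} {x : Bits n} : x ∈ sorted s ↔ x ∈ s := by
  simp only [sorted, List.mem_map, Finset.mem_sort, Finset.mem_map_equiv]
  constructor
  · rintro ⟨a, ha, rfl⟩
    exact ha
  · exact fun h => ⟨toLex x, h, rfl⟩

theorem nodup_sorted (s : Finset (Bits n)) : (sorted s).Nodup :=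
  (Finset.sort_nodup _ _).map ofLex.injective

@[simp] theorem length_sorted (s : Finset (Bits n)) : (sorted s).length = s.card := by
  simp [sorted]

/-- The canonical code of a set is computable from any listing of it, in any order and with
repetitions. Simulators and reductions use this to produce encrypted sets. -/
theorem bitsSet_toFinset (l : List (Bits n)) :
    bitsSet l.toFinset = list (sortLT (fun a b => lexLT a.toList b.toList) (l.map bits)) := by
  have h : l.toFinset.map (toLex : Bits n ≃ Lex (Bits n)).toEmbedding =
      (l.map toLex).toFinset := by
    ext x
    simp only [Finset.mem_map_equiv, List.mem_toFinset, List.mem_map]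
    exact ⟨fun h => ⟨_, h, rfl⟩, fun ⟨a, ha, e⟩ => e ▸ ha⟩
  have h2 := map_sortLT (fun x : Lex (Bits n) => bits (ofLex x))
    (lt := fun a b => lexLT (bits (ofLex a)).toList (bits (ofLex b)).toList)
    (lt' := fun a b => lexLT a.toList b.toList) (fun _ _ => rfl) (l.map toLex)
  rw [List.map_map] at h2
  have h3 := sort_toFinset_eq_sortLT (α := Lex (Bits n))
    (fun a b => lexLT_bits (ofLex a) (ofLex b)) (l.map toLex)
  rw [bitsSet, sorted, h, List.map_map]
  exact congrArg list ((congrArg _ h3).trans h2.symm)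

end Bits

namespace FP

variable {a b c l : Data → Data}

theorem lexLT (ha : FP a) (hb : FP b) :
    FP fun x => .atom (lexLT (a x).toList (b x).toList) := by
  -- An atom as state means that no difference has been found yet; a pair carries the final verdict
  -- in its first component. Taking `fst` at the end turns "undecided" into `false`.
  let g : Data → Data → Data := fun e s =>
    if s.isCons.truth = true then s else
      if e.fst.truth = true then
        if e.snd.truth = true then s else .cons (.atom false) (.atom false)
      else if e.snd.truth = true then .cons (.atom true) (.atom false) else s
  have hg : FP fun p => g p.snd.fst p.snd.snd :=
    id.snd.snd.isCons.ite id.snd.snd (id.snd.fst.fst.ite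
      (id.snd.fst.snd.ite id.snd.snd (const _)) (id.snd.fst.snd.ite (const _) id.snd.snd))
  have h0 (l : List Data) (s t : Data) : l.foldl (fun s e => g e s) (.cons s t) = .cons s t := by
    induction l with
    | nil => rfl
    | cons e l ih => simpa [g] using ih
  have key (l l' : List Data) : ((List.zipWith Data.cons l l').foldl (fun s e => g e s)
      (.atom false)).fst = .atom (EGPSI.lexLT l l') := by
    induction l generalizing l' with
    | nil => rfl
    | cons u l ih =>
      cases l' with
      | nil => rfl
      | cons v l' =>
        simp only [List.zipWith_cons_cons, List.foldl_cons, EGPSI.lexLT]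
        have huv : g (.cons u v) (.atom false) = if u.truth = v.truth then .atom false else
            .cons (.atom v.truth) (.atom false) := by
          cases hu : u.truth <;> cases hv : v.truth <;> simp [g, hu, hv]
        rw [huv]
        split_ifs
        · exact ih l'
        · rw [h0, fst_cons]
  have hsize (l : List Data) (s : Data) (hs : s.size ≤ 3) :
      (l.foldl (fun s e => g e s) s).size ≤ 3 := by
    induction l generalizing s with
    | nil => exact hs
    | cons e l ih =>
      refine ih _ ?_
      simp only [g]
      split_ifs <;> simp [hs]
  refine (foldl (g := fun _ e s => g e s) hg id (ha.zip hb) (const (.atom false)) (.const _ 3)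
    fun x l' _ => hsize _ _ (by simp)).fst.congr fun x => ?_
  rw [toList_list, key]

theorem lexEq (ha : FP a) (hb : FP b) :
    FP fun x => .atom (lexEq (a x).toList (b x).toList) :=
  (ha.lexLT hb).not.and (hb.lexLT ha).not

theorem any {t : Data → Data → Bool} (ht : FP fun p => .atom (t p.fst p.snd)) (hc : FP c)
    (hl : FP l) : FP fun x => .atom ((l x).toList.any (t (c x))) :=
  (filter ht hc hl).isCons.truth.congr fun x => by
    rw [truth_isCons, toList_list]
    congr 1
    rw [Bool.eq_iff_iff]
    simp [List.any_eq_true]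

theorem sortLT (hl : FP l) :
    FP fun x => list (sortLT (fun a b => EGPSI.lexLT a.toList b.toList) (l x).toList) := by
  let g : Data → Data → Data := fun y s =>
    list (insertLT (fun a b => EGPSI.lexLT a.toList b.toList) s.toList y)
  have hg : FP fun p => g p.snd.fst p.snd.snd := by
    have := (filter (t := fun c e => EGPSI.lexLT e.toList c.toList) (id.snd.lexLT id.fst)
      id.snd.fst id.snd.snd).append
      (cons id.snd.fst (filter (t := fun c e => EGPSI.lexLT c.toList e.toList)
        (id.fst.lexLT id.snd) id.snd.fst id.snd.snd))
    exact this.congr fun x => by simp only [toList_list, toList_cons, g, insertLT]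
  have key (l a : List Data) : l.foldl (fun s y => g y s) (list a) =
      list (l.foldl (insertLT fun a b => EGPSI.lexLT a.toList b.toList) a) := by
    induction l generalizing a with
    | nil => rfl
    | cons y l ih => simpa [g] using ih _
  -- By `lexLT_asymm` no element passes both filters, so only the new element adds to the size.
  have hins (y : Data) (a : List Data) :
      (list (insertLT (fun a b => EGPSI.lexLT a.toList b.toList) a y)).size ≤
        (list a).size + (y.size + 1) := by
    induction a with
    | nil => simp [insertLT]
    | cons e a ih =>
      simp only [insertLT, size_list, List.filter_cons, List.map_append, List.sum_append,
        List.map_cons, List.sum_cons] at ih ⊢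
      have := lexLT_asymm e.toList y.toList
      split_ifs with h1 h2
      · simp_all
      all_goals
        try simp only [List.map_cons, List.sum_cons]
        omega
  have hsize (l a : List Data) :
      (list (l.foldl (insertLT fun a b => EGPSI.lexLT a.toList b.toList) a)).size ≤
        (list a).size + (list l).size := by
    induction l generalizing a with
    | nil => simp
    | cons y l ih =>
      have h1 := ih (insertLT (fun a b => EGPSI.lexLT a.toList b.toList) a y)
      have h2 := hins y a
      simp only [List.foldl_cons, list_cons, size_cons]
      omega
  refine (foldl (g := fun _ y s => g y s) hg id hl (const (list []))
    (hl.size_bdd.add (.const _ 1)) fun x l' hl' => ?_).congr fun x => key _ _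
  rw [key]
  have h1 := hsize l' []
  have h2 := size_list_le_of_prefix hl'
  simp only [list_nil, size_atom] at h1
  omega

end FP

end EGPSI

namespace EGPSI
open Data

/-! ## Averages over finite probability spaces -/

section Expect

variable {Ω Ω' A B R Q : Type} [Fintype Ω] [Fintype Ω'] [Fintype A] [Fintype B] [Fintype R]
  [Fintype Q]

theorem expect_prod (f : Ω × Ω' → ℝ) : 𝔼 p, f p = 𝔼 a, 𝔼 b, f (a, b) := by
  rw [← Finset.univ_product_univ, Finset.expect_product]

theorem abs_expect_le [Nonempty Ω] {f : Ω → ℝ} {δ : ℝ} (h : ∀ ω, |f ω| ≤ δ) : |𝔼 ω, f ω| ≤ δ :=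
  (Finset.abs_expect_le _ _).trans (Finset.expect_le Finset.univ_nonempty fun ω _ => h ω)

theorem abs_expect_sub_le [Nonempty Ω] {f g : Ω → ℝ} {δ : ℝ} (h : ∀ ω, |f ω - g ω| ≤ δ) :
    |𝔼 ω, f ω - 𝔼 ω, g ω| ≤ δ := by
  rw [← Finset.expect_sub_distrib]
  exact abs_expect_le h

theorem abs_expect_sub_le_expect {f g h : Ω → ℝ} (hfg : ∀ ω, |f ω - g ω| ≤ h ω) :
    |𝔼 ω, f ω - 𝔼 ω, g ω| ≤ 𝔼 ω, h ω := by
  rw [← Finset.expect_sub_distrib]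
  exact (Finset.abs_expect_le _ _).trans (Finset.expect_le_expect fun ω _ => hfg ω)

theorem expect_fst [Nonempty Ω'] (f : Ω → ℝ) : 𝔼 p : Ω × Ω', f p.1 = 𝔼 a, f a := by
  rw [expect_prod]
  simp

theorem expect_snd [Nonempty Ω] (f : Ω' → ℝ) : 𝔼 p : Ω × Ω', f p.2 = 𝔼 a, f a := by
  rw [expect_prod]
  simp

/-- Restricting a uniformly random function along an injection gives a uniformly random
function. -/
theorem expect_comp_injective [DecidableEq A] [DecidableEq B] [Nonempty R] {φ : A → B}
    (hφ : φ.Injective) (h : (A → R) → ℝ) : 𝔼 r : B → R, h (r ∘ φ) = 𝔼 w, h w := by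
  classical
  -- A function on `B` splits into its part on the range of `φ`, which is a function on `A`, and an
  -- independent part on the complement.
  let e : (B → R) ≃ (A → R) × ({b // ¬ b ∈ Set.range φ} → R) :=
    (Equiv.piEquivPiSubtypeProd (fun b => b ∈ Set.range φ) fun _ => R).trans
      (Equiv.prodCongr ((Equiv.ofInjective φ hφ).arrowCongr (Equiv.refl R)).symm (Equiv.refl _))
  rw [Fintype.expect_equiv e (fun r : B → R => h (r ∘ φ)) (fun p => h p.1) fun r => ?_, expect_fst]
  congr 1

theorem expect_eval [DecidableEq A] [Nonempty R] (a : A) (h : R → ℝ) :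
    𝔼 ω : A → R, h (ω a) = 𝔼 r, h r := by
  refine (expect_comp_injective (φ := fun _ : Unit => a) (fun _ _ _ => rfl) fun w => h (w ())).trans ?_
  exact Fintype.expect_equiv (Equiv.funUnique Unit R) _ _ fun _ => rfl

/-- A coordinate of a uniformly random function may be drawn anew. -/
theorem expect_update [DecidableEq A] [Nonempty R] (a : A) (f : (A → R) → ℝ) :
    𝔼 ω : A → R, f ω = 𝔼 ω : A → R, 𝔼 r, f (Function.update ω a r) := by
  let e := Equiv.funSplitAt a R
  have h (ω : A → R) (r : R) : Function.update ω a r = e.symm (r, (e ω).2) := by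
    ext b
    by_cases hb : b = a
    · subst hb; simp [e, Equiv.funSplitAt, Equiv.piSplitAt]
    · simp [e, Equiv.funSplitAt, Equiv.piSplitAt, hb]
  rw [Fintype.expect_equiv e f (fun p => f (e.symm p)) (by simp),
    Fintype.expect_equiv e _ (fun p => 𝔼 r, f (e.symm (r, p.2))) (fun ω => by simp only [h]),
    expect_snd (Ω := R) (fun q => 𝔼 r, f (e.symm (r, q))), expect_prod, Finset.expect_comm]

/-- The hybrid argument: replacing, in independent slots, the values `V a` by the values `W a`. -/
theorem hybrid {α : Type} [DecidableEq A] [Nonempty R] [Nonempty Q] (V : A → R → α)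
    (W : A → Q → α) (G : (A → α) → ℝ) (s : Finset A)
    (hs : ∀ v v' : A → α, (∀ a ∈ s, v a = v' a) → G v = G v') (δ : ℝ)
    (h : ∀ a ∈ s, ∀ v : A → α, (∀ b, (∃ r, v b = V b r) ∨ ∃ q, v b = W b q) →
      |𝔼 r, G (Function.update v a (V a r)) - 𝔼 q, G (Function.update v a (W a q))| ≤ δ) :
    |𝔼 ω : A → R, G (fun a => V a (ω a)) - 𝔼 ρ : A → Q, G fun a => W a (ρ a)| ≤ s.card * δ := by
  -- The hybrid in which the slots in `t` are already replaced. Both samples `ω` and `ρ` are drawn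
  -- in full, so that moving one slot into `t` amounts to redrawing a single coordinate with
  -- `expect_update`.
  let v : Finset A → (A → R) → (A → Q) → A → α := fun t ω ρ a =>
    if a ∈ t then W a (ρ a) else V a (ω a)
  have hv (t : Finset A) (ω : A → R) (ρ : A → Q) (b : A) :
      (∃ r, v t ω ρ b = V b r) ∨ ∃ q, v t ω ρ b = W b q := by
    by_cases hb : b ∈ t
    · exact Or.inr ⟨ρ b, by simp [v, hb]⟩
    · exact Or.inl ⟨ω b, by simp [v, hb]⟩
  have key : ∀ t ⊆ s, |𝔼 ω : A → R, G (fun a => V a (ω a)) -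
      𝔼 ω : A → R, 𝔼 ρ : A → Q, G (v t ω ρ)| ≤ t.card * δ := by
    intro t
    induction t using Finset.induction_on with
    | empty => simp [v]
    | insert a t ha ih =>
      intro hts
      have h1 := ih fun b hb => hts (Finset.mem_insert_of_mem hb)
      have h2 : 𝔼 ω : A → R, 𝔼 ρ : A → Q, G (v t ω ρ) = 𝔼 ω : A → R, 𝔼 ρ : A → Q, 𝔼 r,
          G (Function.update (v t ω ρ) a (V a r)) := by
        rw [expect_update a]
        refine Finset.expect_congr rfl fun ω _ => ?_
        rw [Finset.expect_comm]
        refine Finset.expect_congr rfl fun ρ _ => Finset.expect_congr rfl fun r _ => ?_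
        congr 1
        ext b
        by_cases hb : b = a
        · subst hb; simp [v, ha]
        · simp [v, hb]
      have h3 : 𝔼 ω : A → R, 𝔼 ρ : A → Q, G (v (insert a t) ω ρ) =
          𝔼 ω : A → R, 𝔼 ρ : A → Q, 𝔼 q, G (Function.update (v t ω ρ) a (W a q)) := by
        refine Finset.expect_congr rfl fun ω _ => ?_
        rw [expect_update a]
        refine Finset.expect_congr rfl fun ρ _ => Finset.expect_congr rfl fun r _ => ?_
        congr 1
        ext b
        by_cases hb : b = a
        · subst hb; simp [v]
        · simp [v, hb]
      have h4 : |𝔼 ω : A → R, 𝔼 ρ : A → Q, G (v t ω ρ) -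
          𝔼 ω : A → R, 𝔼 ρ : A → Q, G (v (insert a t) ω ρ)| ≤ δ := by
        rw [h2, h3]
        exact abs_expect_sub_le fun ω => abs_expect_sub_le fun ρ =>
          h a (hts (Finset.mem_insert_self _ _)) _ (hv t ω ρ)
      rw [Finset.card_insert_of_notMem ha]
      push_cast
      linarith [abs_sub_le (𝔼 ω : A → R, G (fun a => V a (ω a)))
        (𝔼 ω : A → R, 𝔼 ρ : A → Q, G (v t ω ρ))
        (𝔼 ω : A → R, 𝔼 ρ : A → Q, G (v (insert a t) ω ρ))]
  have h5 : 𝔼 ω : A → R, 𝔼 ρ : A → Q, G (v s ω ρ) = 𝔼 ρ : A → Q, G fun a => W a (ρ a) := by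
    rw [← Fintype.expect_const (ι := A → R) (𝔼 ρ : A → Q, G fun a => W a (ρ a))]
    refine Finset.expect_congr rfl fun ω _ => Finset.expect_congr rfl fun ρ _ => hs _ _ ?_
    intro a ha
    simp [v, ha]
  rw [← h5]
  exact key s subset_rfl

end Expect

section Law

variable {Ω Ω' α : Type} [Fintype Ω] [Nonempty Ω]

open Classical in
theorem toReal_law (X : Ω → α) (s : Set α) :
    ((law X).toOuterMeasure s).toReal = 𝔼 ω, if X ω ∈ s then (1 : ℝ) else 0 := by
  rw [law, PMF.toOuterMeasure_map_apply, PMF.toOuterMeasure_uniformOfFintype_apply,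
    Fintype.expect_eq_sum_div_card, ENNReal.toReal_div]
  simp [Fintype.card_subtype]

open Classical in
theorem prob_eq_expect (E : Ω → Prop) : prob E = 𝔼 ω, if E ω then (1 : ℝ) else 0 := by
  have := toReal_law E {p | p}
  rw [law, PMF.toOuterMeasure_map_apply] at this
  exact this

/-- The answer of a distinguisher as a number. -/
def Distinguisher.val (D : Distinguisher) (n : ℕ) (z : Data) : ℝ :=
  if D.test n z = true then 1 else 0

theorem Distinguisher.val_nonneg (D : Distinguisher) (n : ℕ) (z : Data) : 0 ≤ D.val n z := by
  unfold val; split_ifs <;> norm_num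

theorem Distinguisher.val_le_one (D : Distinguisher) (n : ℕ) (z : Data) : D.val n z ≤ 1 := by
  unfold val; split_ifs <;> norm_num

theorem Distinguisher.accept_law (D : Distinguisher) (n : ℕ) (X : Ω → Data) :
    D.accept n (law X) = 𝔼 ω, D.val n (X ω) := by
  rw [accept, toReal_law]
  exact Finset.expect_congr rfl fun ω _ => by simp [val]

/-- The number of coins occurs in a type; a free variable for it avoids casts. -/
theorem PPT.dist_eq (A : PPT) {x : Data} {m : ℕ} (h : A.coins.eval x.size = m) :
    A.dist x = law fun r : Bits m => A.run (.cons x (bits r)) := by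
  subst h; rfl

end Law

/-! ## Negligible functions -/

namespace Negligible

variable {ε δ : ℕ → ℝ}

theorem add (hε : Negligible ε) (hδ : Negligible δ) : Negligible fun n => ε n + δ n :=
  Asymptotics.SuperpolynomialDecay.add hε hδ

theorem abs (hε : Negligible ε) : Negligible fun n => |ε n| := by
  have := (Asymptotics.superpolynomialDecay_iff_superpolynomialDecay_abs _ _ _).1 hε
  simpa only [Negligible, Nat.abs_cast] using this

theorem mono (hδ : Negligible δ) (h : ∀ n, |ε n| ≤ |δ n|) : Negligible ε :=
  Asymptotics.SuperpolynomialDecay.trans_abs_le hδ h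

theorem polynomial_mul (hε : Negligible ε) (q : Polynomial ℕ) :
    Negligible fun n => ((q.eval n : ℕ) : ℝ) * ε n := by
  refine (Asymptotics.SuperpolynomialDecay.polynomial_mul hε
    (q.map (Nat.castRingHom ℝ))).congr fun n => ?_
  rw [Polynomial.eval_natCast_map]
  simp

theorem const_mul (hε : Negligible ε) (c : ℝ) : Negligible fun n => c * ε n :=
  Asymptotics.SuperpolynomialDecay.const_mul hε c

end Negligible

/-- A bounded family of advantages is uniformly negligible if it is negligible along every selection
of one member (or none) for each security parameter. -/
theorem exists_negligible_of_forall_selection {T : ℕ → Type} (adv : ∀ n, T n → ℝ)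
    (h0 : ∀ n t, 0 ≤ adv n t) (h1 : ∀ n t, adv n t ≤ 1)
    (h : ∀ τ : ∀ n, Option (T n), ∃ ε, Negligible ε ∧ ∀ n t, τ n = some t → adv n t ≤ ε n) :
    ∃ ε, Negligible ε ∧ (∀ n, 0 ≤ ε n) ∧ ∀ n t, adv n t ≤ ε n := by
  have hb (n : ℕ) : BddAbove (Set.range (adv n)) := ⟨1, by rintro _ ⟨t, rfl⟩; exact h1 n t⟩
  have hsup (n : ℕ) : 0 ≤ ⨆ t, adv n t := Real.iSup_nonneg (h0 n)
  -- Select a member reaching at least half of the supremum. If the supremum is zero, in particular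
  -- if there are no members, select none. The supremum is then at most twice the selected
  -- advantage.
  have hsel (n : ℕ) : ∃ o : Option (T n), (o = none → ⨆ t, adv n t = 0) ∧
      ∀ t, o = some t → ⨆ t, adv n t ≤ 2 * adv n t := by
    rcases (hsup n).eq_or_lt with hz | hpos
    · exact ⟨none, fun _ => hz.symm, by simp⟩
    · have : Nonempty (T n) := by
        by_contra hne
        rw [not_nonempty_iff] at hne
        simp at hpos
      obtain ⟨t, ht⟩ := exists_lt_of_lt_ciSup (half_lt_self hpos)
      refine ⟨some t, by simp, ?_⟩
      rintro _ ⟨rfl⟩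
      linarith
  choose τ hτ0 hτ using hsel
  obtain ⟨ε, hε, hle⟩ := h τ
  refine ⟨fun n => ⨆ t, adv n t, (hε.const_mul 2).mono fun n => ?_, hsup,
    fun n t => le_ciSup (hb n) t⟩
  rw [abs_of_nonneg (hsup n)]
  cases hn : τ n with
  | none => rw [hτ0 n hn]; positivity
  | some t => exact ((hτ n t hn).trans (by linarith [hle n t hn])).trans (le_abs_self _)

end EGPSI

namespace EGPSI
open Data

/-! ## Contexts -/

/-- Places a datum into a hole of a tree, given by the path from the hole to the root: at each step
the side on which the sibling stands (`true` for left) and the sibling. -/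
def plug (l : List Data) (z : Data) : Data :=
  l.foldl (fun a e => if e.fst.truth = true then .cons e.snd a else .cons a e.snd) z

theorem FP.plug {l a : Data → Data} (hl : FP l) (ha : FP a) :
    FP fun x => plug (l x).toList (a x) := by
  have key (l : List Data) (a : Data) : (EGPSI.plug l a).size ≤ (list l).size + a.size := by
    induction l generalizing a with
    | nil => simp [EGPSI.plug]
    | cons e l ih =>
      have h1 := ih (if e.fst.truth = true then .cons e.snd a else .cons a e.snd)
      have h2 := e.size_snd_le
      simp only [EGPSI.plug, List.foldl_cons, list_cons, size_cons] at h1 ⊢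
      refine h1.trans ?_
      split_ifs <;> simp only [size_cons] <;> omega
  refine foldl (g := fun _ e a => if e.fst.truth = true then .cons e.snd a else .cons a e.snd)
    (id.snd.fst.fst.ite (cons id.snd.fst.snd id.snd.snd) (cons id.snd.snd id.snd.fst.snd)) id hl ha
    (hl.size_bdd.add ha.size_bdd) fun x l' hl' => (key _ _).trans ?_
  have := size_list_le_of_prefix hl'
  omega

/-- Functions that place a datum into a fixed context. -/
def IsContext (f : Data → Data) : Prop :=
  ∃ l : List Data, (∀ z, f z = plug l z) ∧ (list l).size ≤ 3 * (f (.atom false)).size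

namespace IsContext

variable {f : Data → Data}

theorem id : IsContext fun z => z := ⟨[], fun _ => rfl, by simp⟩

theorem cons_left (hf : IsContext f) (d : Data) : IsContext fun z => .cons d (f z) := by
  obtain ⟨l, hl, hs⟩ := hf
  -- Paths run from the hole to the root, so a new root is appended at the end. Coding this step
  -- costs `d.size + 3` while the tree grows by `d.size + 1`, so the factor `3` is enough.
  refine ⟨l ++ [.cons (.atom true) d], fun z => by simp [plug, hl], ?_⟩
  have := size_list_append l [.cons (.atom true) d]
  simp only [size_cons, list_cons, list_nil, size_atom] at this ⊢
  omega

theorem cons_right (hf : IsContext f) (d : Data) : IsContext fun z => .cons (f z) d := by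
  obtain ⟨l, hl, hs⟩ := hf
  refine ⟨l ++ [.cons (.atom false) d], fun z => by simp [plug, hl], ?_⟩
  have := size_list_append l [.cons (.atom false) d]
  simp only [size_cons, list_cons, list_nil, size_atom] at this ⊢
  omega

theorem list_append (hf : IsContext f) (l l' : List Data) :
    IsContext fun z => list (l ++ f z :: l') := by
  induction l with
  | nil => exact hf.cons_right _
  | cons d l ih => exact ih.cons_left d

/-- Without repetitions `a` occurs exactly once, so a single entry of the list depends on the hole.
-/
theorem list_map {α : Type} {s : List α} (hs : s.Nodup) {a : α} (ha : a ∈ s)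
    {F : Data → α → Data} (hF : ∀ z z', ∀ b ∈ s, b ≠ a → F z b = F z' b)
    (h : IsContext fun z => F z a) : IsContext fun z => list (s.map (F z)) := by
  obtain ⟨s₁, s₂, rfl⟩ := List.append_of_mem ha
  have hd := List.nodup_middle.1 hs
  rw [List.nodup_cons, List.mem_append] at hd
  convert h.list_append (s₁.map (F (.atom false))) (s₂.map (F (.atom false))) using 2 with z
  rw [List.map_append, List.map_cons]
  congr 2
  · refine List.map_congr_left fun b hb => hF _ _ b (by simp [hb]) ?_
    rintro rfl
    exact hd.1 (Or.inl hb)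
  · congr 1
    refine List.map_congr_left fun b hb => hF _ _ b (by simp [hb]) ?_
    rintro rfl
    exact hd.1 (Or.inr hb)

end IsContext

/-- The distinguisher that applies `D` to the result of a polynomial-time function of an advice
and the sample. -/
def Distinguisher.comp (D : Distinguisher) (w : ℕ → Data)
    (hw : PolyBdd (fun n : ℕ => n) fun n => (w n).size) (F : Data → Data → Data)
    (hF : FP fun p => F p.fst p.snd) : Distinguisher where
  advice n := .cons (D.advice n) (w n)
  advice_bound := (PolyBdd.add (PolyBdd.add D.advice_bound hw) (.const _ 1))
  test n z := D.test n (F (w n) z)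
  polyTime := by
    have h : FP fun x => .cons x.fst.fst (F x.fst.snd x.snd) :=
      FP.id.fst.fst.cons (hF.app2 FP.id.fst.snd FP.id.snd)
    exact PolyTime.comp (h.reindex fun p : ℕ × Data => .cons (.cons (D.advice p.1) (w p.1)) p.2)
      (D.polyTime.reindex fun p : ℕ × Data => (p.1, F (w p.1) p.2))

/-- Indistinguishable samples remain so in contexts of polynomial size. -/
theorem CompIndist.context {I : ℕ → Type} {X Y : ∀ n, I n → PMF Data} (h : CompIndist X Y)
    (D : Distinguisher) {b : ℕ → ℕ} (hb : PolyBdd (fun n => n) b) :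
    ∃ ε, Negligible ε ∧ (∀ n, 0 ≤ ε n) ∧ ∀ n i f, IsContext f → (f (.atom false)).size ≤ b n →
      |D.accept n ((X n i).map f) - D.accept n ((Y n i).map f)| ≤ ε n := by
  -- An instance is an input together with the path describing the context. The path selected for
  -- each `n` becomes advice of the distinguisher; its length is polynomial by the bound built into
  -- `IsContext`.
  let T (n : ℕ) : Type := {p : I n × List Data // (list p.2).size ≤ 3 * b n}
  have h01 (n : ℕ) (X : PMF Data) : 0 ≤ D.accept n X ∧ D.accept n X ≤ 1 := by
    refine ⟨ENNReal.toReal_nonneg, ENNReal.toReal_le_of_le_ofReal zero_le_one ?_⟩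
    rw [ENNReal.ofReal_one]
    refine (X.toOuterMeasure.mono (Set.subset_univ _)).trans_eq ?_
    exact (PMF.toOuterMeasure_apply_eq_one_iff _ _).2 (Set.subset_univ _)
  let adv (n : ℕ) (t : T n) : ℝ := |D.accept n ((X n t.1.1).map (plug t.1.2)) -
      D.accept n ((Y n t.1.1).map (plug t.1.2))|
  have hsel (τ : ∀ n, Option (T n)) : ∃ ε, Negligible ε ∧ ∀ n t, τ n = some t → adv n t ≤ ε n := by
    let w (n : ℕ) : Data := list (((τ n).map fun t => t.1.2).getD [])
    have hw : PolyBdd (fun n : ℕ => n) fun n => (w n).size := by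
      refine ((PolyBdd.const _ 3).mul hb).add (.const _ 1) |>.mono fun n => ?_
      cases hn : τ n with
      | none => simp [w, hn]
      | some t =>
        have := t.2
        simp only [w, hn, Option.map_some, Option.getD_some]
        omega
    obtain ⟨ε, hε, hle⟩ := h (D.comp w hw (fun w z => plug w.toList z)
      (FP.plug FP.id.fst FP.id.snd))
    refine ⟨ε, hε, fun n t hn => ?_⟩
    have hacc (Z : PMF Data) : (D.comp w hw (fun w z => plug w.toList z)
        (FP.plug FP.id.fst FP.id.snd)).accept n Z = D.accept n (Z.map (plug t.1.2)) := by
      rw [Distinguisher.accept, Distinguisher.accept, PMF.toOuterMeasure_map_apply]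
      congr 2
      ext z
      simp [Distinguisher.comp, w, hn]
    simpa only [hacc] using hle n t.1.1
  obtain ⟨ε, hε, hε0, hle⟩ := exists_negligible_of_forall_selection adv (fun _ _ => abs_nonneg _)
    (fun n t => by
      have h1 := h01 n ((X n t.1.1).map (plug t.1.2))
      have h2 := h01 n ((Y n t.1.1).map (plug t.1.2))
      rw [abs_le]
      constructor <;> linarith) hsel
  refine ⟨ε, hε, hε0, fun n i f hf hs => ?_⟩
  obtain ⟨l, hl, hls⟩ := hf
  obtain rfl : f = plug l := funext hl
  exact hle n ⟨(i, l), hls.trans (Nat.mul_le_mul_left 3 hs)⟩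

theorem law_map {Ω α β : Type} [Fintype Ω] [Nonempty Ω] (X : Ω → α) (f : α → β) :
    (law X).map f = law fun ω => f (X ω) := by
  rw [law, law, PMF.map_comp]
  rfl

end EGPSI

/-! ### Replacing independent samples in many slots of a view -/

namespace EGPSI
open Data

theorem IsContext.list_ofFn {n : ℕ} (a : Fin n) {F : Data → Fin n → Data}
    (hF : ∀ z z' b, b ≠ a → F z b = F z' b) (h : IsContext fun z => F z a) :
    IsContext fun z => list (List.ofFn (F z)) := by
  simp only [List.ofFn_eq_map]
  exact IsContext.list_map (List.nodup_finRange n) (List.mem_finRange a)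
    (fun z z' b _ => hF z z' b) h

/-- Indistinguishability is preserved when independent samples are placed into polynomially many
slots of a view of polynomial size. -/
theorem CompIndist.hybrid {I : ℕ → Type} {X Y : ∀ n, I n → PMF Data} (h : CompIndist X Y)
    (D : Distinguisher) {b : ℕ → ℕ} (hb : PolyBdd (fun n => n) b) :
    ∃ ε, Negligible ε ∧ (∀ n, 0 ≤ ε n) ∧ ∀ n {A R Q : Type} [Fintype A] [DecidableEq A]
      [Fintype R] [Nonempty R] [Fintype Q] [Nonempty Q] (ix : A → I n) (V : A → R → Data)
      (W : A → Q → Data) (G : (A → Data) → Data) (s : Finset A),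
      (∀ a, X n (ix a) = law (W a)) → (∀ a, Y n (ix a) = law (V a)) →
      (∀ v v' : A → Data, (∀ a ∈ s, v a = v' a) → G v = G v') →
      (∀ a ∈ s, ∀ v, IsContext fun z => G (Function.update v a z)) →
      (∀ v, (∀ a, (∃ r, v a = V a r) ∨ (∃ q, v a = W a q) ∨ v a = .atom false) →
        (G v).size ≤ b n) →
      |𝔼 ω : A → R, D.val n (G fun a => V a (ω a)) -
        𝔼 ρ : A → Q, D.val n (G fun a => W a (ρ a))| ≤ s.card * ε n := by
  obtain ⟨ε, hε, hε0, hle⟩ := h.context D hb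
  refine ⟨ε, hε, hε0, ?_⟩
  intro n A R Q _ _ _ _ _ _ ix V W G s hW hV hs hctx hsize
  refine EGPSI.hybrid V W (fun v => D.val n (G v)) s (fun v v' hv => by rw [hs v v' hv]) (ε n) ?_
  intro a ha v hv
  -- A context is measured with the atom `0` in its hole; this is the third alternative in the size
  -- hypothesis.
  have := hle n (ix a) _ (hctx a ha v) (hsize _ fun c => ?_)
  · rw [hW, hV, law_map, law_map, D.accept_law, D.accept_law, abs_sub_comm] at this
    exact this
  · by_cases hc : c = a
    · subst hc; simp
    · rcases hv c with hr | hq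
      · exact Or.inl (by simpa [hc] using hr)
      · exact Or.inr (Or.inl (by simpa [hc] using hq))

/-! ## Sizes -/

/-- The output `1^(ℓ n)` cannot be longer than the time spent on `1ⁿ`. -/
theorem PolyLength.polyBdd {ℓ : ℕ → ℕ} (h : PolyLength ℓ) : PolyBdd (fun n => n) ℓ := by
  have h1 : PolyBdd (fun n : ℕ => n) fun n => (unary n).size :=
    (((PolyBdd.const _ 2).mul (.self _)).add (.const _ 1)).mono fun n => (size_unary n).le
  refine (h1.trans (PolyTime.polyBdd h)).mono fun n => ?_
  rw [size_unary]
  omega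

theorem length_transcript (cm sm : List Data → Data) (t : ℕ) :
    (transcript cm sm t).1.length = t ∧ (transcript cm sm t).2.length = t := by
  induction t with
  | zero => simp [transcript]
  | succ t ih => simp [transcript, ih]

namespace OPRFProtocol

variable {F : FunFamily} (P : OPRFProtocol F)

theorem exists_view_bound : ∃ b : ℕ → ℕ, PolyBdd (fun n => n) b ∧ (∀ n k x rc rs,
    (P.clientView n k x rc rs).size ≤ b n) ∧ ∀ n k x rc rs, (P.serverView n k x rc rs).size ≤ b n := by
  obtain ⟨q, hq⟩ := P.msg_bound
  let msgs (n : ℕ) : ℕ := P.rounds n * (q.eval n + 1) + 1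
  have hmsgs : PolyBdd (fun n => n) msgs :=
    (P.rounds_poly.polyBdd.mul (PolyBdd.add ⟨q, fun _ => le_rfl⟩ (.const _ 1))).add (.const _ 1)
  refine ⟨fun n => 2 * F.u n + 2 * P.clientCoins n + 2 * P.serverCoins n + 2 * n + msgs n + 6,
    ?_, fun n k x rc rs => ?_, fun n k x rc rs => ?_⟩
  · have h2 := PolyBdd.const (fun n : ℕ => n) 2
    exact (((((h2.mul F.u_poly.polyBdd).add (h2.mul P.clientCoins_poly.polyBdd)).add
      (h2.mul P.serverCoins_poly.polyBdd)).add (h2.mul (.self _))).add hmsgs).add (.const _ 6)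
  · have := size_list_le (length_transcript (P.clientMsg n x rc) (P.serverMsg n k rs)
      (P.rounds n)).2.le (hq n k x rc rs).2
    simp only [clientView, exec, list_cons, list_nil, size_cons, size_atom, size_bits, msgs]
    omega
  · have := size_list_le (length_transcript (P.clientMsg n x rc) (P.serverMsg n k rs)
      (P.rounds n)).1.le (hq n k x rc rs).1
    simp only [serverView, exec, list_cons, list_nil, size_cons, size_atom, size_bits, msgs]
    omega

end OPRFProtocol

/-! ## Blocks of coins -/

section Blocks

/-- The `L` bits from position `o` on (padded with zeros). -/
def block {N : ℕ} (L : ℕ) (r : Bits N) (o : ℕ) : Bits L := fun b =>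
  if h : o + b < N then r ⟨o + b, h⟩ else false

theorem toList_bits_drop_take {N L o : ℕ} (r : Bits N) (h : o + L ≤ N) :
    ((bits r).toList.drop o).take L = (bits (block L r o)).toList := by
  apply List.ext_getElem
  · simp; omega
  · intro i h1 h2
    have hi : o + i < N := by simp at h1; omega
    simp [toList_bits, block, hi]

theorem list_toList_bits {n : ℕ} (x : Bits n) : list (bits x).toList = bits x := by
  simp [bits]

/-- This closed form shows which coins reach the `k`-th element: those of the `k`-th block. -/
theorem blockMap_eq_mapIdx {α β γ : Type} (f : α → List β → γ) (B : ℕ) (l : List α) (r : List β) :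
    blockMap f B l r = l.mapIdx fun k e => f e ((r.drop (k * B)).take B) := by
  induction l generalizing r with
  | nil => rfl
  | cons e l ih =>
    rw [blockMap, ih, List.mapIdx_cons]
    congr 1
    · simp
    · congr 1
      ext k e
      rw [List.drop_drop, Nat.succ_mul, Nat.add_comm]

/-- Elements thus become labels of coin blocks, even when the simulator knows only how many elements
there are. -/
theorem mapIdx_eq_map_idxOf {α β : Type} [DecidableEq α] {s : List α} (hs : s.Nodup)
    (f : ℕ → α → β) : s.mapIdx f = s.map fun x => f (s.idxOf x) x := by
  apply List.ext_getElem
  · simp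
  · intro i h1 h2
    have : i < s.length := by simpa using h1
    simp [hs.idxOf_getElem i this]

theorem mapIdx_eq_of_length_eq {α α' β : Type} (f : ℕ → β) {l : List α} {l' : List α'}
    (h : l.length = l'.length) : l.mapIdx (fun k _ => f k) = l'.mapIdx fun k _ => f k := by
  apply List.ext_getElem
  · simpa using h
  · intro i h1 h2
    simp

theorem mapIdx_ofFn {α β : Type} {n : ℕ} (g : Fin n → α) (f : ℕ → α → β) :
    (List.ofFn g).mapIdx f = List.ofFn fun i : Fin n => f i (g i) := by
  apply List.ext_getElem
  · simp
  · intro i h1 h2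
    simp

/-- Disjoint blocks of uniformly random bits are independent uniformly random strings. -/
theorem expect_block {A : Type} [Fintype A] [DecidableEq A] (L N : ℕ) (s : Finset A)
    (idx : A → ℕ) (hinj : ∀ a ∈ s, ∀ b ∈ s, idx a = idx b → a = b)
    (hN : ∀ a ∈ s, idx a * L + L ≤ N) (H : (A → Bits L) → ℝ)
    (hH : ∀ ρ ρ' : A → Bits L, (∀ a ∈ s, ρ a = ρ' a) → H ρ = H ρ') :
    𝔼 r : Bits N, H (fun a => block L r (idx a * L)) = 𝔼 ρ : A → Bits L, H ρ := by
  -- Both sides are compared with the average over the bits in `s × Fin L`, which embed into the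
  -- positions of `r` by `φ` and into the coordinates of `ρ` by `ψ`. The padding outside `s` is
  -- invisible to `H`.
  let ext (w : s × Fin L → Bool) : A → Bits L := fun a b => if h : a ∈ s then w (⟨a, h⟩, b) else false
  have hlt (p : s × Fin L) : idx p.1 * L + p.2 < N := by
    have h1 := hN p.1 p.1.2
    have h2 := p.2.2
    omega
  let φ : s × Fin L → Fin N := fun p => ⟨idx p.1 * L + p.2, hlt p⟩
  have hφ : φ.Injective := by
    rintro ⟨a, b⟩ ⟨a', b'⟩ h
    have h : idx a * L + b = idx a' * L + b' := by simpa [φ] using h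
    have hL : 0 < L := b.pos
    have h1 : idx a = idx a' := by
      have := congrArg (· / L) h
      simpa [Nat.mul_comm _ L, Nat.mul_add_div hL, Nat.div_eq_of_lt b.2, Nat.div_eq_of_lt b'.2]
        using this
    have h2 : a = a' := Subtype.ext (hinj a a.2 a' a'.2 h1)
    subst h2
    simp only [Nat.add_left_cancel_iff] at h
    simp [Fin.ext h]
  let ψ : s × Fin L → A × Fin L := fun p => (p.1, p.2)
  have hψ : ψ.Injective := by
    rintro ⟨a, b⟩ ⟨a', b'⟩ h
    simp only [ψ, Prod.mk.injEq] at h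
    exact Prod.ext (Subtype.ext h.1) h.2
  calc 𝔼 r : Bits N, H (fun a => block L r (idx a * L))
      = 𝔼 r : Bits N, H (ext (r ∘ φ)) := by
        refine Finset.expect_congr rfl fun r _ => hH _ _ fun a ha => ?_
        ext b
        simp only [ext, ha, dif_pos, Function.comp, φ, block, hlt (⟨a, ha⟩, b)]
    _ = 𝔼 w, H (ext w) := expect_comp_injective hφ fun w => H (ext w)
    _ = 𝔼 ρ : A × Fin L → Bool, H (ext (ρ ∘ ψ)) :=
        (expect_comp_injective hψ fun w => H (ext w)).symm
    _ = 𝔼 ρ : A → Bits L, H ρ := by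
        refine Fintype.expect_equiv (Equiv.curry A (Fin L) Bool) _ _ fun ρ => hH _ _ fun a ha => ?_
        ext b
        simp [ext, ha, ψ]

end Blocks

end EGPSI

/-! ### Lengths, sub-blocks and splitting of coins -/

namespace EGPSI
open Data

/-- The total length of a list of lists. -/
def sumLength (l : List Data) : ℕ := (l.map fun e => e.toList.length).sum

theorem sumLength_lt_size (l : List Data) : sumLength l < (list l).size := by
  rw [size_list, sumLength, Nat.lt_succ_iff]
  exact List.sum_le_sum fun e _ => (length_toList_le e).trans (Nat.le_succ _)

theorem length_le_sumLength {e : Data} {l : List Data} (h : e ∈ l) :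
    e.toList.length ≤ sumLength l :=
  List.single_le_sum (by simp) _ (List.mem_map_of_mem h)

theorem FP.unary_sumLength {l : Data → Data} (hl : FP l) :
    FP fun x => unary (sumLength (l x).toList) := by
  have key (l : List Data) (k : ℕ) : l.foldl (fun a e => unary (e.toList.length + a.toList.length))
      (unary k) = unary (sumLength l + k) := by
    induction l generalizing k with
    | nil => simp [sumLength]
    | cons e l ih =>
      rw [List.foldl_cons, length_toList_unary, ih]
      simp only [sumLength, List.map_cons, List.sum_cons]
      congr 1
      ring
  refine (foldl (g := fun _ e a => unary (e.toList.length + a.toList.length))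
    (unary_add id.snd.fst.unary_length_toList id.snd.snd.unary_length_toList) id hl (unary_const 0)
    (((PolyBdd.const _ 2).mul hl.size_bdd).add (.const _ 1)) fun x l' hl' => ?_).congr
    fun x => (key _ 0).trans (by simp)
  rw [key, size_unary]
  have h1 := sumLength_lt_size l'
  have h2 := size_list_le_of_prefix hl'
  omega

theorem drop_take_drop_take {α : Type} (l : List α) {o o' B B' : ℕ} (h : o' + B' ≤ B) :
    ((((l.drop o).take B).drop o').take B') = (l.drop (o + o')).take B' := by
  rw [List.drop_take, List.drop_drop, List.take_take, min_eq_left (by omega)]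

theorem toList_bits_take {p q : ℕ} (x : Bits (p + q)) :
    (bits x).toList.take p = (bits fun i => x (Fin.castAdd q i)).toList := by
  apply List.ext_getElem
  · simp
  · intro i h1 h2
    simp [toList_bits, Fin.castAdd, Fin.castLE]

theorem toList_bits_drop {p q : ℕ} (x : Bits (p + q)) :
    (bits x).toList.drop p = (bits fun i => x (Fin.natAdd p i)).toList := by
  apply List.ext_getElem
  · simp
  · intro i h1 h2
    simp [toList_bits, Fin.natAdd]

/-- One block of `p + q` bits supplies two independent uniform strings, such as a random value and
the coins of a simulated run. -/
theorem expect_split {A : Type} [Fintype A] [DecidableEq A] {p q : ℕ}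
    (H : (A → Bits p) → (A → Bits q) → ℝ) :
    𝔼 ρ : A → Bits (p + q), H (fun a i => ρ a (Fin.castAdd q i)) (fun a i => ρ a (Fin.natAdd p i)) =
      𝔼 g, 𝔼 w, H g w := by
  let e : (A → Bits (p + q)) ≃ (A → Bits p) × (A → Bits q) :=
    { toFun := fun ρ => (fun a i => ρ a (Fin.castAdd q i), fun a i => ρ a (Fin.natAdd p i))
      invFun := fun x a => Fin.append (x.1 a) (x.2 a)
      left_inv := fun ρ => by
        ext a i
        refine Fin.addCases (fun i => ?_) (fun i => ?_) i <;> simp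
      right_inv := fun x => by simp }
  rw [← expect_prod fun x : (A → Bits p) × (A → Bits q) => H x.1 x.2]
  exact Fintype.expect_equiv e _ _ fun _ => rfl

/-! ## The view of the TEE -/

/-- The view of the TEE with key `k` in which the views in the OPRF runs are given by `v`. -/
noncomputable def teeContext {u n : ℕ} (I : Inputs u) (k : Bits n) (v : Fin 2 × Fin I.m × Bits u → Data) : Data :=
  list [bits k, list (List.ofFn fun j : Fin 2 => list (List.ofFn fun i : Fin I.m =>
    list ((sorted (I.S j i)).map fun x => v (j, i, x))))]

/-- The elements of all the clients. -/
noncomputable def elements {u : ℕ} (I : Inputs u) : Finset (Fin 2 × Fin I.m × Bits u) :=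
  Finset.univ.biUnion fun p : Fin 2 × Fin I.m => (I.S p.1 p.2).image fun x => (p.1, p.2, x)

section

variable {u n : ℕ} {I : Inputs u}

@[simp] theorem mem_elements {a : Fin 2 × Fin I.m × Bits u} :
    a ∈ elements I ↔ a.2.2 ∈ I.S a.1 a.2.1 := by
  obtain ⟨j, i, x⟩ := a
  simp only [elements, Finset.mem_biUnion, Finset.mem_univ, true_and, Finset.mem_image,
    Prod.mk.injEq, Prod.exists]
  constructor
  · rintro ⟨j, i, x, hx, rfl, rfl, rfl⟩
    exact hx
  · exact fun h => ⟨j, i, x, h, rfl, rfl, rfl⟩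

theorem card_elements_le {b : ℕ} (h : I.Bounded b) : (elements I).card ≤ 2 * b * b := by
  refine (Finset.card_biUnion_le_card_mul _ _ b fun p _ =>
    Finset.card_image_le.trans (h.2 _ _)).trans ?_
  have := h.1
  simp only [Finset.card_univ, Fintype.card_prod, Fintype.card_fin]
  gcongr

theorem teeContext_congr (k : Bits n) {v v' : Fin 2 × Fin I.m × Bits u → Data}
    (h : ∀ a ∈ elements I, v a = v' a) : teeContext I k v = teeContext I k v' := by
  have h' (j : Fin 2) (i : Fin I.m) : ((sorted (I.S j i)).map fun x => v (j, i, x)) =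
      (sorted (I.S j i)).map fun x => v' (j, i, x) :=
    List.map_congr_left fun x hx => h _ (mem_elements.2 (mem_sorted.1 hx))
  simp only [teeContext, h']

theorem isContext_teeContext (k : Bits n) (v : Fin 2 × Fin I.m × Bits u → Data)
    {a : Fin 2 × Fin I.m × Bits u} (ha : a ∈ elements I) :
    IsContext fun z => teeContext I k (Function.update v a z) := by
  obtain ⟨j, i, x⟩ := a
  refine ((?_ : IsContext fun z => list (List.ofFn fun j' : Fin 2 => list (List.ofFn
    fun i' : Fin I.m => list ((sorted (I.S j' i')).map fun x' =>
      Function.update v (j, i, x) z (j', i', x'))))).cons_right _).cons_left _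
  refine IsContext.list_ofFn j (fun z z' j' hj => ?_) (IsContext.list_ofFn i (fun z z' i' hi => ?_)
    (IsContext.list_map (nodup_sorted _) (mem_sorted.2 (mem_elements.1 ha))
      (fun z z' x' _ hx => ?_) ?_))
  · simp [hj]
  · simp [hi]
  · simp [hx]
  · simpa using IsContext.id

theorem size_teeContext_le (k : Bits n) (v : Fin 2 × Fin I.m × Bits u → Data) {b q : ℕ}
    (h : I.Bounded b) (hv : ∀ a, (v a).size ≤ q) :
    (teeContext I k v).size ≤ 2 * n + 2 * (b * (b * (q + 1) + 1 + 1) + 1 + 1) + 5 := by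
  have h2 (j : Fin 2) : (list (List.ofFn fun i : Fin I.m =>
      list ((sorted (I.S j i)).map fun x => v (j, i, x)))).size ≤ b * (b * (q + 1) + 1 + 1) + 1 := by
    refine size_list_le (by simpa using h.1) fun y hy => ?_
    obtain ⟨i, rfl⟩ := List.mem_ofFn.1 hy
    refine size_list_le (by simpa using h.2 j i) fun y hy => ?_
    obtain ⟨x, _, rfl⟩ := List.mem_map.1 hy
    exact hv _
  have h3 : (list (List.ofFn fun j : Fin 2 => list (List.ofFn fun i : Fin I.m =>
      list ((sorted (I.S j i)).map fun x => v (j, i, x))))).size ≤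
      2 * (b * (b * (q + 1) + 1 + 1) + 1 + 1) + 1 := by
    refine size_list_le (by simp) fun y hy => ?_
    obtain ⟨j, rfl⟩ := List.mem_ofFn.1 hy
    exact h2 j
  rw [teeContext, list_cons, list_cons, list_nil, size_cons, size_cons, size_atom, size_bits]
  omega

end

/-! ## The simulator for the TEE -/

namespace TeeSim

variable (Sim : PPT)

/-- Number of coins of a run of the OPRF simulator, for keys of length `n`. -/
noncomputable def coinLength (n : ℕ) : ℕ := Sim.coins.eval (4 * n + 5)

/-- Simulation of one run of the OPRF. The context `c` consists of the input of the OPRF simulator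
and of the lengths of a key, of a block of coins for one element, and for one client. -/
noncomputable def runElem (c _e b : Data) : Data :=
  Sim.run (.cons c.fst (list (b.toList.drop c.snd.fst.toList.length)))

/-- Simulation of the runs with one client. -/
noncomputable def runClient (c e b : Data) : Data :=
  list (blockMap (fun e b => runElem Sim c e (list b)) c.snd.snd.fst.toList.length e.toList b.toList)

/-- Simulation of the runs with the clients of one group. -/
noncomputable def runGroup (c e b : Data) : Data :=
  list (blockMap (fun e b => runClient Sim c e (list b)) c.snd.snd.snd.toList.length
    e.toList b.toList)

/-- The simulation of the view of the TEE from `1ⁿ`, the lists of cardinalities `g₀` and `g₁`, and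
coins `r`. -/
noncomputable def simulate (N g₀ g₁ r : Data) : Data :=
  let n := N.toList.length
  -- All blocks have the same length. Block zero supplies the key by its first `n` bits, the others
  -- supply coins by their remaining bits; the rest is wasted, in exchange for a uniform layout.
  let L := n + coinLength Sim n
  -- Each client is allotted as many blocks as there are elements overall, so that its offset does
  -- not depend on the cardinalities of its predecessors.
  let B := (sumLength g₀.toList + sumLength g₁.toList) * L
  let k := list (r.toList.take n)
  list [k, list (blockMap (fun e b => runGroup Sim
      (.cons (list [unary n, k]) (.cons (unary n) (.cons (unary L) (unary B)))) e (list b))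
    (g₀.toList.length * B) [g₀, g₁] (r.toList.drop L))]

theorem fp_runElem : FP fun p => runElem Sim p.fst p.snd.fst p.snd.snd :=
  FP.comp Sim.polyTime (FP.id.fst.fst.cons (FP.id.fst.snd.fst.unary_length_toList.drop FP.id.snd.snd))

theorem fp_runClient : FP fun p => runClient Sim p.fst p.snd.fst p.snd.snd :=
  (fp_runElem Sim).blockMap FP.id.fst FP.id.fst.snd.snd.fst.unary_length_toList FP.id.snd.fst
    FP.id.snd.snd

theorem fp_runGroup : FP fun p => runGroup Sim p.fst p.snd.fst p.snd.snd :=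
  (fp_runClient Sim).blockMap FP.id.fst FP.id.fst.snd.snd.snd.unary_length_toList FP.id.snd.fst
    FP.id.snd.snd

theorem fp_simulate {N g₀ g₁ r : Data → Data} (hN : FP N) (h₀ : FP g₀) (h₁ : FP g₁) (hr : FP r) :
    FP fun x => simulate Sim (N x) (g₀ x) (g₁ x) (r x) := by
  have hn := hN.unary_length_toList
  have hL : FP fun x => unary ((N x).toList.length + coinLength Sim (N x).toList.length) :=
    hn.unary_add (FP.unary_eval Sim.coins (((FP.unary_const 4).unary_mul hn).unary_add
      (FP.unary_const 5)))
  have hB := (h₀.unary_sumLength.unary_add h₁.unary_sumLength).unary_mul hL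
  have hk := hn.take hr
  have hc := (hn.cons (hk.cons (FP.const (.atom false)))).cons (hn.cons (hL.cons hB))
  have := hk.cons (((fp_runGroup Sim).blockMap hc (h₀.unary_length_toList.unary_mul hB)
    (h₀.cons (h₁.cons (FP.const (.atom false)))) (hL.drop hr)).cons (FP.const (.atom false)))
  exact this.congr fun x => by simp only [simulate, list_cons, list_nil, toList_cons, toList_atom,
    toList_list]

/-- The simulator for the TEE. -/
noncomputable def sim : PPT where
  -- This covers `1 + 2 * m * total` blocks, since `m`, `total` and `n` are all at most the length
  -- of the input; `4 * n + 5` is the length of the OPRF simulator's input.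
  coins := (1 + 2 * .X * .X) * (.X + Sim.coins.comp (4 * .X + 5))
  run z := simulate Sim z.fst.fst.fst z.fst.fst.snd.fst z.fst.fst.snd.snd.fst z.snd
  polyTime := fp_simulate Sim FP.id.fst.fst.fst FP.id.fst.fst.snd.fst FP.id.fst.fst.snd.snd.fst
    FP.id.snd

variable {u : ℕ} (I : Inputs u) (n : ℕ)

/-- The number of elements of all clients. -/
noncomputable def total {u : ℕ} (I : Inputs u) : ℕ :=
  sumLength (List.ofFn fun i => unary (I.S 0 i).card) +
    sumLength (List.ofFn fun i => unary (I.S 1 i).card)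

theorem card_le_total {u : ℕ} (I : Inputs u) (j : Fin 2) (i : Fin I.m) :
    (I.S j i).card ≤ total I := by
  have h (j : Fin 2) : (I.S j i).card ≤ sumLength (List.ofFn fun i => unary (I.S j i).card) := by
    have := length_le_sumLength (l := List.ofFn fun i => unary (I.S j i).card)
      (List.mem_ofFn.2 ⟨i, rfl⟩)
    simpa using this
  have h0 := h 0
  have h1 := h 1
  unfold total
  match j with
  | 0 => omega
  | 1 => omega

/-- The position of the block of coins for the key (`none`) and for the elements of the clients. -/
noncomputable def index {u : ℕ} (I : Inputs u) : Option (Fin 2 × Fin I.m × Bits u) → ℕ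
  | none => 0
  | some a => 1 + ((a.1 * I.m + a.2.1) * total I + (sorted (I.S a.1 a.2.1)).idxOf a.2.2)

variable {n}

/-- The program uses only the cardinality of `S`. The elements enter the right-hand side merely as
names for the positions in its sorted listing. -/
theorem runClient_eq {N L B o : ℕ} (r : Bits N) (k : Data) (S : Finset (Bits u)) (c : ℕ)
    (hL : L = n + c) (hB : S.card * L ≤ B) (ho : o + B ≤ N) :
    runClient Sim (.cons k (.cons (unary n) (.cons (unary L) (unary B)))) (unary S.card)
      (list (((bits r).toList.drop o).take B)) =
    list ((sorted S).map fun x => Sim.run (.cons k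
      (list ((bits (block L r (o + (sorted S).idxOf x * L))).toList.drop n)))) := by
  simp only [runClient, snd_cons, fst_cons, length_toList_unary, toList_list, runElem,
    blockMap_eq_mapIdx]
  congr 1
  rw [mapIdx_eq_of_length_eq (l' := sorted S) (fun j => Sim.run (.cons k
    (list ((((((bits r).toList.drop o).take B).drop (j * L)).take L).drop n)))) (by simp),
    mapIdx_eq_map_idxOf (nodup_sorted S)]
  refine List.map_congr_left fun x hx => ?_
  have h1 := List.idxOf_lt_length_of_mem hx
  rw [length_sorted] at h1
  have h2 : (sorted S).idxOf x * L + L ≤ S.card * L := by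
    rw [← Nat.succ_mul]
    exact Nat.mul_le_mul_right _ h1
  rw [drop_take_drop_take _ (by omega), toList_bits_drop_take _ (by omega)]

theorem runGroup_eq {N L B o : ℕ} (r : Bits N) (k : Data) (j : Fin 2) (c : ℕ)
    (hL : L = n + c) (hB : ∀ i, (I.S j i).card * L ≤ B) (ho : o + I.m * B ≤ N) :
    runGroup Sim (.cons k (.cons (unary n) (.cons (unary L) (unary B))))
      (list (List.ofFn fun i => unary (I.S j i).card))
      (list (((bits r).toList.drop o).take (I.m * B))) =
    list (List.ofFn fun i => list ((sorted (I.S j i)).map fun x => Sim.run (.cons k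
      (list ((bits (block L r (o + i * B + (sorted (I.S j i)).idxOf x * L))).toList.drop n))))) := by
  simp only [runGroup, snd_cons, toList_list, length_toList_unary, blockMap_eq_mapIdx,
    mapIdx_ofFn]
  congr 2
  ext i
  have h : i * B + B ≤ I.m * B := by
    rw [← Nat.succ_mul]
    exact Nat.mul_le_mul_right _ i.2
  rw [drop_take_drop_take _ h, runClient_eq Sim r k _ c hL (hB i) (by omega)]

/-- In this form the output is a function of coin blocks indexed by the key and the elements, as
`expect_block` requires. -/
theorem simulate_eq {N : ℕ} (r : Bits N) {L : ℕ} (hL : L = n + coinLength Sim n)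
    (hN : (1 + 2 * I.m * total I) * L ≤ N) :
    simulate Sim (unary n) (list (List.ofFn fun i => unary (I.S 0 i).card))
      (list (List.ofFn fun i => unary (I.S 1 i).card)) (bits r) =
    list [list ((bits (block L r 0)).toList.take n), list (List.ofFn fun j : Fin 2 =>
      list (List.ofFn fun i => list ((sorted (I.S j i)).map fun x => Sim.run (.cons
        (list [unary n, list ((bits (block L r 0)).toList.take n)])
        (list ((bits (block L r (index I (some (j, i, x)) * L))).toList.drop n))))))] := by
  have hm : (1 + 2 * I.m * total I) * L = L + 2 * (I.m * (total I * L)) := by ring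
  have hk : list ((bits (block L r 0)).toList.take n) = list ((bits r).toList.take n) := by
    rw [← toList_bits_drop_take r (by omega), List.drop_zero, List.take_take, min_eq_left (by omega)]
  have hB (j : Fin 2) (i : Fin I.m) : (I.S j i).card * L ≤ total I * L :=
    Nat.mul_le_mul_right _ (card_le_total I j i)
  have ht : sumLength (List.ofFn fun i => unary (I.S 0 i).card) +
    sumLength (List.ofFn fun i => unary (I.S 1 i).card) = total I := rfl
  simp only [simulate, length_toList_unary, toList_list, List.length_ofFn, ← hL, ht, hk]
  congr 2
  congr 1
  congr 1
  simp only [blockMap_eq_mapIdx, List.mapIdx_cons, List.mapIdx_nil, List.ofFn_succ, List.ofFn_zero,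
    List.drop_drop]
  rw [runGroup_eq Sim I r _ 0 _ hL (hB 0) (by omega),
    runGroup_eq Sim I r _ 1 _ hL (hB 1) (by omega)]
  have he (j i a : ℕ) : (1 + ((j * I.m + i) * total I + a)) * L =
      L + j * (I.m * (total I * L)) + i * (total I * L) + a * L := by ring
  simp only [index, he, Fin.val_zero, Fin.val_one, Fin.succ_zero_eq_one, Nat.zero_add]

end TeeSim

end EGPSI

/-! ### Distribution of the TEE simulator's output -/

namespace EGPSI
open Data

namespace TeeSim

variable (Sim : PPT) {u : ℕ} (I : Inputs u) (n : ℕ)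

/-- The input of the simulator for the TEE. -/
noncomputable def input : Data :=
  list [I.pub n, bitsSet (∅ : Finset (Bits u)), bitsSet (∅ : Finset (Bits u)), list []]

theorem coins_sufficient : (1 + 2 * I.m * total I) * (n + coinLength Sim n) ≤
    (sim Sim).coins.eval (input I n).size := by
  have hS (j : Fin 2) := sumLength_lt_size (List.ofFn fun i => unary (I.S j i).card)
  have hm := length_lt_size_list (List.ofFn fun i => unary (I.S 0 i).card)
  have h0 := hS 0
  have h1 := hS 1
  have hs : (list (List.ofFn fun i => unary (I.S 0 i).card)).size +
      (list (List.ofFn fun i => unary (I.S 1 i).card)).size + (2 * n + 1) ≤ (input I n).size := by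
    simp only [input, Inputs.pub, list_cons, list_nil, size_cons, size_atom, size_unary]
    omega
  rw [List.length_ofFn] at hm
  have hc : coinLength Sim n ≤ Sim.coins.eval (4 * (input I n).size + 5) :=
    polynomial_eval_mono _ (by omega)
  have ht : total I ≤ (input I n).size := by unfold total; omega
  simp only [sim, Polynomial.eval_mul, Polynomial.eval_add, Polynomial.eval_one, Polynomial.eval_X,
    Polynomial.eval_comp, Polynomial.eval_ofNat]
  gcongr <;> omega

/-- The index is a mixed-radix number with digits group, client, and position in the sorted set,
shifted by one to leave block zero to the key. Division by `total I` and then by `I.m` recovers the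
digits. -/
theorem index_injOn : ∀ a ∈ (elements I).insertNone, ∀ b ∈ (elements I).insertNone,
    index I a = index I b → a = b := by
  have hlt (j : Fin 2) (i : Fin I.m) (x : Bits u) (h : x ∈ I.S j i) :
      (sorted (I.S j i)).idxOf x < total I := by
    have := List.idxOf_lt_length_of_mem (mem_sorted.2 h)
    rw [length_sorted] at this
    exact this.trans_le (card_le_total I j i)
  rintro (_ | ⟨j, i, x⟩) ha (_ | ⟨j', i', x'⟩) hb h
  · rfl
  · simp only [index] at h
    omega
  · simp only [index] at h
    omega
  · simp only [Finset.some_mem_insertNone, mem_elements] at ha hb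
    simp only [index, Nat.add_left_cancel_iff] at h
    have h1 := hlt j i x ha
    have h2 := hlt j' i' x' hb
    have hK : 0 < total I := by omega
    have hq := congrArg (· / total I) h
    simp only [Nat.mul_comm _ (total I), Nat.mul_add_div hK, Nat.div_eq_of_lt h1,
      Nat.div_eq_of_lt h2, Nat.add_zero] at hq
    have hq2 := congrArg (· / I.m) hq
    simp only [Nat.mul_comm _ I.m, Nat.mul_add_div i.pos, Nat.div_eq_of_lt i.2,
      Nat.div_eq_of_lt i'.2, Nat.add_zero] at hq2
    obtain rfl : j = j' := Fin.ext hq2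
    obtain rfl : i = i' := Fin.ext (by omega)
    obtain rfl : x = x' := (List.idxOf_inj (mem_sorted.2 ha)).1 (by omega)
    rfl

theorem index_mul_add_le (L : ℕ) : ∀ a ∈ (elements I).insertNone,
    index I a * L + L ≤ (1 + 2 * I.m * total I) * L := by
  intro a ha
  rw [← Nat.succ_mul]
  refine Nat.mul_le_mul_right L ?_
  rcases a with _ | ⟨j, i, x⟩
  · simp [index]
  · simp only [Finset.some_mem_insertNone, mem_elements] at ha
    have h1 := List.idxOf_lt_length_of_mem (mem_sorted.2 ha)
    rw [length_sorted] at h1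
    have h2 := card_le_total I j i
    have h3 : (j : ℕ) * I.m + i + 1 ≤ 2 * I.m := by
      have := Nat.mul_le_mul_right I.m (Nat.le_of_lt_succ j.2)
      have := i.2
      omega
    have h4 := Nat.mul_le_mul_right (total I) h3
    simp only [index]
    rw [Nat.add_mul, Nat.one_mul] at h4
    omega

/-- The output of the simulator: the OPRF simulator is run independently for all elements under one
uniform key. -/
theorem accept_sim (D : Distinguisher) : D.accept n ((sim Sim).dist (input I n)) =
    𝔼 k : Bits n, 𝔼 ρ : Fin 2 × Fin I.m × Bits u → Bits (coinLength Sim n),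
      D.val n (teeContext I k fun a => Sim.run (.cons (list [unary n, bits k]) (bits (ρ a)))) := by
  let A := Fin 2 × Fin I.m × Bits u
  let c := coinLength Sim n
  let H : (Option A → Bits n) → (Option A → Bits c) → ℝ := fun g w =>
    D.val n (teeContext I (g none) fun a =>
      Sim.run (.cons (list [unary n, bits (g none)]) (bits (w (some a)))))
  -- Of the block for `none` only the first half matters, of the blocks for elements only the second
  -- half.
  let H' : (Option A → Bits (n + c)) → ℝ := fun ρ =>
    H (fun a i => ρ a (Fin.castAdd c i)) (fun a i => ρ a (Fin.natAdd n i))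
  have hrun (r : Bits ((sim Sim).coins.eval (input I n).size)) :
      D.val n ((sim Sim).run (.cons (input I n) (bits r))) =
        H' fun a => block (n + c) r (index I a * (n + c)) := by
    have := simulate_eq Sim I r rfl (coins_sufficient Sim I n)
    simp only [toList_bits_take, toList_bits_drop, list_toList_bits] at this
    refine congrArg _ (Eq.trans this ?_)
    simp only [teeContext, index, Nat.zero_mul]
    rfl
  rw [PPT.dist_eq _ rfl, D.accept_law]
  simp only [hrun]
  rw [expect_block (n + c) _ (elements I).insertNone (index I) (index_injOn I)
    (fun a ha => (index_mul_add_le I _ a ha).trans (coins_sufficient Sim I n)) H']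
  · refine (expect_split H).trans ?_
    rw [← expect_eval (A := Option A) (none : Option A) fun k : Bits n =>
      𝔼 ρ : A → Bits c,
        D.val n (teeContext I k fun a => Sim.run (.cons (list [unary n, bits k]) (bits (ρ a))))]
    refine Finset.expect_congr rfl fun g _ => ?_
    exact expect_comp_injective (R := Bits c) (Option.some_injective A) fun ρ =>
      D.val n (teeContext I (g none) fun a =>
        Sim.run (.cons (list [unary n, bits (g none)]) (bits (ρ a))))
  · intro ρ ρ' h
    have h0 := h none (by simp)
    simp only [H', H, h0]
    congr 1
    refine teeContext_congr _ fun a ha => ?_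
    rw [h (some a) (by simpa using ha)]

end TeeSim

/-! ### Security against the TEE -/

theorem size_run_bdd (A : PPT) {m c : ℕ → ℕ} (hm : PolyBdd (fun n => n) m)
    (hc : PolyBdd (fun n => n) c) : ∃ b : ℕ → ℕ, PolyBdd (fun n => n) b ∧
      ∀ n x (r : Bits (c n)), x.size ≤ m n → (A.run (.cons x (bits r))).size ≤ b n := by
  obtain ⟨q, hq⟩ := A.polyTime.polyBdd
  refine ⟨fun n => q.eval (m n + (2 * c n + 1) + 1),
    (((hm.add (((PolyBdd.const _ 2).mul hc).add (.const _ 1))).add (.const _ 1)).eval q),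
    fun n x r hx => (hq _).trans (polynomial_eval_mono q ?_)⟩
  dsimp only
  rw [size_cons, size_bits]
  omega

/-- For each fixed key the OPRF runs are independent and the hybrid bound applies. As it is uniform
in the key, it survives averaging. -/
theorem tee_compIndist {F : FunFamily} {P : OPRFProtocol F} {Sim : PPT}
    (h : CompIndist (I := fun n => Bits n × Bits (F.u n))
      (fun n i => Sim.dist (Data.list [.unary n, bits i.1]))
      (fun n i => law fun r : Bits (P.clientCoins n) × Bits (P.serverCoins n) =>
        P.serverView n i.1 i.2 r.1 r.2)) (B : Polynomial ℕ) :
    CompIndist (I := fun n => {I : Inputs (F.u n) // I.Bounded (B.eval n)})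
      (fun n I => (TeeSim.sim Sim).dist (TeeSim.input I.1 n))
      (fun n I => law fun ω => teeView2 P n I.1 ω) := by
  intro D
  obtain ⟨b₁, hb₁, -, hP⟩ := P.exists_view_bound
  have hB : PolyBdd (fun n : ℕ => n) fun n => B.eval n := ⟨B, fun _ => le_rfl⟩
  have hin : PolyBdd (fun n : ℕ => n) fun n => 4 * n + 5 :=
    ((PolyBdd.const _ 4).mul (.self _)).add (.const _ 5)
  have hcoin : PolyBdd (fun n : ℕ => n) (TeeSim.coinLength Sim) := hin.eval Sim.coins
  obtain ⟨b₂, hb₂, hS⟩ := size_run_bdd Sim hin hcoin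
  let q (n : ℕ) : ℕ := b₁ n + b₂ n + 1
  have hq : PolyBdd (fun n => n) q := (hb₁.add hb₂).add (.const _ 1)
  obtain ⟨ε, hε, hε0, hle⟩ := h.hybrid D
    (b := fun n => 2 * n + 2 * (B.eval n * (B.eval n * (q n + 1) + 1 + 1) + 1 + 1) + 5)
    ((((PolyBdd.const _ 2).mul (.self _)).add ((PolyBdd.const _ 2).mul (((hB.mul
      (((hB.mul (hq.add (.const _ 1))).add (.const _ 1)).add (.const _ 1))).add (.const _ 1)).add
      (.const _ 1)))).add (.const _ 5))
  refine ⟨fun n => (((2 * B * B).eval n : ℕ) : ℝ) * ε n, hε.polynomial_mul _, fun n ⟨I, hI⟩ => ?_⟩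
  let A := Fin 2 × Fin I.m × Bits (F.u n)
  let e : (Fin 2 → Fin I.m → Bits (F.u n) → Bits (P.clientCoins n) × Bits (P.serverCoins n)) ≃
      (A → Bits (P.clientCoins n) × Bits (P.serverCoins n)) :=
    { toFun := fun g p => g p.1 p.2.1 p.2.2
      invFun := fun g j i x => g (j, i, x)
      left_inv := fun _ => rfl
      right_inv := fun _ => rfl }
  have hreal : D.accept n (law fun ω => teeView2 P n I ω) = 𝔼 k : Bits n,
      𝔼 ω : A → Bits (P.clientCoins n) × Bits (P.serverCoins n),
        D.val n (teeContext I k fun a => P.serverView n k a.2.2 (ω a).1 (ω a).2) := by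
    rw [D.accept_law, expect_prod]
    exact Finset.expect_congr rfl fun k _ => Fintype.expect_equiv e _ _ fun _ => rfl
  rw [TeeSim.accept_sim, hreal, abs_sub_comm]
  refine abs_expect_sub_le fun k => ?_
  have hin_size : (list [unary n, bits k]).size = 4 * n + 5 := by
    simp only [list_cons, list_nil, size_cons, size_atom, size_unary, size_bits]
    omega
  have key := hle n (fun a : A => (k, a.2.2)) (fun a (r : Bits (P.clientCoins n) ×
      Bits (P.serverCoins n)) => P.serverView n k a.2.2 r.1 r.2)
    (fun a (r : Bits (TeeSim.coinLength Sim n)) => Sim.run (.cons (list [unary n, bits k]) (bits r)))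
    (teeContext I k) (elements I) (fun a => PPT.dist_eq _ (by rw [hin_size]; rfl)) (fun a => rfl)
    (fun v v' => teeContext_congr k) (fun a ha v => isContext_teeContext k v ha)
    (fun v hv => size_teeContext_le k v hI fun a => ?_)
  · refine key.trans (mul_le_mul_of_nonneg_right ?_ (hε0 n))
    have := card_elements_le hI
    simp only [Polynomial.eval_mul, Polynomial.eval_ofNat]
    exact_mod_cast this
  · have hqn : q n = b₁ n + b₂ n + 1 := rfl
    rcases hv a with ⟨r, hr⟩ | ⟨r, hr⟩ | hr
    · rw [hr]
      have := hP n k a.2.2 r.1 r.2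
      omega
    · rw [hr]
      have := hS n (list [unary n, bits k]) r hin_size.le
      omega
    · rw [hr, size_atom]
      omega

end EGPSI

namespace EGPSI
open Data

/-! ## Pseudorandomness for non-adaptive queries -/

/-- The number of answers received so far tells which entry of a fixed list to ask next. -/
theorem OracleAdversary.answers_eq {u v : ℕ → ℕ} (A : OracleAdversary u v) (n : ℕ)
    (qs : List (Bits (u n))) (hA : ∀ l : List (Bits (v n)), A.query n l = qs.getD l.length default)
    (g : Bits (u n) → Bits (v n)) (t : ℕ) (ht : t ≤ qs.length) :
    A.answers n g t = (qs.take t).map g := by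
  induction t with
  | zero => rfl
  | succ t ih =>
    have ht' : t < qs.length := ht
    rw [answers, ih ht'.le, hA, List.take_succ_eq_append_getElem ht', List.map_append]
    simp [ht', ht'.le]

/-- The adversary that makes the queries `qs n` and gives the answers to the distinguisher `D`,
after they have been processed together with an advice. -/
def prfAdversary {u v : ℕ → ℕ} (D : Distinguisher) {T : Data → Data → Data}
    (hT : FP fun p => T p.fst p.snd) (hu : PolyBdd (fun n => n) u) (qs : ∀ n, List (Bits (u n)))
    (hqs : PolyBdd (fun n => n) fun n => (qs n).length) (w : ℕ → Data)
    (hw : PolyBdd (fun n => n) fun n => (w n).size) : OracleAdversary u v where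
  advice n := .cons (D.advice n) (.cons (w n)
    (.cons (bits (default : Bits (u n))) (list ((qs n).map bits))))
  advice_bound := by
    have h2 := PolyBdd.const (fun n : ℕ => n) 2
    have h1 := PolyBdd.const (fun n : ℕ => n) 1
    refine ((PolyBdd.add D.advice_bound (hw.add (((h2.mul hu).add h1).add
      ((hqs.mul (((h2.mul hu).add h1).add h1)).add h1)))).add (.const _ 3)).mono fun n => ?_
    have : (list ((qs n).map bits)).size ≤ (qs n).length * (2 * u n + 1 + 1) + 1 :=
      size_list_le (by simp) (by simp [size_bits])
    simp only [size_cons, size_bits]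
    omega
  queries n := (qs n).length
  queries_bound := hqs
  query n l := (qs n).getD l.length default
  query_polyTime := by
    have h : FP fun x => if (list (x.fst.snd.snd.snd.toList.drop x.snd.toList.length)).isCons.truth
        = true then (list (x.fst.snd.snd.snd.toList.drop x.snd.toList.length)).fst
        else x.fst.snd.snd.fst :=
      FP.ite (FP.id.snd.unary_length_toList.drop FP.id.fst.snd.snd.snd).isCons
        (FP.id.snd.unary_length_toList.drop FP.id.fst.snd.snd.snd).fst FP.id.fst.snd.snd.fst
    have := h.reindex fun a : Σ n, List (Bits (v n)) => .cons (.cons (D.advice a.1) (.cons (w a.1)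
      (.cons (bits (default : Bits (u a.1))) (list ((qs a.1).map bits)))))
      (Data.list (a.2.map bits))
    convert this using 2 with a
    obtain ⟨n, l⟩ := a
    simp only [fst_cons, snd_cons, toList_list, List.length_map, ← List.map_drop, truth_isCons]
    cases hl : (qs n).drop l.length with
    | nil =>
      have := List.drop_eq_nil_iff.1 hl
      simp [this]
    | cons x l' =>
      have hlt : l.length < (qs n).length := by
        by_contra hge
        rw [List.drop_eq_nil_of_le (by omega)] at hl
        simp at hl
      rw [List.drop_eq_getElem_cons hlt] at hl
      simp only [List.cons.injEq] at hl
      simp [hlt, hl.1]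
  guess n l := D.test n (T (w n) (list (l.map bits)))
  guess_polyTime := by
    have h : FP fun x => .cons x.fst.fst (T x.fst.snd.fst x.snd) :=
      FP.id.fst.fst.cons (hT.app2 FP.id.fst.snd.fst FP.id.snd)
    exact PolyTime.comp (h.reindex fun a : Σ n, List (Bits (v n)) => .cons (.cons (D.advice a.1)
      (.cons (w a.1) (.cons (bits (default : Bits (u a.1))) (list ((qs a.1).map bits)))))
      (Data.list (a.2.map bits)))
      (D.polyTime.reindex fun a : Σ n, List (Bits (v n)) => (a.1, T (w a.1) (list (a.2.map bits))))

/-- The values of a pseudorandom function at polynomially many points are indistinguishable from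
those of a random function, in polynomially long contexts. -/
theorem FunFamily.IsPRF.exists_bound {F : FunFamily} (hF : F.IsPRF) (D : Distinguisher)
    {T : Data → Data → Data} (hT : FP fun p => T p.fst p.snd) {b : ℕ → ℕ}
    (hb : PolyBdd (fun n => n) b) :
    ∃ ε, Negligible ε ∧ (∀ n, 0 ≤ ε n) ∧ ∀ n (qs : List (Bits (F.u n))) (w : Data),
      qs.length ≤ b n → w.size ≤ b n →
      |𝔼 k : Bits n, D.val n (T w (list (qs.map fun x => bits (F.eval n k x)))) -
        𝔼 g : Bits (F.u n) → Bits (F.v n), D.val n (T w (list (qs.map fun x => bits (g x))))|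
        ≤ ε n := by
  let ι (n : ℕ) : Type := {p : List (Bits (F.u n)) × Data // p.1.length ≤ b n ∧ p.2.size ≤ b n}
  let adv (n : ℕ) (t : ι n) : ℝ :=
    |𝔼 k : Bits n, D.val n (T t.1.2 (list (t.1.1.map fun x => bits (F.eval n k x)))) -
        𝔼 g : Bits (F.u n) → Bits (F.v n), D.val n (T t.1.2 (list (t.1.1.map fun x => bits (g x))))|
  -- The selected query list and context are hard-wired into the adversary. Its advantage then
  -- equals `adv` exactly, so its PRF advantage itself serves as the bound.
  have hsel (τ : ∀ n, Option (ι n)) : ∃ ε, Negligible ε ∧ ∀ n t, τ n = some t → adv n t ≤ ε n := by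
    let qs (n : ℕ) : List (Bits (F.u n)) := ((τ n).map fun t => t.1.1).getD []
    let w (n : ℕ) : Data := ((τ n).map fun t => t.1.2).getD (.atom false)
    have hqs : PolyBdd (fun n => n) fun n => (qs n).length := hb.mono fun n => by
      cases hn : τ n with
      | none => simp [qs, hn]
      | some t => simpa [qs, hn] using t.2.1
    have hw : PolyBdd (fun n => n) fun n => (w n).size := (hb.add (.const _ 1)).mono fun n => by
      cases hn : τ n with
      | none => simp [w, hn]
      | some t => simpa [w, hn] using t.2.2.trans (Nat.le_succ _)
    let A : OracleAdversary F.u F.v := prfAdversary D hT F.u_poly.polyBdd qs hqs w hw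
    refine ⟨_, hF A, fun n t hn => le_of_eq ?_⟩
    have hres (g : Bits (F.u n) → Bits (F.v n)) : (if A.result n g = true then (1 : ℝ) else 0) =
        D.val n (T t.1.2 (list (t.1.1.map fun x => bits (g x)))) := by
      have h1 := A.answers_eq n (qs n) (fun _ => rfl) g (qs n).length le_rfl
      have h2 : A.result n g = D.test n (T (w n) (list (((qs n).map g).map bits))) := by
        rw [OracleAdversary.result]
        change D.test n (T (w n) (list ((A.answers n g (qs n).length).map bits))) = _
        rw [h1, List.take_length]
      rw [h2]
      simp [Distinguisher.val, qs, w, hn, Function.comp_def]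
    simp only [prob_eq_expect, adv, ← hres]
    congr!
  obtain ⟨ε, hε, hε0, hle⟩ := exists_negligible_of_forall_selection adv (fun _ _ => abs_nonneg _)
    (fun n t => by
      have h (Ω : Type) [Fintype Ω] [Nonempty Ω] (X : Ω → Data) :
          0 ≤ 𝔼 ω, D.val n (X ω) ∧ 𝔼 ω, D.val n (X ω) ≤ 1 :=
        ⟨Finset.expect_nonneg fun _ _ => D.val_nonneg n _,
          Finset.expect_le Finset.univ_nonempty fun _ _ => D.val_le_one n _⟩
      have h1 := h (Bits n) fun k => T t.1.2 (list (t.1.1.map fun x => bits (F.eval n k x)))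
      have h2 := h (Bits (F.u n) → Bits (F.v n)) fun g => T t.1.2 (list (t.1.1.map fun x => bits (g x)))
      rw [abs_le]
      constructor <;> linarith) hsel
  exact ⟨ε, hε, hε0, fun n qs w h1 h2 => hle n ⟨(qs, w), h1, h2⟩⟩

/-! ## Tables of values -/

/-- In a table with entries `(x, (y, _))`, the values `y` for the elements `x` of the set `s`. -/
def lookup (table s : Data) : Data :=
  list ((table.toList.filter fun e =>
    s.toList.any fun x => lexEq e.fst.toList x.toList).map fun e => e.snd.fst)

theorem FP.lookup {t s : Data → Data} (ht : FP t) (hs : FP s) :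
    FP fun x => lookup (t x) (s x) := by
  have h1 : FP fun p => .atom (p.fst.toList.any fun x => EGPSI.lexEq p.snd.fst.toList x.toList) :=
    any (t := fun c x => EGPSI.lexEq c.toList x.toList) (id.fst.lexEq id.snd) id.snd.fst id.fst
  have := map (F := fun _ e => e.snd.fst) id.snd.snd.fst id
    (filter (t := fun s e => s.toList.any fun x => EGPSI.lexEq e.fst.toList x.toList) h1 hs ht)
  exact this.congr fun x => by rw [toList_list]; rfl

theorem lookup_eq {u v : ℕ} (l : List (Bits u)) (g : Bits u → Bits v) (d : Bits u → Data)
    (s : Finset (Bits u)) :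
    lookup (list (l.map fun x => .cons (bits x) (.cons (bits (g x)) (d x)))) (bitsSet s) =
      list ((l.filter fun x => x ∈ s).map fun x => bits (g x)) := by
  have h (x : Bits u) : (((sorted s).map bits).any fun y => lexEq (bits x).toList y.toList) =
      decide (x ∈ s) := by
    rw [Bool.eq_iff_iff, decide_eq_true_iff, List.any_eq_true]
    constructor
    · rintro ⟨y, hy, hxy⟩
      obtain ⟨z, hz, rfl⟩ := List.mem_map.1 hy
      rw [lexEq_bits] at hxy
      rw [hxy]
      exact mem_sorted.1 hz
    · exact fun hx => ⟨_, List.mem_map_of_mem (mem_sorted.2 hx), (lexEq_bits x x).2 rfl⟩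
  simp only [lookup, bitsSet, toList_list, List.filter_map, Function.comp_def, fst_cons, h,
    List.map_map, snd_cons]

end EGPSI

namespace EGPSI
open Data

/-! ## The view of a client -/

/-- The view of a client with the set `S` in which the views in the OPRF runs are given by `v` and
the encrypted sets received are the sets `E t`. -/
noncomputable def clientContext {u l m : ℕ} (S : Finset (Bits u)) (E : Fin m → Finset (Bits l))
    (v : Bits u → Data) : Data :=
  list [bitsSet S, list ((sorted S).map v), list (List.ofFn fun t => bitsSet (E t))]

/-- The view of a client in the ideal world in which the encryptions are the values of `g`: the OPRF
simulator is run on `x` and `g x` with coins `w x`. -/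
noncomputable def idealView (Sim : PPT) (n : ℕ) {u l m c : ℕ} (S : Finset (Bits u))
    (S' : Fin m → Finset (Bits u)) (g : Bits u → Bits l) (w : Bits u → Bits c) : Data :=
  clientContext S (fun t => (S' t).image g) fun x =>
    Sim.run (.cons (list [unary n, bits x, bits (g x)]) (bits (w x)))

section

variable {u l m : ℕ} (S : Finset (Bits u)) (E : Fin m → Finset (Bits l))

theorem clientContext_congr {v v' : Bits u → Data} (h : ∀ x ∈ S, v x = v' x) :
    clientContext S E v = clientContext S E v' := by
  rw [clientContext, clientContext, List.map_congr_left fun x hx => h x (mem_sorted.1 hx)]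

theorem isContext_clientContext (v : Bits u → Data) {x : Bits u} (hx : x ∈ S) :
    IsContext fun z => clientContext S E (Function.update v x z) := by
  refine ((IsContext.list_map (nodup_sorted _) (mem_sorted.2 hx)
      (fun z z' x' _ hx => ?_) ?_).cons_right _).cons_left _
  · simp [hx]
  · simpa using IsContext.id

theorem size_bitsSet_le {s : Finset (Bits u)} {b : ℕ} (h : s.card ≤ b) :
    (bitsSet s).size ≤ b * (2 * u + 2) + 1 :=
  size_list_le (by simpa using h) (by simp [size_bits])

theorem size_clientContext_le {b q : ℕ} (hm : m ≤ b) (hS : S.card ≤ b) (hE : ∀ t, (E t).card ≤ b)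
    {v : Bits u → Data} (hv : ∀ x, (v x).size ≤ q) :
    (clientContext S E v).size ≤
      b * (2 * u + 2) + b * (q + 1) + b * (b * (2 * l + 2) + 2) + 7 := by
  have h1 := size_bitsSet_le hS
  have h2 : (list ((sorted S).map v)).size ≤ b * (q + 1) + 1 :=
    size_list_le (by simpa using hS) (by simpa using fun x _ => hv x)
  have h3 : (list (List.ofFn fun t => bitsSet (E t))).size ≤ b * (b * (2 * l + 2) + 2) + 1 := by
    refine size_list_le (by simpa using hm) fun y hy => ?_
    obtain ⟨t, rfl⟩ := List.mem_ofFn.1 hy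
    exact size_bitsSet_le (hE t)
  simp only [clientContext, list_cons, list_nil, size_cons, size_atom]
  omega

end

/-! ### The ideal view from a table of values -/

/-- The ideal view of a client from the answers `a` to oracle queries and from
`w = (1ⁿ, (P, (q, T)))`, where `P` lists the client's elements with coins for the OPRF simulator, `q`
lists the queries, beginning with the client's elements, and `T` lists the sets of the other group. -/
def viewFromAnswers (Sim : PPT) (w a : Data) : Data :=
  let table := list (List.zipWith Data.cons w.snd.snd.fst.toList
    (list (a.toList.map fun y => .cons y (.atom false))).toList)
  list [list (w.snd.fst.toList.map fun p => p.fst),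
    -- The queries begin with the client's elements, so truncation pairs each of them with its own
    -- answer.
    list ((list (List.zipWith Data.cons w.snd.fst.toList a.toList)).toList.map fun p =>
      Sim.run (.cons (list [w.fst, p.fst.fst, p.snd]) p.fst.snd)),
    list (w.snd.snd.snd.toList.map fun T =>
      list (sortLT (fun a b => lexLT a.toList b.toList) (lookup table T).toList))]

theorem fp_viewFromAnswers (Sim : PPT) : FP fun p => viewFromAnswers Sim p.fst p.snd := by
  have h0 := FP.const (.atom false)
  have htable : FP fun p => list (List.zipWith Data.cons p.fst.snd.snd.fst.toList
      (list (p.snd.toList.map fun y => .cons y (.atom false))).toList) :=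
    FP.id.fst.snd.snd.fst.zip (FP.map (F := fun _ y => .cons y (.atom false)) (FP.id.snd.cons h0)
      FP.id FP.id.snd)
  have h1 : FP fun p => list (p.fst.snd.fst.toList.map fun p => p.fst) :=
    FP.map (F := fun _ p => p.fst) FP.id.snd.fst FP.id FP.id.fst.snd.fst
  have h2 : FP fun p => list ((list (List.zipWith Data.cons p.fst.snd.fst.toList
      p.snd.toList)).toList.map fun q =>
        Sim.run (.cons (list [p.fst.fst, q.fst.fst, q.snd]) q.fst.snd)) := by
    refine FP.map (F := fun c q => Sim.run (.cons (list [c, q.fst.fst, q.snd]) q.fst.snd)) ?_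
      FP.id.fst.fst (FP.id.fst.snd.fst.zip FP.id.snd)
    exact FP.comp Sim.polyTime ((FP.id.fst.cons (FP.id.snd.fst.fst.cons
      (FP.id.snd.snd.cons h0))).cons FP.id.snd.fst.snd)
  have h3 := FP.map (F := fun c T =>
      list (sortLT (fun a b => lexLT a.toList b.toList) (lookup c T).toList))
    (FP.id.fst.lookup FP.id.snd).sortLT htable FP.id.fst.snd.snd.snd
  exact h1.cons (h2.cons (h3.cons h0))

/-- The query list repeats elements common to both groups. This does no harm, as encrypted sets are
formed as sets. -/
theorem filter_mem_append_toFinset {α : Type} [DecidableEq α] (s t : Finset α) (l l' : List α)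
    (hl : ∀ x, x ∈ l ↔ x ∈ s) (hl' : ∀ x ∈ t, x ∉ s → x ∈ l') :
    ((l ++ l').filter fun x => x ∈ t).toFinset = t := by
  ext x
  simp only [List.mem_toFinset, List.mem_filter, List.mem_append, decide_eq_true_eq, hl]
  constructor
  · exact fun h => h.2
  · intro h
    by_cases hs : x ∈ s
    · exact ⟨Or.inl hs, h⟩
    · exact ⟨Or.inr (hl' x h hs), h⟩

theorem zipWith_map_map_append {α β γ δ : Type} (f : β → γ → δ) (a : α → β) (b : α → γ)
    (l : List α) (r : List γ) :
    List.zipWith f (l.map a) (l.map b ++ r) = l.map fun x => f (a x) (b x) := by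
  induction l with
  | nil => rfl
  | cons x l ih => simp [ih]

theorem zipWith_map_map {α β γ δ : Type} (f : β → γ → δ) (a : α → β) (b : α → γ) (l : List α) :
    List.zipWith f (l.map a) (l.map b) = l.map fun x => f (a x) (b x) := by
  have := zipWith_map_map_append f a b l []
  rwa [List.append_nil] at this

/-- The ideal view uses the function only through its values on the queries, so an oracle adversary
can compute it with the sets and the coins `w` as advice. -/
theorem viewFromAnswers_eq (Sim : PPT) (n : ℕ) {u l m c : ℕ} (S : Finset (Bits u))
    (S' : Fin m → Finset (Bits u)) (g : Bits u → Bits l) (w : Bits u → Bits c) :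
    viewFromAnswers Sim (.cons (unary n)
      (.cons (list ((sorted S).map fun x => .cons (bits x) (bits (w x))))
        (.cons (list ((sorted S ++ sorted (Finset.univ.biUnion S')).map bits))
          (list (List.ofFn fun t => bitsSet (S' t))))))
      (list ((sorted S ++ sorted (Finset.univ.biUnion S')).map fun x => bits (g x))) =
    idealView Sim n S S' g w := by
  have hlk (t : Fin m) := lookup_eq (sorted S ++ sorted (Finset.univ.biUnion S')) g
    (fun _ => .atom false) (S' t)
  have himg (t : Fin m) : bitsSet ((S' t).image g) = list (sortLT (fun a b =>
      lexLT a.toList b.toList) (((sorted S ++ sorted (Finset.univ.biUnion S')).filter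
        fun x => x ∈ S' t).map fun x => bits (g x))) := by
    have h1 := filter_mem_append_toFinset S (S' t) (sorted S) (sorted (Finset.univ.biUnion S'))
      (fun _ => mem_sorted) fun x hx _ => mem_sorted.2 (Finset.mem_biUnion.2 ⟨t, by simp, hx⟩)
    have h2 := bitsSet_toFinset (((sorted S ++ sorted (Finset.univ.biUnion S')).filter
      fun x => x ∈ S' t).map g)
    rw [List.map_map] at h2
    refine Eq.trans ?_ h2
    congr 1
    nth_rewrite 1 [← h1]
    ext y
    simp only [Finset.mem_image, List.mem_toFinset, List.mem_map]
  have hzip : List.zipWith Data.cons ((sorted S).map fun x => .cons (bits x) (bits (w x)))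
      ((sorted S ++ sorted (Finset.univ.biUnion S')).map fun x => bits (g x)) =
      (sorted S).map fun x => .cons (.cons (bits x) (bits (w x))) (bits (g x)) := by
    rw [List.map_append, zipWith_map_map_append]
  have htable : List.zipWith Data.cons ((sorted S ++ sorted (Finset.univ.biUnion S')).map bits)
      ((sorted S ++ sorted (Finset.univ.biUnion S')).map fun x => .cons (bits (g x)) (.atom false)) =
      (sorted S ++ sorted (Finset.univ.biUnion S')).map fun x =>
        .cons (bits x) (.cons (bits (g x)) (.atom false)) :=
    zipWith_map_map _ _ _ _
  simp only [viewFromAnswers, fst_cons, snd_cons, toList_list, List.map_map, Function.comp_def,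
    hzip, List.map_ofFn, htable, hlk, idealView, clientContext, himg]
  rfl

end EGPSI

namespace EGPSI
open Data

/-! ## The simulator for a client -/

namespace ClientSim

variable (F : FunFamily) (Sim : PPT)

/-- Number of coins of a run of the OPRF simulator. -/
noncomputable def coinLength (n : ℕ) : ℕ := Sim.coins.eval (2 * (n + F.u n + F.v n) + 7)

/-- The first bits of a block, as many as there are elements in the list `c`. -/
noncomputable def firstBits (c _e b : Data) : Data := list (b.toList.take c.toList.length)

/-- The table entry for the element `e`: a random value and a simulated run of the OPRF. The context
consists of `1ⁿ` and the length of a value. -/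
noncomputable def runElem (c e b : Data) : Data :=
  .cons e (.cons (firstBits c.snd e b) (Sim.run (.cons (list [c.fst, e, firstBits c.snd e b])
    (list (b.toList.drop c.snd.toList.length)))))

/-- The encrypted set of a client of the other group, given by its cardinality and its intersection
with the set of the client. The context consists of the table for the latter, the length of a value
and the length of a block of coins. -/
noncomputable def runOther (c e b : Data) : Data :=
  -- Values on the intersection come from the table and so agree with the simulated runs. Every
  -- remaining element gets a fresh value; dropping as many unary digits as the intersection has
  -- elements leaves their number.
  list (sortLT (fun a b => lexLT a.toList b.toList) (list ((lookup c.fst e.snd).toList ++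
    (list (blockMap (fun e b => firstBits c.snd.fst e (list b)) c.snd.snd.toList.length
      (list (e.fst.toList.drop e.snd.toList.length)).toList b.toList)).toList)).toList)

/-- The simulation of the view of a client from `1ⁿ`, the cardinalities of the sets of the other
group, the client's set and output, and coins `r`. -/
noncomputable def simulate (N cards S out r : Data) : Data :=
  let n := N.toList.length
  -- A block holds a random value followed by the coins of a simulated run. For elements held only
  -- by the other group the second part stays unused.
  let L := F.v n + coinLength F Sim n
  let K := S.toList.length + sumLength cards.toList
  let table := list (blockMap (fun e b => runElem Sim (.cons (unary n) (unary (F.v n))) e (list b)) L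
    S.toList r.toList)
  list [S, list (table.toList.map fun e => e.snd.snd),
    list (blockMap (fun e b => runOther (.cons table (.cons (unary (F.v n)) (unary L))) e (list b))
      (K * L) (list (List.zipWith Data.cons cards.toList out.toList)).toList
      (list (r.toList.drop (K * L))).toList)]

theorem fp_firstBits : FP fun p => firstBits p.fst p.snd.fst p.snd.snd :=
  FP.id.fst.unary_length_toList.take FP.id.snd.snd

theorem fp_runElem : FP fun p => runElem Sim p.fst p.snd.fst p.snd.snd := by
  have hy : FP fun p => firstBits p.fst.snd p.snd.fst p.snd.snd :=
    fp_firstBits.app3 FP.id.fst.snd FP.id.snd.fst FP.id.snd.snd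
  exact FP.id.snd.fst.cons (hy.cons (FP.comp Sim.polyTime
    ((FP.id.fst.fst.cons (FP.id.snd.fst.cons (hy.cons (FP.const (.atom false))))).cons
      (FP.id.fst.snd.unary_length_toList.drop FP.id.snd.snd))))

theorem fp_runOther : FP fun p => runOther p.fst p.snd.fst p.snd.snd :=
  ((FP.id.fst.fst.lookup FP.id.snd.fst.snd).append
    (fp_firstBits.blockMap FP.id.fst.snd.fst FP.id.fst.snd.snd.unary_length_toList
      (FP.id.snd.fst.snd.unary_length_toList.drop FP.id.snd.fst.fst) FP.id.snd.snd)).sortLT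

theorem fp_simulate {N cards S out r : Data → Data} (hN : FP N) (hcards : FP cards) (hS : FP S)
    (hout : FP out) (hr : FP r) :
    FP fun x => simulate F Sim (N x) (cards x) (S x) (out x) (r x) := by
  have h0 := FP.const (.atom false)
  have hn := hN.unary_length_toList
  have hu := FP.unary_polyLength F.u_poly hn
  have hv := FP.unary_polyLength F.v_poly hn
  have hc : FP fun x => unary (coinLength F Sim (N x).toList.length) :=
    FP.unary_eval Sim.coins (((FP.unary_const 2).unary_mul ((hn.unary_add hu).unary_add hv)).unary_add
      (FP.unary_const 7))
  have hL := hv.unary_add hc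
  have hKL := (hS.unary_length_toList.unary_add hcards.unary_sumLength).unary_mul hL
  have htable := (fp_runElem Sim).blockMap (hn.cons hv) hL hS hr
  exact hS.cons ((FP.map (F := fun _ e => e.snd.snd) FP.id.snd.snd.snd FP.id htable).cons
    ((fp_runOther.blockMap (htable.cons (hv.cons hL)) hKL (hcards.zip hout) (hKL.drop hr)).cons h0))

/-- A polynomial bound for the lengths of values and of arguments of the functions. -/
noncomputable def lengthBound : Polynomial ℕ := F.u_poly.polyBdd.choose + F.v_poly.polyBdd.choose

theorem length_le (n : ℕ) : F.u n + F.v n ≤ (lengthBound F).eval n := by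
  rw [lengthBound, Polynomial.eval_add]
  exact add_le_add (F.u_poly.polyBdd.choose_spec n) (F.v_poly.polyBdd.choose_spec n)

/-- The simulator for a client. -/
noncomputable def sim : PPT where
  -- This covers `m + 1` groups, one for the client itself and one for each opponent, of `total`
  -- blocks each.
  coins := (.X + 1) * .X * (lengthBound F + Sim.coins.comp (2 * (.X + lengthBound F) + 7))
  run z := simulate F Sim z.fst.fst.fst
    -- The unary code of `j` is a pair exactly when `j = 1`, so this test picks the cardinalities of
    -- group `1 - j`.
    (if z.fst.snd.fst.isCons.truth = true then z.fst.fst.snd.fst else z.fst.fst.snd.snd.fst)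
    z.fst.snd.snd.snd.fst z.fst.snd.snd.snd.snd.fst z.snd
  polyTime := fp_simulate F Sim FP.id.fst.fst.fst
    (FP.id.fst.snd.fst.isCons.ite FP.id.fst.fst.snd.fst FP.id.fst.fst.snd.snd.fst)
    FP.id.fst.snd.snd.snd.fst FP.id.fst.snd.snd.snd.snd.fst FP.id.snd

/-! ### Allocation of coin blocks to elements -/

section Index

variable {u m : ℕ} (S : Finset (Bits u)) (S' : Fin m → Finset (Bits u))

/-- The number of elements, of the client and of the other group. -/
noncomputable def total : ℕ := S.card + sumLength (List.ofFn fun t => unary (S' t).card)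

open Classical in
/-- The position of the block of coins for an element. -/
noncomputable def index (x : Bits u) : ℕ :=
  -- Common elements are indexed only within `S`, so both sides share one value. For disjoint sets
  -- `S' t` the choice below is unambiguous; the final `0` is a default for strings that nobody
  -- holds.
  if x ∈ S then (sorted S).idxOf x
  else if h : ∃ t, x ∈ S' t then
    (h.choose + 1) * total S S' + (sorted (S' h.choose \ S)).idxOf x
  else 0

variable {S S'}

theorem index_of_mem {x : Bits u} (h : x ∈ S) : index S S' x = (sorted S).idxOf x := by
  simp [index, h]

/-- Here disjointness within a group enters: outside `S`, an element belongs to only one opponent,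
hence to only one block of coins. -/
theorem index_of_notMem (hd : ∀ t t', t ≠ t' → Disjoint (S' t) (S' t')) {x : Bits u} (h : x ∉ S)
    {t : Fin m} (ht : x ∈ S' t) :
    index S S' x = (t + 1) * total S S' + (sorted (S' t \ S)).idxOf x := by
  have hex : ∃ t, x ∈ S' t := ⟨t, ht⟩
  have : hex.choose = t := by
    by_contra hne
    exact Finset.disjoint_left.1 (hd _ _ hne) hex.choose_spec ht
  simp [index, h, hex, this]

theorem card_le_total (t : Fin m) : (S' t).card ≤ total S S' := by
  have := length_le_sumLength (l := List.ofFn fun t => unary (S' t).card)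
    (List.mem_ofFn.2 ⟨t, rfl⟩)
  rw [length_toList_unary] at this
  exact this.trans (Nat.le_add_left _ _)

theorem idxOf_lt_card {s : Finset (Bits u)} {x : Bits u} (h : x ∈ s) :
    (sorted s).idxOf x < s.card := by
  rw [← length_sorted]
  exact List.idxOf_lt_length_of_mem (mem_sorted.2 h)

/-- Quotient and remainder of the index modulo `total S S'`, with the quotient determining the list
in which the remainder is a position. Injectivity and the bound on positions both follow from this.
-/
theorem index_form (hd : ∀ t t', t ≠ t' → Disjoint (S' t) (S' t')) {x : Bits u}
    (hx : x ∈ S ∪ Finset.univ.biUnion S') : ∃ (q : ℕ) (s : Finset (Bits u)), q ≤ m ∧ x ∈ s ∧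
      (sorted s).idxOf x < total S S' ∧ index S S' x = q * total S S' + (sorted s).idxOf x ∧
      ((q = 0 ∧ s = S) ∨ ∃ t : Fin m, q = t + 1 ∧ s = S' t \ S) := by
  by_cases h : x ∈ S
  · exact ⟨0, S, Nat.zero_le _, h, (idxOf_lt_card h).trans_le (Nat.le_add_right _ _),
      by rw [index_of_mem h]; simp, Or.inl ⟨rfl, rfl⟩⟩
  · obtain ⟨t, -, ht⟩ := Finset.mem_biUnion.1 ((Finset.mem_union.1 hx).resolve_left h)
    have hx' : x ∈ S' t \ S := Finset.mem_sdiff.2 ⟨ht, h⟩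
    exact ⟨t + 1, S' t \ S, t.2, hx', ((idxOf_lt_card hx').trans_le
      (Finset.card_le_card Finset.sdiff_subset)).trans_le (card_le_total t),
      index_of_notMem hd h ht, Or.inr ⟨t, rfl, rfl⟩⟩

theorem index_injOn (hd : ∀ t t', t ≠ t' → Disjoint (S' t) (S' t')) :
    ∀ a ∈ S ∪ Finset.univ.biUnion S', ∀ b ∈ S ∪ Finset.univ.biUnion S',
      index S S' a = index S S' b → a = b := by
  intro a ha b hb h
  obtain ⟨q, s, -, has, hlt, he, hq⟩ := index_form hd ha
  obtain ⟨q', s', -, hbs, hlt', he', hq'⟩ := index_form hd hb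
  rw [he, he'] at h
  have hK : 0 < total S S' := by omega
  have hqq := congrArg (· / total S S') h
  simp only [Nat.mul_comm _ (total S S'), Nat.mul_add_div hK, Nat.div_eq_of_lt hlt,
    Nat.div_eq_of_lt hlt', Nat.add_zero] at hqq
  subst hqq
  obtain rfl : s = s' := by
    rcases hq with ⟨rfl, rfl⟩ | ⟨t, rfl, rfl⟩ <;> rcases hq' with ⟨h0, rfl⟩ | ⟨t', h0, rfl⟩
    · rfl
    · omega
    · omega
    · rw [Fin.ext (Nat.succ_injective h0)]
  exact (List.idxOf_inj (mem_sorted.2 has)).1 (by omega)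

theorem index_mul_add_le (hd : ∀ t t', t ≠ t' → Disjoint (S' t) (S' t')) (L : ℕ) :
    ∀ a ∈ S ∪ Finset.univ.biUnion S',
      index S S' a * L + L ≤ (m + 1) * total S S' * L := by
  intro a ha
  obtain ⟨q, s, hq, -, hlt, he, -⟩ := index_form hd ha
  rw [← Nat.succ_mul, he]
  refine Nat.mul_le_mul_right L ?_
  have := Nat.mul_le_mul_right (total S S') hq
  rw [Nat.add_mul, Nat.one_mul]
  omega

end Index

/-! ### The client simulator's output as an ideal view -/

variable {F Sim} {n m N : ℕ} {S : Finset (Bits (F.u n))} {S' : Fin m → Finset (Bits (F.u n))}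

/-- The value drawn from a block of coins. -/
noncomputable def blockValue {p q : ℕ} (b : Bits (p + q)) : Bits p := fun i => b (Fin.castAdd q i)

/-- The coins for the OPRF simulator drawn from a block of coins. -/
noncomputable def blockCoins {p q : ℕ} (b : Bits (p + q)) : Bits q := fun i => b (Fin.natAdd p i)

/-- The table entry for `x` obtained with the block `b` of coins. -/
noncomputable def entry (Sim : PPT) (n : ℕ) {u p q : ℕ} (x : Bits u) (b : Bits (p + q)) : Data :=
  .cons (bits x) (.cons (bits (blockValue b))
    (Sim.run (.cons (list [unary n, bits x, bits (blockValue b)]) (bits (blockCoins b)))))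

theorem mapIdx_map {α β γ : Type} (f : α → β) (g : ℕ → β → γ) (l : List α) :
    (l.map f).mapIdx g = l.mapIdx fun i a => g i (f a) := by
  apply List.ext_getElem
  · simp
  · intro i h1 h2
    simp

theorem table_eq (r : Bits N)
    (hN : S.card * (F.v n + coinLength F Sim n) ≤ N) :
    blockMap (fun e b => runElem Sim (.cons (unary n) (unary (F.v n))) e (list b))
      (F.v n + coinLength F Sim n) (bitsSet S).toList (bits r).toList =
    (sorted S).map fun x => entry Sim n x (block (F.v n + coinLength F Sim n) r
      ((sorted S).idxOf x * (F.v n + coinLength F Sim n))) := by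
  rw [blockMap_eq_mapIdx, bitsSet, toList_list, mapIdx_map,
    mapIdx_eq_map_idxOf (nodup_sorted S)]
  refine List.map_congr_left fun x hx => ?_
  have h1 := Nat.mul_le_mul_right (F.v n + coinLength F Sim n)
    (Nat.succ_le_of_lt (idxOf_lt_card (mem_sorted.1 hx)))
  rw [Nat.succ_mul] at h1
  simp only [runElem, firstBits, fst_cons, snd_cons, length_toList_unary,
    toList_bits_drop_take r (h1.trans hN), toList_bits_take, toList_bits_drop,
    list_toList_bits]
  rfl

theorem zipWith_ofFn {α β γ : Type} {n : ℕ} (f : α → β → γ) (a : Fin n → α) (b : Fin n → β) :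
    List.zipWith f (List.ofFn a) (List.ofFn b) = List.ofFn fun i => f (a i) (b i) := by
  apply List.ext_getElem
  · simp
  · intro i h1 h2
    simp

/-- `S' t` is the disjoint union of `S ∩ S' t`, read from the table, and `S' t \ S`, drawn afresh;
sorting removes any trace of this division. -/
theorem runOther_eq {B o : ℕ} (r : Bits N) {c : ℕ} (t : Fin m) (ρ : Bits (F.u n) → Bits (F.v n + c))
    (d : Bits (F.u n) → Data)
    (hρ : ∀ x ∈ S' t \ S, ρ x = block _ r (o + (sorted (S' t \ S)).idxOf x * (F.v n + c)))
    (hB : (S' t).card * (F.v n + c) ≤ B) (ho : o + B ≤ N) :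
    runOther (.cons (list ((sorted S).map fun x =>
        .cons (bits x) (.cons (bits (blockValue (ρ x))) (d x))))
      (.cons (unary (F.v n)) (unary (F.v n + c))))
      (.cons (unary (S' t).card) (bitsSet (S ∩ S' t)))
      (list (((bits r).toList.drop o).take B)) =
    bitsSet ((S' t).image fun x => blockValue (ρ x)) := by
  have hcard : (unary (S' t).card).toList.length - (bitsSet (S ∩ S' t)).toList.length =
      (S' t \ S).card := by
    rw [Finset.card_sdiff]
    simp [bitsSet]
  have hfresh : blockMap (fun e b => firstBits (unary (F.v n)) e (list b)) (F.v n + c)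
      ((unary (S' t).card).toList.drop (bitsSet (S ∩ S' t)).toList.length)
      (((bits r).toList.drop o).take B) =
      (sorted (S' t \ S)).map fun x => bits (blockValue (ρ x)) := by
    rw [blockMap_eq_mapIdx]
    simp only [firstBits, length_toList_unary, toList_list]
    rw [mapIdx_eq_of_length_eq (l' := sorted (S' t \ S)) (fun k => list ((((((bits r).toList.drop
        o).take B).drop (k * (F.v n + c))).take (F.v n + c)).take (F.v n)))
      (by rw [List.length_drop, hcard, length_sorted]), mapIdx_eq_map_idxOf (nodup_sorted _)]
    refine List.map_congr_left fun x hx => ?_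
    have h1 := Nat.mul_le_mul_right (F.v n + c) (Nat.succ_le_of_lt ((idxOf_lt_card
      (mem_sorted.1 hx)).trans_le (Finset.card_le_card Finset.sdiff_subset)))
    rw [Nat.succ_mul] at h1
    rw [drop_take_drop_take _ (h1.trans hB), toList_bits_drop_take r (by omega), toList_bits_take,
      list_toList_bits, hρ x (mem_sorted.1 hx)]
    rfl
  have hset : (((sorted S).filter fun x => x ∈ S ∩ S' t) ++ sorted (S' t \ S)).toFinset = S' t := by
    ext x
    simp only [List.mem_toFinset, List.mem_append, List.mem_filter, mem_sorted, decide_eq_true_eq,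
      Finset.mem_inter, Finset.mem_sdiff]
    tauto
  have himg : ((S' t).image fun x => blockValue (ρ x)) = ((((sorted S).filter fun x =>
      x ∈ S ∩ S' t) ++ sorted (S' t \ S)).map fun x => blockValue (ρ x)).toFinset := by
    conv_lhs => rw [← hset]
    ext y
    simp only [Finset.mem_image, List.mem_toFinset, List.mem_map]
  rw [himg, bitsSet_toFinset, runOther]
  simp only [fst_cons, snd_cons, toList_list, length_toList_unary, lookup_eq, hfresh, List.map_map,
    List.map_append, Function.comp_def]

/-- The random function is read off the coins: its value at `x` is the first part of the block with
index `index S S' x`. -/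
theorem simulate_eq (hd : ∀ t t', t ≠ t' → Disjoint (S' t) (S' t')) (r : Bits N) {c : ℕ}
    (hc : c = coinLength F Sim n) (hN : (m + 1) * total S S' * (F.v n + c) ≤ N) :
    simulate F Sim (unary n) (list (List.ofFn fun t => unary (S' t).card)) (bitsSet S)
      (list (List.ofFn fun t => bitsSet (S ∩ S' t))) (bits r) =
    idealView Sim n S S' (fun x => blockValue (block (F.v n + c) r (index S S' x * (F.v n + c))))
      (fun x => blockCoins (block (F.v n + c) r (index S S' x * (F.v n + c)))) := by
  subst hc
  have hm : (m + 1) * total S S' * (F.v n + coinLength F Sim n) =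
      total S S' * (F.v n + coinLength F Sim n) +
        m * (total S S' * (F.v n + coinLength F Sim n)) := by ring
  have hS : S.card * (F.v n + coinLength F Sim n) ≤ N := by
    have := Nat.mul_le_mul_right (F.v n + coinLength F Sim n)
      (Nat.le_add_right S.card (sumLength (List.ofFn fun t => unary (S' t).card)))
    rw [total] at hm
    rw [total] at hN
    omega
  have hlen : (bitsSet S).toList.length + sumLength (List.ofFn fun t => unary (S' t).card) =
      total S S' := by simp [bitsSet, total]
  have htab := table_eq (Sim := Sim) r hS
  rw [List.map_congr_left (g := fun x => entry Sim n x (block (F.v n + coinLength F Sim n) r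
    (index S S' x * (F.v n + coinLength F Sim n))))
    fun x hx => by rw [index_of_mem (mem_sorted.1 hx)]] at htab
  simp only [simulate, length_toList_unary, toList_list, zipWith_ofFn, hlen, htab,
    blockMap_eq_mapIdx (fun e b => runOther _ e (list b)), mapIdx_ofFn, idealView, clientContext,
    List.map_map, Function.comp_def, entry, snd_cons, List.drop_drop]
  congr 3
  refine congrArg (fun f => [list (List.ofFn f)]) (funext fun t => ?_)
  have h : (t : ℕ) * (total S S' * (F.v n + coinLength F Sim n)) +
      total S S' * (F.v n + coinLength F Sim n) ≤
      m * (total S S' * (F.v n + coinLength F Sim n)) := by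
    rw [← Nat.succ_mul]
    exact Nat.mul_le_mul_right _ t.2
  refine runOther_eq r t (fun x => block (F.v n + coinLength F Sim n) r
    (index S S' x * (F.v n + coinLength F Sim n))) _ (fun x hx => ?_)
    (Nat.mul_le_mul_right _ (card_le_total t)) (by omega)
  have hx := Finset.mem_sdiff.1 hx
  rw [index_of_notMem hd hx.2 hx.1]
  congr 1
  ring

end ClientSim

end EGPSI

/-! ### Distribution of the client simulator's output -/

namespace EGPSI
open Data

namespace ClientSim

variable (F : FunFamily) (Sim : PPT) (n : ℕ) (I : Inputs (F.u n)) (j : Fin 2) (i : Fin I.m)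

/-- The input of the simulator for a client. -/
noncomputable def input : Data :=
  list [I.pub n, unary j, unary i, bitsSet (I.S j i),
    list (List.ofFn fun t => bitsSet (I.fGPSI j i t))]

theorem coins_sufficient :
    (I.m + 1) * total (I.S j i) (I.S (1 - j)) * (F.v n + coinLength F Sim n) ≤
      (sim F Sim).coins.eval (input F n I j i).size := by
  have hS (j : Fin 2) := sumLength_lt_size (List.ofFn fun i => unary (I.S j i).card)
  have hm := length_lt_size_list (List.ofFn fun i => unary (I.S 0 i).card)
  have hc := length_lt_size_list ((sorted (I.S j i)).map bits)
  have h0 := hS 0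
  have h1 := hS 1
  have hsize : (list (List.ofFn fun i => unary (I.S 0 i).card)).size +
      (list (List.ofFn fun i => unary (I.S 1 i).card)).size + (2 * n + 1) +
      (list ((sorted (I.S j i)).map bits)).size ≤ (input F n I j i).size := by
    simp only [input, Inputs.pub, bitsSet, list_cons, list_nil, size_cons, size_atom, size_unary]
    omega
  rw [List.length_ofFn] at hm
  rw [List.length_map, length_sorted] at hc
  have hn : n ≤ (input F n I j i).size := by omega
  have hl := (length_le F n).trans (polynomial_eval_mono (lengthBound F) hn)
  dsimp only at hl
  have ht : total (I.S j i) (I.S (1 - j)) ≤ (input F n I j i).size := by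
    unfold total
    match j with
    | 0 => simp only [sub_zero] at *; omega
    | 1 => simp only [sub_self] at *; omega
  have hcl : coinLength F Sim n ≤ Sim.coins.eval (2 * ((input F n I j i).size +
      (lengthBound F).eval (input F n I j i).size) + 7) :=
    polynomial_eval_mono _ (by omega)
  simp only [sim, Polynomial.eval_mul, Polynomial.eval_add, Polynomial.eval_one, Polynomial.eval_X,
    Polynomial.eval_comp, Polynomial.eval_ofNat]
  gcongr <;> omega

theorem idealView_congr {u l m c : ℕ} {S : Finset (Bits u)} {S' : Fin m → Finset (Bits u)}
    {g g' : Bits u → Bits l} {w w' : Bits u → Bits c}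
    (hg : ∀ x ∈ S ∪ Finset.univ.biUnion S', g x = g' x)
    (hw : ∀ x ∈ S ∪ Finset.univ.biUnion S', w x = w' x) :
    idealView Sim n S S' g w = idealView Sim n S S' g' w' := by
  have h (t : Fin m) : (S' t).image g = (S' t).image g' :=
    Finset.image_congr fun x hx => hg x (Finset.mem_union_right _
      (Finset.mem_biUnion.2 ⟨t, Finset.mem_univ t, hx⟩))
  simp only [idealView, h]
  refine clientContext_congr _ _ fun x hx => ?_
  rw [hg x (Finset.mem_union_left _ hx), hw x (Finset.mem_union_left _ hx)]

/-- The output of the simulator is the ideal view for a uniformly random function. -/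
theorem accept_sim (D : Distinguisher) : D.accept n ((sim F Sim).dist (input F n I j i)) =
    𝔼 g : Bits (F.u n) → Bits (F.v n), 𝔼 w : Bits (F.u n) → Bits (coinLength F Sim n),
      D.val n (idealView Sim n (I.S j i) (I.S (1 - j)) g w) := by
  have hd := I.disjoint (1 - j)
  let H' : (Bits (F.u n) → Bits (F.v n + coinLength F Sim n)) → ℝ := fun ρ =>
    D.val n (idealView Sim n (I.S j i) (I.S (1 - j)) (fun x => blockValue (ρ x))
      (fun x => blockCoins (ρ x)))
  have hrun (r : Bits ((sim F Sim).coins.eval (input F n I j i).size)) :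
      D.val n ((sim F Sim).run (.cons (input F n I j i) (bits r))) = H' fun x =>
        block _ r (index (I.S j i) (I.S (1 - j)) x * (F.v n + coinLength F Sim n)) := by
    have := simulate_eq hd r rfl (coins_sufficient F Sim n I j i)
    refine congrArg _ (Eq.trans ?_ this)
    have hcards : (if (unary (j : ℕ)).isCons.truth = true then
        list (List.ofFn fun i => unary (I.S 0 i).card) else
        list (List.ofFn fun i => unary (I.S 1 i).card)) =
        list (List.ofFn fun i => unary (I.S (1 - j) i).card) := by
      match j with
      | 0 => rfl
      | 1 => rfl
    rw [← hcards]
    rfl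
  rw [PPT.dist_eq _ rfl, D.accept_law]
  simp only [hrun]
  rw [expect_block _ _ _ _ (index_injOn hd) (fun a ha => (index_mul_add_le hd _ a ha).trans
    (coins_sufficient F Sim n I j i)) H']
  · exact expect_split fun g w => D.val n (idealView Sim n (I.S j i) (I.S (1 - j)) g w)
  · intro ρ ρ' h
    refine congrArg (D.val n) (idealView_congr Sim n (fun x hx => ?_) fun x hx => ?_) <;>
      rw [h x hx]

end ClientSim

/-! ## Errors of the OPRF -/

section

variable {F : FunFamily} (P : OPRFProtocol F)

theorem expect_eval₂ {A B R : Type} [Fintype A] [DecidableEq A] [Fintype B] [DecidableEq B]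
    [Fintype R] [Nonempty R] (a : A) (b : B) (h : R → ℝ) :
    𝔼 ω : A → B → R, h (ω a b) = 𝔼 r, h r :=
  (expect_eval a fun f : B → R => h (f b)).trans (expect_eval b h)

theorem prob_exists_le_sum {Ω A : Type} [Fintype Ω] [Nonempty Ω] (T : Finset A)
    (E : A → Ω → Prop) : prob (fun ω => ∃ a ∈ T, E a ω) ≤ ∑ a ∈ T, prob (E a) := by
  classical
  simp only [prob_eq_expect]
  rw [← Finset.expect_sum_comm]
  refine Finset.expect_le_expect fun ω _ => ?_
  have h0 (a : A) : (0 : ℝ) ≤ if E a ω then 1 else 0 := by split_ifs <;> norm_num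
  split_ifs with h
  · obtain ⟨a, ha, hE⟩ := h
    exact le_trans (by simp [hE]) (Finset.single_le_sum (f := fun a => if E a ω then (1 : ℝ) else 0)
      (fun a _ => h0 a) ha)
  · exact Finset.sum_nonneg fun a _ => h0 a

theorem prob_mono {Ω : Type} [Fintype Ω] [Nonempty Ω] {E E' : Ω → Prop} (h : ∀ ω, E ω → E' ω) :
    prob E ≤ prob E' := by
  simp only [prob_eq_expect]
  refine Finset.expect_le_expect fun ω _ => ?_
  by_cases hE : E ω
  · rw [if_pos hE, if_pos (h ω hE)]
  · rw [if_neg hE]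
    split_ifs <;> norm_num

/-- Two experiments that agree unless a bad event occurs differ by at most its probability. -/
theorem abs_expect_sub_le_prob {Ω : Type} [Fintype Ω] [Nonempty Ω] {f g : Ω → ℝ} (E : Ω → Prop)
    (h : ∀ ω, |f ω - g ω| ≤ 1) (hE : ∀ ω, ¬ E ω → f ω = g ω) :
    |𝔼 ω, f ω - 𝔼 ω, g ω| ≤ prob E := by
  rw [prob_eq_expect]
  refine abs_expect_sub_le_expect fun ω => ?_
  split_ifs with hω
  · exact h ω
  · rw [hE ω hω, sub_self, abs_zero]

theorem Distinguisher.abs_val_sub_le_one (D : Distinguisher) (n : ℕ) (y z : Data) :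
    |D.val n y - D.val n z| ≤ 1 := by
  rw [abs_le]
  constructor <;> linarith [D.val_nonneg n y, D.val_le_one n y, D.val_nonneg n z, D.val_le_one n z]

/-- The probability that one of the OPRF runs yields a wrong value. -/
theorem prob_error_le {ε : ℕ → ℝ} (hε : ∀ n (k : Bits n) (x : Bits (F.u n)),
      prob (fun r : Bits (P.clientCoins n) × Bits (P.serverCoins n) =>
        P.output n k x r.1 r.2 ≠ F.eval n k x) ≤ ε n)
    (n : ℕ) (I : Inputs (F.u n)) (k : Bits n) :
    prob (fun ω : Fin 2 → Fin I.m → Bits (F.u n) → Bits (P.clientCoins n) × Bits (P.serverCoins n) =>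
      ∃ a ∈ elements I, encElem P n I (k, ω) a.1 a.2.1 a.2.2 ≠ F.eval n k a.2.2) ≤
      (elements I).card * ε n := by
  refine (prob_exists_le_sum (elements I) _).trans ?_
  rw [← nsmul_eq_mul]
  refine Finset.sum_le_card_nsmul _ _ _ fun a _ => ?_
  refine le_trans (le_of_eq ?_) (hε n k a.2.2)
  let E (r : Bits (P.clientCoins n) × Bits (P.serverCoins n)) : Prop :=
    P.output n k a.2.2 r.1 r.2 ≠ F.eval n k a.2.2
  change prob (fun ω : Fin 2 → Fin I.m → Bits (F.u n) → Bits (P.clientCoins n) ×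
    Bits (P.serverCoins n) => E (ω a.1 a.2.1 a.2.2)) = prob E
  classical
  rw [prob_eq_expect, prob_eq_expect]
  -- Each run uses a single coordinate of the family of coins, and that coordinate is uniform.
  exact (expect_eval₂ a.1 a.2.1 fun f : Bits (F.u n) → Bits (P.clientCoins n) ×
    Bits (P.serverCoins n) => @ite ℝ (E (f a.2.2)) (Classical.propDecidable _) 1 0).trans
      (expect_eval a.2.2 fun r => @ite ℝ (E r) (Classical.propDecidable _) 1 0)

end

/-! ## Security against clients -/

theorem card_biUnion_le {α : Type} [DecidableEq α] {m b : ℕ} {S : Fin m → Finset α} (hm : m ≤ b)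
    (hS : ∀ t, (S t).card ≤ b) : (Finset.univ.biUnion S).card ≤ b * b := by
  refine (Finset.card_biUnion_le_card_mul _ _ b fun t _ => hS t).trans ?_
  simpa using Nat.mul_le_mul_right b hm

/-- The step from the pseudorandom function to a random function. -/
theorem exists_prf_bound {F : FunFamily} (hF : F.IsPRF) (Sim : PPT) (D : Distinguisher)
    {b c : ℕ → ℕ} (hb : PolyBdd (fun n => n) b) (hc : PolyBdd (fun n => n) c) :
    ∃ ε, Negligible ε ∧ ∀ n {m : ℕ} (S : Finset (Bits (F.u n))) (S' : Fin m → Finset (Bits (F.u n)))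
      (w : Bits (F.u n) → Bits (c n)), m ≤ b n → S.card ≤ b n → (∀ t, (S' t).card ≤ b n) →
      |𝔼 k : Bits n, D.val n (idealView Sim n S S' (F.eval n k) w) -
        𝔼 g : Bits (F.u n) → Bits (F.v n), D.val n (idealView Sim n S S' g w)| ≤ ε n := by
  -- One bound for both the number of queries, at most `b n + b n * b n`, and the size of the
  -- advice.
  let β (n : ℕ) : ℕ := 2 * n + b n * (2 * F.u n + 2 * c n + 4) + (b n + b n * b n) * (2 * F.u n + 2) +
    b n * (b n * (2 * F.u n + 2) + 2) + b n + b n * b n + 7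
  have hβ : PolyBdd (fun n => n) β := by
    have h2 := PolyBdd.const (fun n : ℕ => n) 2
    have hu := (h2.mul F.u_poly.polyBdd).add (.const _ 2)
    exact (((((((h2.mul (.self _)).add (hb.mul (((h2.mul F.u_poly.polyBdd).add (h2.mul hc)).add
      (.const _ 4)))).add ((hb.add (hb.mul hb)).mul hu)).add
      (hb.mul ((hb.mul hu).add h2))).add hb).add (hb.mul hb)).add (.const _ 7))
  obtain ⟨ε, hε, -, hle⟩ := hF.exists_bound D (fp_viewFromAnswers Sim) hβ
  refine ⟨ε, hε, fun n m S S' w hm hS hS' => ?_⟩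
  have hlen : (sorted S ++ sorted (Finset.univ.biUnion S')).length ≤ b n + b n * b n := by
    rw [List.length_append, length_sorted, length_sorted]
    exact add_le_add hS (card_biUnion_le hm hS')
  have := hle n (sorted S ++ sorted (Finset.univ.biUnion S'))
    (.cons (unary n) (.cons (list ((sorted S).map fun x => .cons (bits x) (bits (w x))))
      (.cons (list ((sorted S ++ sorted (Finset.univ.biUnion S')).map bits))
        (list (List.ofFn fun t => bitsSet (S' t)))))) ?_ ?_
  · simpa only [viewFromAnswers_eq] using this
  · simp only [β]
    omega
  · have h1 : (list ((sorted S).map fun x => .cons (bits x) (bits (w x)))).size ≤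
        b n * (2 * F.u n + 2 * c n + 4) + 1 := by
      refine size_list_le (by simpa using hS) fun y hy => ?_
      obtain ⟨x, -, rfl⟩ := List.mem_map.1 hy
      simp only [size_cons, size_bits]
      omega
    have h2 : (list ((sorted S ++ sorted (Finset.univ.biUnion S')).map bits)).size ≤
        (b n + b n * b n) * (2 * F.u n + 2) + 1 := by
      refine size_list_le (by rwa [List.length_map]) fun y hy => ?_
      obtain ⟨x, -, rfl⟩ := List.mem_map.1 hy
      exact (size_bits x).le
    have h3 : (list (List.ofFn fun t => bitsSet (S' t))).size ≤
        b n * (b n * (2 * F.u n + 2) + 2) + 1 := by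
      refine size_list_le (by simpa using hm) fun y hy => ?_
      obtain ⟨t, rfl⟩ := List.mem_ofFn.1 hy
      exact size_bitsSet_le (hS' t)
    simp only [size_cons, size_unary, β]
    omega

/-- The order of the replacements matters. Errors go first, so that the sets received no longer
involve OPRF coins. The key is averaged only in the last step, when it enters solely through values
of `F`. -/
theorem client_compIndist {F : FunFamily} {P : OPRFProtocol F} (hP : P.Secure) {Sim : PPT}
    (h : CompIndist (I := fun n => Bits n × Bits (F.u n))
      (fun n i => Sim.dist (Data.list [.unary n, bits i.2, bits (F.eval n i.1 i.2)]))
      (fun n i => law fun r : Bits (P.clientCoins n) × Bits (P.serverCoins n) =>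
        P.clientView n i.1 i.2 r.1 r.2)) (B : Polynomial ℕ) :
    CompIndist
      (I := fun n => Σ I : {I : Inputs (F.u n) // I.Bounded (B.eval n)}, Fin 2 × Fin I.1.m)
      (fun n a => (ClientSim.sim F Sim).dist (ClientSim.input F n a.1.1 a.2.1 a.2.2))
      (fun n a => law fun ω => clientView2 P n a.1.1 ω a.2.1 a.2.2) := by
  classical
  intro D
  obtain ⟨b₁, hb₁, hview, -⟩ := P.exists_view_bound
  obtain ⟨ε₁, hε₁, hcorr⟩ := hP.correct
  have hB : PolyBdd (fun n : ℕ => n) fun n => B.eval n := ⟨B, fun _ => le_rfl⟩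
  have h2 := PolyBdd.const (fun n : ℕ => n) 2
  have hin : PolyBdd (fun n : ℕ => n) fun n => 2 * (n + F.u n + F.v n) + 7 :=
    (h2.mul (((PolyBdd.self _).add F.u_poly.polyBdd).add F.v_poly.polyBdd)).add (.const _ 7)
  have hcoin : PolyBdd (fun n : ℕ => n) (ClientSim.coinLength F Sim) := hin.eval Sim.coins
  obtain ⟨b₂, hb₂, hrun⟩ := size_run_bdd Sim hin hcoin
  let q (n : ℕ) : ℕ := b₁ n + b₂ n + 1
  have hq : PolyBdd (fun n => n) q := (hb₁.add hb₂).add (.const _ 1)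
  obtain ⟨ε₂, hε₂, hε₂0, hhyb⟩ := h.hybrid D
    (b := fun n => B.eval n * (2 * F.u n + 2) + B.eval n * (q n + 1) +
      B.eval n * (B.eval n * (2 * F.v n + 2) + 2) + 7)
    ((((hB.mul ((h2.mul F.u_poly.polyBdd).add h2)).add (hB.mul (hq.add (.const _ 1)))).add
      (hB.mul ((hB.mul ((h2.mul F.v_poly.polyBdd).add h2)).add h2))).add (.const _ 7))
  obtain ⟨ε₃, hε₃, hprf⟩ := exists_prf_bound hP.prf Sim D hB hcoin
  refine ⟨fun n => (((2 * B * B).eval n : ℕ) : ℝ) * ε₁ n + ((B.eval n : ℕ) : ℝ) * ε₂ n + ε₃ n,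
    ((hε₁.polynomial_mul _).add (hε₂.polynomial_mul _)).add hε₃, ?_⟩
  rintro n ⟨⟨I, hI⟩, j, i⟩
  have hε₁0 : 0 ≤ ε₁ n := le_trans ENNReal.toReal_nonneg (hcorr n default default)
  let S := I.S j i
  let S' := I.S (1 - j)
  let R := Bits (P.clientCoins n) × Bits (P.serverCoins n)
  let c := ClientSim.coinLength F Sim n
  -- the real view, the view with correct encrypted sets, the ideal views for `F` and for a random
  -- function
  let a₀ : ℝ := 𝔼 k : Bits n, 𝔼 ω : Fin 2 → Fin I.m → Bits (F.u n) → R,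
    D.val n (clientView2 P n I (k, ω) j i)
  let a₁ : ℝ := 𝔼 k : Bits n, 𝔼 ω : Bits (F.u n) → R,
    D.val n (clientContext S (fun t => (S' t).image (F.eval n k)) fun x =>
      P.clientView n k x (ω x).1 (ω x).2)
  let a₂ : ℝ := 𝔼 k : Bits n, 𝔼 w : Bits (F.u n) → Bits c,
    D.val n (idealView Sim n S S' (F.eval n k) w)
  let a₃ : ℝ := 𝔼 g : Bits (F.u n) → Bits (F.v n), 𝔼 w : Bits (F.u n) → Bits c,
    D.val n (idealView Sim n S S' g w)
  have h01 : |a₀ - a₁| ≤ (((2 * B * B).eval n : ℕ) : ℝ) * ε₁ n := by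
    refine abs_expect_sub_le fun k => ?_
    -- The corrected view uses only the coins of client `(j, i)`. Averaging over everyone's coins
    -- instead puts both views on one probability space.
    rw [← expect_eval₂ (A := Fin 2) (B := Fin I.m) j i fun ω : Bits (F.u n) → R =>
      D.val n (clientContext S (fun t => (S' t).image (F.eval n k)) fun x =>
        P.clientView n k x (ω x).1 (ω x).2)]
    refine (abs_expect_sub_le_prob (fun ω => ∃ a ∈ elements I,
      encElem P n I (k, ω) a.1 a.2.1 a.2.2 ≠ F.eval n k a.2.2) (fun ω => D.abs_val_sub_le_one n _ _)
      fun ω herr => ?_).trans ((prob_error_le P hcorr n I k).trans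
      (mul_le_mul_of_nonneg_right ?_ hε₁0))
    · push Not at herr
      have henc (t : Fin I.m) : encSet P n I (k, ω) (1 - j) t = (S' t).image (F.eval n k) :=
        Finset.image_congr fun x hx => herr (1 - j, t, x) (mem_elements.2 hx)
      have : clientView2 P n I (k, ω) j i = clientContext S (fun t => (S' t).image (F.eval n k))
          fun x => P.clientView n k x (ω j i x).1 (ω j i x).2 := by
        simp only [clientView2, henc]
        rfl
      rw [this]
    · have := card_elements_le hI
      simp only [Polynomial.eval_mul, Polynomial.eval_ofNat]
      exact_mod_cast this
  have h12 : |a₁ - a₂| ≤ ((B.eval n : ℕ) : ℝ) * ε₂ n := by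
    refine abs_expect_sub_le fun k => ?_
    have hsize (x : Bits (F.u n)) : (list [unary n, bits x, bits (F.eval n k x)]).size =
        2 * (n + F.u n + F.v n) + 7 := by
      simp only [list_cons, list_nil, size_cons, size_atom, size_unary, size_bits]
      omega
    have key := hhyb n (fun x : Bits (F.u n) => (k, x)) (fun x (r : R) => P.clientView n k x r.1 r.2)
      (fun x (r : Bits c) => Sim.run (.cons (list [unary n, bits x, bits (F.eval n k x)]) (bits r)))
      (clientContext S fun t => (S' t).image (F.eval n k)) S
      (fun x => PPT.dist_eq _ (by rw [hsize]; rfl)) (fun x => rfl)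
      (fun v v' => clientContext_congr _ _) (fun x hx v => isContext_clientContext _ _ v hx)
      (fun v hv => size_clientContext_le _ _ hI.1 (hI.2 j i)
        (fun t => Finset.card_image_le.trans (hI.2 _ _)) fun x => ?_)
    · exact key.trans (mul_le_mul_of_nonneg_right (by exact_mod_cast hI.2 j i) (hε₂0 n))
    · have hqn : q n = b₁ n + b₂ n + 1 := rfl
      rcases hv x with ⟨r, hr⟩ | ⟨r, hr⟩ | hr
      · rw [hr]
        have := hview n k x r.1 r.2
        omega
      · rw [hr]
        have := hrun n (list [unary n, bits x, bits (F.eval n k x)]) r (hsize x).le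
        omega
      · rw [hr, size_atom]
        omega
  have h23 : |a₂ - a₃| ≤ ε₃ n := by
    simp only [a₂, a₃]
    -- With the simulator's coins `w` outermost they can be fixed and given to the PRF adversary as
    -- advice.
    rw [Finset.expect_comm, Finset.expect_comm Finset.univ (Finset.univ : Finset (Bits (F.u n) → _))]
    exact abs_expect_sub_le fun w => hprf n S S' w hI.1 (hI.2 j i) (hI.2 (1 - j))
  have hreal : D.accept n (law fun ω => clientView2 P n I ω j i) = a₀ := by
    rw [D.accept_law, expect_prod]
  rw [ClientSim.accept_sim, hreal, abs_sub_comm]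
  have h02 := abs_sub_le a₀ a₁ a₂
  have h03 := abs_sub_le a₀ a₂ a₃
  change |a₀ - a₃| ≤ _
  linarith

end EGPSI

namespace EGPSI
open Data

/-! ## Correctness -/

section

variable {F : FunFamily}

/-- The probability that a function takes the same value at two given points. -/
theorem prob_random_collision {A R : Type} [Fintype A] [DecidableEq A] [Fintype R] [Nonempty R]
    {x x' : A} (h : x ≠ x') : prob (fun g : A → R => g x = g x') = (Fintype.card R : ℝ)⁻¹ := by
  classical
  -- Redraw the value at `x` while the value at `x'` stays fixed; exactly one outcome is a
  -- collision.
  rw [prob_eq_expect, expect_update x]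
  refine (Finset.expect_congr (g := fun _ => (Fintype.card R : ℝ)⁻¹) rfl fun g _ => ?_).trans
    (Fintype.expect_const _)
  simp only [Function.update_self, Function.update_of_ne h.symm]
  rw [Fintype.expect_eq_sum_div_card]
  simp

/-- The values of a pseudorandom function at two different points rarely coincide. -/
theorem FunFamily.IsPRF.exists_collision_bound (hF : F.IsPRF) : ∃ ε, Negligible ε ∧
    ∀ n (x x' : Bits (F.u n)), x ≠ x' →
      prob (fun k : Bits n => F.eval n k x = F.eval n k x') ≤ ((2 : ℝ) ^ F.v n)⁻¹ + ε n := by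
  -- The test for equality is done by the processing map `T`, so this distinguisher only reads off
  -- the resulting bit.
  let D : Distinguisher :=
    { advice := fun _ => .atom false
      advice_bound := ⟨1, fun n => by simp⟩
      test := fun _ z => z.truth
      polyTime := FP.id.snd.truth.reindex fun p : ℕ × Data => .cons (.atom false) p.2 }
  obtain ⟨ε, hε, -, h⟩ := hF.exists_bound D
    (T := fun _ ys => .atom (lexEq ys.fst.toList ys.snd.fst.toList))
    (FP.id.snd.fst.lexEq FP.id.snd.snd.fst) (PolyBdd.const _ 2)
  refine ⟨ε, hε, fun n x x' hx => ?_⟩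
  have hval (y y' : Bits (F.v n)) : D.val n (.atom (lexEq (bits y).toList (bits y').toList)) =
      if y = y' then 1 else 0 := by
    simp only [Distinguisher.val, D, truth_atom, lexEq_bits]
  have := h n [x, x'] (.atom false) le_rfl (by simp)
  simp only [List.map_cons, List.map_nil, list_cons, Data.fst, Data.snd, hval] at this
  have hk : prob (fun k : Bits n => F.eval n k x = F.eval n k x') =
      𝔼 k : Bits n, if F.eval n k x = F.eval n k x' then (1 : ℝ) else 0 := by
    rw [prob_eq_expect]
    exact Finset.expect_congr rfl fun k _ => by congr
  have hg := prob_random_collision (R := Bits (F.v n)) hx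
  rw [prob_eq_expect] at hg
  have hg' : 𝔼 g : Bits (F.u n) → Bits (F.v n), (if g x = g x' then (1 : ℝ) else 0) =
      ((2 : ℝ) ^ F.v n)⁻¹ := by
    refine Eq.trans (Finset.expect_congr rfl fun k _ => by congr) (hg.trans ?_)
    simp
  rw [hg', ← hk] at this
  linarith [(abs_le.1 this).2]

/-- Without errors of the OPRF and collisions, the clients compute the intersections. -/
theorem clientOut2_eq_fGPSI {P : OPRFProtocol F} {n : ℕ} {I : Inputs (F.u n)} {ω : Coins2 P n I}
    (herr : ∀ a ∈ elements I, encElem P n I ω a.1 a.2.1 a.2.2 = F.eval n ω.1 a.2.2)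
    (hinj : ∀ a ∈ elements I, ∀ a' ∈ elements I,
      F.eval n ω.1 a.2.2 = F.eval n ω.1 a'.2.2 → a.2.2 = a'.2.2)
    (j : Fin 2) (i : Fin I.m) : clientOut2 P n I ω j i = I.fGPSI j i := by
  funext t
  ext x
  simp only [clientOut2, Inputs.fGPSI, encSet, Finset.mem_filter, Finset.mem_inter,
    Finset.mem_image]
  refine and_congr_right fun hx => ⟨?_, fun hx' => ⟨x, hx', ?_⟩⟩
  · rintro ⟨y, hy, hyx⟩
    have ha : (1 - j, t, y) ∈ elements I := mem_elements.2 hy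
    have ha' : (j, i, x) ∈ elements I := mem_elements.2 hx
    have h := herr _ ha
    have h' := herr _ ha'
    have : y = x := hinj _ ha _ ha' (h.symm.trans (hyx.trans h'))
    rwa [← this]
  · exact (herr (1 - j, t, x) (mem_elements.2 hx')).trans
      (herr (j, i, x) (mem_elements.2 hx)).symm

theorem prob_or_le {Ω : Type} [Fintype Ω] [Nonempty Ω] (E E' : Ω → Prop) :
    prob (fun ω => E ω ∨ E' ω) ≤ prob E + prob E' := by
  classical
  simp only [prob_eq_expect]
  rw [← Finset.expect_add_distrib]
  refine Finset.expect_le_expect fun ω _ => ?_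
  by_cases h : E ω <;> by_cases h' : E' ω <;> simp [h, h']

theorem prob_prod_le {Ω Ω' : Type} [Fintype Ω] [Nonempty Ω] [Fintype Ω'] [Nonempty Ω']
    {E : Ω × Ω' → Prop} {δ : ℝ} (h : ∀ a, prob (fun b => E (a, b)) ≤ δ) : prob E ≤ δ := by
  rw [prob_eq_expect, expect_prod]
  refine Finset.expect_le Finset.univ_nonempty fun a _ => ?_
  have := h a
  rwa [prob_eq_expect] at this

theorem prob_fst {Ω Ω' : Type} [Fintype Ω] [Nonempty Ω] [Fintype Ω'] [Nonempty Ω']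
    (E : Ω → Prop) : prob (fun p : Ω × Ω' => E p.1) = prob E := by
  classical
  rw [prob_eq_expect, prob_eq_expect]
  exact expect_fst fun a => @ite ℝ (E a) (Classical.propDecidable _) 1 0

/-- Union bounds over the elements for wrong OPRF outputs and over pairs of elements for collisions.
-/
theorem egpsi2_correct {P : OPRFProtocol F} (hP : P.Secure)
    (hv : Negligible fun n => ((2 : ℝ) ^ F.v n)⁻¹) : (egpsi2 P).Correct := by
  classical
  intro B
  obtain ⟨ε₁, hε₁, hcorr⟩ := hP.correct
  obtain ⟨ε₂, hε₂, hcoll⟩ := hP.prf.exists_collision_bound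
  have hδ := hv.add hε₂
  refine ⟨fun n => (((2 * B * B).eval n : ℕ) : ℝ) * ε₁ n +
    ((((2 * B * B) * (2 * B * B)).eval n : ℕ) : ℝ) * |((2 : ℝ) ^ F.v n)⁻¹ + ε₂ n|,
    (hε₁.polynomial_mul _).add (hδ.abs.polynomial_mul _), fun n I hI => ?_⟩
  have hε₁0 : 0 ≤ ε₁ n := le_trans ENNReal.toReal_nonneg (hcorr n default default)
  have hcard : (elements I).card ≤ (2 * B * B).eval n := by
    simpa only [Polynomial.eval_mul, Polynomial.eval_ofNat] using card_elements_le hI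
  -- Pairs with equal strings are left out: a string held in both groups must encrypt to the same
  -- value.
  let T := ((elements I) ×ˢ (elements I)).filter fun q => q.1.2.2 ≠ q.2.2.2
  have hT : T.card ≤ ((2 * B * B) * (2 * B * B)).eval n := by
    refine (Finset.card_filter_le _ _).trans ?_
    rw [Finset.card_product, Polynomial.eval_mul]
    exact Nat.mul_le_mul hcard hcard
  let E₁ (ω : Coins2 P n I) : Prop :=
    ∃ a ∈ elements I, encElem P n I ω a.1 a.2.1 a.2.2 ≠ F.eval n ω.1 a.2.2
  let E₂ (k : Bits n) : Prop := ∃ q ∈ T, F.eval n k q.1.2.2 = F.eval n k q.2.2.2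
  have h₁ : prob E₁ ≤ (((2 * B * B).eval n : ℕ) : ℝ) * ε₁ n :=
    prob_prod_le fun k => (prob_error_le P hcorr n I k).trans
      (mul_le_mul_of_nonneg_right (by exact_mod_cast hcard) hε₁0)
  have h₂ : prob E₂ ≤
      ((((2 * B * B) * (2 * B * B)).eval n : ℕ) : ℝ) * |((2 : ℝ) ^ F.v n)⁻¹ + ε₂ n| := by
    refine (prob_exists_le_sum T fun q k => F.eval n k q.1.2.2 = F.eval n k q.2.2.2).trans
      ((Finset.sum_le_card_nsmul _ _ _ fun q hq =>
        (hcoll n _ _ (Finset.mem_filter.1 hq).2).trans (le_abs_self _)).trans ?_)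
    rw [nsmul_eq_mul]
    exact mul_le_mul_of_nonneg_right (by exact_mod_cast hT) (abs_nonneg _)
  have h₁₂ : prob (fun ω : Coins2 P n I => ∃ j i, clientOut2 P n I ω j i ≠ I.fGPSI j i) ≤
      prob fun ω : Coins2 P n I => E₁ ω ∨ E₂ ω.1 := by
    refine prob_mono fun ω => ?_
    rintro ⟨j, i, hne⟩
    by_contra hE
    rw [not_or] at hE
    refine hne (clientOut2_eq_fGPSI (fun a ha => ?_) (fun a ha a' ha' heq => ?_) j i)
    · by_contra h
      exact hE.1 ⟨a, ha, h⟩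
    · by_contra h
      exact hE.2 ⟨(a, a'), Finset.mem_filter.2 ⟨Finset.mem_product.2 ⟨ha, ha'⟩, h⟩, heq⟩
  refine h₁₂.trans ((prob_or_le _ _).trans (add_le_add h₁ ?_))
  rwa [prob_fst]

end

end EGPSI

theorem theorem2 (F : EGPSI.FunFamily) (P : EGPSI.OPRFProtocol F) (hP : P.Secure) :
    (EGPSI.egpsi2 P).SecurelyRealizes EGPSI.emptyLeakage ∧
    (EGPSI.Negligible (fun n => ((2 : ℝ) ^ F.v n)⁻¹) → (EGPSI.egpsi2 P).Correct) := by
  obtain ⟨SimC, hC⟩ := hP.client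
  obtain ⟨SimS, hS⟩ := hP.server
  exact ⟨⟨EGPSI.ClientSim.sim F SimC, EGPSI.TeeSim.sim SimS, fun B =>
    ⟨EGPSI.client_compIndist hP hC B, EGPSI.tee_compIndist hS B⟩⟩, EGPSI.egpsi2_correct hP⟩
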